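/- **Setting.** Write $\eta=(\eta_p,\eta_o)$, $\eta_p=(x,y,z)$, $\eta_o=(\phi,\theta,\psi)$, $\nu=(u,v,w,p,q,r)$, and let $\|\cdot\|$ be the Euclidean norm. *Vehicle.* $\dot\eta=J(\eta_o)\nu$, $\;M\dot\nu+\mu(\eta,\nu)+\tau^*=\Gamma\tau$, where $J=\mathrm{blkdiag}\{R,T\}$ is the roll–pitch–yaw Jacobian, $M=\mathrm{blkdiag}\{mI,I_o\}$ with $m>0$, $I_o\succ0$ (body frame at the centre of mass), $\Gamma=\mathrm{diag}\{1,\gamma_v,\gamma_w,1,1,1\}$ with $\gamma_v,\gamma_w\in\{0,1\}$, $\mu=\Delta\nu+{}$(arbitrary remaining forces), $\Delta=\mathrm{diag}\{\rho_u,\dots,\rho_r\}$ with positive entries, and $\tau^*(t)$ is bounded and Lipschitz. Put $M_\eta=J^{-\top}MJ^{-1}$, $\Gamma_\eta=J^{-\top}\Gamma J^{\top}$, $\Delta_\eta=J^{-\top}\Delta J^{-1}$, $\mu_\eta=J^{-\top}\mu-M_\eta\dot J\nu$, $\tau^*_\eta=J^{-\top}\tau^*$, $\tau_\eta=J^{-\top}\tau$.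 *Path.* $D\subset\mathbb R^3$ is open, $s_1,s_2$ are $C^3$ on $D$ with bounded derivatives of orders 1–3, $\underline m_j<\|\nabla s_j\|<\bar m_j$ on $D$ with $\underline m_j>0$, and the gradients are uniformly non-collinear: $|\nabla s_1\cdot\nabla s_2|\le c\,\|\nabla s_1\|\|\nabla s_2\|$ on $D$ for some $c<1$. Put $e_p=(s_1,s_2)$, $N_j=-\nabla s_j/\|\nabla s_j\|$, $\vartheta=\sigma\,N_1\times N_2/\|N_1\times N_2\|$, $u_d=\xi_dU$ with $U>0$, $\sigma,\xi_d\in\{-1,1\}$. For some $\underline m,\bar r>0$, the horizontal part of $\vartheta$ is longer than $\underline m$ at all points of $D$ with $\|e_p\|<\bar r$. The reference angles are $\phi_d=0$, $\psi_d=\mathrm{Atan2}(\xi_d\vartheta_y,\xi_d\vartheta_x)$, $\theta_d=\arctan(-\vartheta_z/(\vartheta_x\cos\psi_d+\vartheta_y\sin\psi_d))$, and $e_{2\pi}=(e_p,(\phi_d-\phi,\theta_d-\theta,\psi_d-\psi)\bmod 2\pi)$. *Controller.* Let $\nu_c=(u_c,0,0,p_c,q_c,r_c)$, $\eta_c(t)=\eta(0)+\int_0^tJ\nu_c$,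 $y=\eta_c-\eta$, $\varepsilon=\dot\eta_c-\dot\eta$, and let $\hat B$ be diagonal and invertible, $\hat B_\eta=J\hat BJ^\top$. The total disturbance is $d=\ddot\eta_c+M_\eta^{-1}(\mu_\eta+\tau_\eta^*)-M_\eta^{-1}\Gamma_\eta\tau_\eta+\hat B_\eta\Gamma_\eta\tau_\eta$, so that $\dot\varepsilon=d-J\hat B\Gamma\tau$, and $d^*=d+M_\eta^{-1}\Delta_\eta\varepsilon$. - ADR law: $\tau=\hat B^{-1}J^{-1}[\hat d+JKJ^{-1}\hat\varepsilon]$. - Observer: for each degree of freedom $i$, with bandwidth $\omega_i>0$, $\dot{\hat y}_i=\hat\varepsilon_i+3\omega_i(y_i-\hat y_i)$, $\dot{\hat\varepsilon}_i=\hat d_i-(J\hat B\Gamma\tau)_i+3\omega_i^2(y_i-\hat y_i)$, $\dot{\hat d}_i=\omega_i^3(y_i-\hat y_i)$. Put $\omega_o=\min_i\omega_i$ and $\tilde\chi=(y-\hat y,\varepsilon-\hat\varepsilon,d-\hat d)$. - VFO law: $h_p=u_d\vartheta+k_p(s_1N_1+s_2N_2)$, $\hat h=h_p+\delta_p\hat\varepsilon_p$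 (where $\hat\varepsilon_p$ is the translational part of $\hat\varepsilon$); $\psi_a$ is a continuous argument of $\xi_d(\hat h_x,\hat h_y)$, $\theta_a=\arctan(-\hat h_z/(\hat h_x\cos\psi_a+\hat h_y\sin\psi_a))$, $\bar e_a=(\theta_a-\theta,\psi_a-\psi)$; $u_c=\hat h_x\cos\theta\cos\psi+\hat h_y\cos\theta\sin\psi-\hat h_z\sin\theta$, $q_c=\hat{\dot\theta}_a+k_\theta(\theta_a-\theta)+\delta_o\hat\varepsilon_5$, $r_c=[\hat{\dot\psi}_a+k_\psi(\psi_a-\psi)+\delta_o\hat\varepsilon_6]\cos\theta$. Here $\hat{\dot\theta}_a,\hat{\dot\psi}_a$ are the time derivatives of $\theta_a,\psi_a$ computed with the estimate $\dot\eta_{pc}-\hat\varepsilon_p$ in place of $\dot\eta_p$. While $\hat h_x^2+\hat h_y^2<\varepsilon_f$, the values $\theta_a,\psi_a,\hat{\dot\theta}_a,\hat{\dot\psi}_a$ are frozen at their last previous values. - Roll stabiliser: $p_c=f_\phi(-\phi,\cdot)-\sin\phi\tan\theta\,q_c-\cos\phi\tan\theta\,r_c$ with an arbitrary feedback function $f_\phi$.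 Take $K=\mathrm{blkdiag}\{\frac{\rho}{m}I,k_oI\}$, $K_a=\mathrm{diag}\{k_\theta,k_\psi\}$, with $k_o,k_\theta,k_\psi,k_p>0$, $\delta_o\in[0,1]$, $\delta_p\in[0,1)$, where $\rho:=\rho_v=\rho_w$ are the (equal) sway and heave damping coefficients. **Local guarantee.** Fix the path, the gains, and bounds $r_{\dot d},r_{d^*}>0$. We say that the law *locally guarantees the bounds* $(\varepsilon_\eta,\varepsilon_p)$ if there is $\delta>0$, the same for all vehicles with $\rho_v=\rho_w=\rho$ and the given ratio $\rho/m$, all $\hat B$, $f_\phi$, $\tau^*$, with the following property. Consider any solution of the closed loop on $[0,\infty)$ with $\eta_p(t)\in D$ and $\theta(t)\in(-\frac\pi2,\frac\pi2)$, differentiable commanded velocity $\dot\eta_c$, $\sup_{t\ge0}\|\dot d\|\le r_{\dot d}$ (understood as: $d$ is $r_{\dot d}$-Lipschitz) and $\sup_{t\ge0}\|d^*\|\le r_{d^*}$, whose roll angle vanishes for all $t>T_0$ for some finite $T_0\ge0$. If at the instant $T_0$ each of $\|\tilde\chi\|,\|\varepsilon\|,\|\bar e_a\|,\|e_p\|$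 is less than $\delta$ (for $T_0=0$ these are the initial errors), then there is $T\ge0$ with $\|e_{2\pi}(t)\|\le\varepsilon_\eta$ and $\|e_p(t)\|\le\varepsilon_p$ for all $t\ge T$. **Proposition.** For every path as above there are $\varepsilon_0>0$ and positive functions $\varepsilon_\eta,\varepsilon_p$ of $(\omega_o,K,K_a,k_p,\delta_o,\delta_p,r_{\dot d},r_{d^*})$ such that, for every freezing threshold $\varepsilon_f\in(0,\varepsilon_0]$ and all $k_o>0$, $\delta_o\in[0,1]$, $\delta_p\in[0,1)$: 1. For all $k_\theta,k_\psi,k_p>0$ and all bandwidths $\omega_i>0$ there is $r_0>0$ such that for every $r_{d^*}>0$, if $\rho/m$ is large enough, then for all $0<r_{\dot d}\le r_0$ the law locally guarantees the bounds $(\varepsilon_\eta,\varepsilon_p)$, evaluated at these parameters. 2. For all $r_{\dot d},r_{d^*}>0$, if $\rho/m$ is large enough, then $\varepsilon_p$ can be made arbitrarily small: for every $\epsilon>0$, for all sufficiently large $k_p$, and then for all sufficiently large $\lambda_{\min}(K_a)$ and $\omega_o$, the law locally guarantees the bounds $(\varepsilon_\eta,\varepsilon_p)$, evaluated at these parameters,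 and $\varepsilon_p\le\epsilon$. -/

import Mathlib

open Matrix

namespace VFOADR

noncomputable section

/-! ### Vectors and vehicle kinematics -/

/-- The six degrees of freedom: `inl 0, inl 1, inl 2` are the translational ones (`x, y, z` in the
global frame, `u, v, w` in the body frame), `inr 0, inr 1, inr 2` the rotational ones
(`φ, θ, ψ`, respectively `p, q, r`). -/
abbrev DoF := Fin 3 ⊕ Fin 3

/-- Euclidean norm of a finite real vector. -/
def eNorm {ι : Type} [Fintype ι] (v : ι → ℝ) : ℝ := ‖WithLp.toLp 2 v‖

/-- First (translational) half of a six-dimensional vector. -/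
def pos (v : DoF → ℝ) : Fin 3 → ℝ := fun i => v (Sum.inl i)

def roll (η : DoF → ℝ) : ℝ := η (Sum.inr 0)
def pitch (η : DoF → ℝ) : ℝ := η (Sum.inr 1)
def yaw (η : DoF → ℝ) : ℝ := η (Sum.inr 2)

/-- Rotation matrix of the roll-pitch-yaw angles. -/
def rotMat (φ θ ψ : ℝ) : Matrix (Fin 3) (Fin 3) ℝ :=
  !![Real.cos ψ * Real.cos θ,
      Real.cos ψ * Real.sin φ * Real.sin θ - Real.cos φ * Real.sin ψ,
      Real.cos ψ * Real.cos φ * Real.sin θ + Real.sin φ * Real.sin ψ;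
    Real.sin ψ * Real.cos θ,
      Real.sin ψ * Real.sin φ * Real.sin θ + Real.cos φ * Real.cos ψ,
      Real.sin ψ * Real.cos φ * Real.sin θ - Real.sin φ * Real.cos ψ;
    -Real.sin θ, Real.sin φ * Real.cos θ, Real.cos φ * Real.cos θ]

/-- Transformation of the angular velocity into the rates of the roll-pitch-yaw angles. -/
def angMat (φ θ : ℝ) : Matrix (Fin 3) (Fin 3) ℝ :=
  !![1, Real.sin φ * Real.tan θ, Real.cos φ * Real.tan θ;
    0, Real.cos φ, -Real.sin φ;
    0, Real.sin φ / Real.cos θ, Real.cos φ / Real.cos θ]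

/-- The Jacobian `J = blkdiag {R, T}` of the kinematics `η' = J ν`. -/
def jac (η : DoF → ℝ) : Matrix DoF DoF ℝ :=
  fromBlocks (rotMat (roll η) (pitch η) (yaw η)) 0 0 (angMat (roll η) (pitch η))

/-! ### Reference path -/

/-- Four-quadrant inverse tangent with values in `[-π, π)`. -/
def atan2 (y x : ℝ) : ℝ := toIcoMod Real.two_pi_pos (-Real.pi) (Complex.arg ⟨x, y⟩)

/-- Data of the reference path: the domain `D` of admissible positions, the two level-surface
functions, the speed `U`, the forward/backward strategy `ξ = ±1` and the direction `σ = ±1`. -/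
structure RefPath where
  D : Set (Fin 3 → ℝ)
  s : Fin 2 → (Fin 3 → ℝ) → ℝ
  U : ℝ
  ξ : ℝ
  σ : ℝ

namespace RefPath

variable (P : RefPath)

/-- Reference velocity `u_d = ξ_d U`. -/
def ud : ℝ := P.ξ * P.U

/-- Gradient of the `j`-th level-surface function. -/
def grad (j : Fin 2) (p : Fin 3 → ℝ) : Fin 3 → ℝ :=
  fun i => fderiv ℝ (P.s j) p (Pi.single i 1)

/-- Unit vector normal to the `j`-th level surface. -/
def normal (j : Fin 2) (p : Fin 3 → ℝ) : Fin 3 → ℝ :=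
  -((eNorm (P.grad j p))⁻¹ • P.grad j p)

/-- Unit vector tangential to both level surfaces: `σ (N₁ × N₂)` brought to unit length. -/
def tangent (p : Fin 3 → ℝ) : Fin 3 → ℝ :=
  (P.σ * (eNorm (crossProduct (P.normal 0 p) (P.normal 1 p)))⁻¹) •
    crossProduct (P.normal 0 p) (P.normal 1 p)

/-- Positional path-following error `e_p = (s₁, s₂)`. -/
def ep (p : Fin 3 → ℝ) : Fin 2 → ℝ := fun j => P.s j p

/-- The standing assumptions on the reference path. -/
structure Admissible : Prop where
  isOpen_D : IsOpen P.D
  U_pos : 0 < P.U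
  xi_sign : P.ξ = 1 ∨ P.ξ = -1
  sigma_sign : P.σ = 1 ∨ P.σ = -1
  contDiffOn : ∀ j, ContDiffOn ℝ 3 (P.s j) P.D
  /-- The gradients have norms between two positive constants. -/
  grad_bounds : ∀ j, ∃ lo hi : ℝ, 0 < lo ∧
    ∀ p ∈ P.D, lo < eNorm (P.grad j p) ∧ eNorm (P.grad j p) < hi
  /-- The derivatives of orders one, two (the Hessian) and three are bounded. -/
  deriv_bounds : ∀ j, ∃ C : ℝ, ∀ p ∈ P.D, ∀ k : ℕ, 1 ≤ k → k ≤ 3 →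
    ‖iteratedFDeriv ℝ k (P.s j) p‖ ≤ C
  /-- The gradients are not collinear, uniformly: the cosine of the angle between them stays
  away from `±1`. -/
  noncollinear : ∃ c < (1 : ℝ), ∀ p ∈ P.D,
    |P.grad 0 p ⬝ᵥ P.grad 1 p| ≤ c * (eNorm (P.grad 0 p) * eNorm (P.grad 1 p))
  /-- In a tube around the path the tangent stays away from the vertical direction. -/
  nonvertical : ∃ m > (0 : ℝ), ∃ r > (0 : ℝ), ∀ p ∈ P.D, eNorm (P.ep p) < r →
    m < eNorm ![P.tangent p 0, P.tangent p 1]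

/-- Reference yaw angle. -/
def yawRef (p : Fin 3 → ℝ) : ℝ := atan2 (P.ξ * P.tangent p 1) (P.ξ * P.tangent p 0)

/-- Reference pitch angle. -/
def pitchRef (p : Fin 3 → ℝ) : ℝ :=
  Real.arctan (-P.tangent p 2 /
    (P.tangent p 0 * Real.cos (P.yawRef p) + P.tangent p 1 * Real.sin (P.yawRef p)))

/-- Orientation error `e_o = (φ_d - φ, θ_d - θ, ψ_d - ψ)` with `φ_d = 0`. -/
def eo (η : DoF → ℝ) : Fin 3 → ℝ :=
  ![0 - roll η, P.pitchRef (pos η) - pitch η, P.yawRef (pos η) - yaw η]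

/-- The path-following error with angles reduced modulo `2π` (to `[-π, π)`). -/
def e2pi (η : DoF → ℝ) : Fin 2 ⊕ Fin 3 → ℝ :=
  Sum.elim (P.ep (pos η)) (fun i => toIcoMod Real.two_pi_pos (-Real.pi) (P.eo η i))

/-- Longitudinal part `h_p = u_d ϑ_⊥ + k_p (s₁ N₁ + s₂ N₂)` of the convergence vector field. -/
def hp (kp : ℝ) (p : Fin 3 → ℝ) : Fin 3 → ℝ :=
  P.ud • P.tangent p + kp • (P.s 0 p • P.normal 0 p + P.s 1 p • P.normal 1 p)

end RefPath

/-! ### The vehicle -/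

/-- The vehicle: mass, rotational inertia, coefficients of the linear damping, the remaining
(Coriolis, centripetal, gravitational, restoring, nonlinear damping) forces, and the actuation
indicators of the sway and heave axes. -/
structure Vehicle where
  m : ℝ
  Io : Matrix (Fin 3) (Fin 3) ℝ
  damp : DoF → ℝ
  muRest : (DoF → ℝ) → (DoF → ℝ) → (DoF → ℝ)
  actV : ℝ
  actW : ℝ

namespace Vehicle

variable (V : Vehicle)

structure Admissible : Prop where
  m_pos : 0 < V.m
  Io_posDef : V.Io.PosDef
  damp_pos : ∀ i, 0 < V.damp i
  actV_mem : V.actV = 0 ∨ V.actV = 1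
  actW_mem : V.actW = 0 ∨ V.actW = 1

/-- Inertia matrix; the origin of the body frame is the centre of mass. -/
def M : Matrix DoF DoF ℝ := fromBlocks (V.m • (1 : Matrix (Fin 3) (Fin 3) ℝ)) 0 0 V.Io

/-- Input matrix; surge, roll, pitch and yaw are actuated. -/
def Γ : Matrix DoF DoF ℝ := diagonal (Sum.elim ![1, V.actV, V.actW] ![1, 1, 1])

/-- Matrix of the linear part of the environmental damping. -/
def Δ : Matrix DoF DoF ℝ := diagonal V.damp

/-- All the modelled forces, the linear damping included. -/
def mu (η ν : DoF → ℝ) : DoF → ℝ := V.Δ *ᵥ ν + V.muRest η ν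

end Vehicle

/-! ### The controller -/

/-- Design parameters: ADR gain `K`, `K_a = diag {k_θ, k_ψ}`, `k_p`, `δ_o`, `δ_p`. -/
structure Design where
  K : Matrix DoF DoF ℝ
  kθ : ℝ
  kψ : ℝ
  kp : ℝ
  δo : ℝ
  δp : ℝ

/-- The gain `K = blkdiag {κ I, k_o I}`. -/
def gainK (κ ko : ℝ) : Matrix DoF DoF ℝ :=
  fromBlocks (κ • (1 : Matrix (Fin 3) (Fin 3) ℝ)) 0 0 (ko • (1 : Matrix (Fin 3) (Fin 3) ℝ))

/-- Everything that is fixed in one run of the closed loop: path, vehicle, design parameters,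
observer bandwidths `ω i`, the diagonal `b` of the estimate of the inverse inertia matrix, the
threshold `εf` below which the auxiliary orientation is frozen, the feedback function
`fφ e_φ t` of the roll stabiliser, and the external disturbance `τ*`. -/
structure Setup where
  P : RefPath
  V : Vehicle
  G : Design
  ω : DoF → ℝ
  b : DoF → ℝ
  εf : ℝ
  fφ : ℝ → ℝ → ℝ
  τs : ℝ → DoF → ℝ

/-- The signals of the closed loop: configuration, pseudovelocity, commanded configuration, the
three parts of the observer state (estimates of `η_c - η`, of the velocity error `ε`, and of the
total disturbance `d`), and the auxiliary yaw angle. -/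
structure Signals where
  η : ℝ → DoF → ℝ
  ν : ℝ → DoF → ℝ
  ηc : ℝ → DoF → ℝ
  yh : ℝ → DoF → ℝ
  eh : ℝ → DoF → ℝ
  dh : ℝ → DoF → ℝ
  ψa : ℝ → ℝ

namespace Setup

variable (S : Setup) (X : Signals) (t : ℝ)

/-- Diagonal estimate of the inverse inertia matrix. -/
def Bhat : Matrix DoF DoF ℝ := diagonal S.b

/-- The ADR law `τ = B̂⁻¹ J⁻¹ (d̂ + K_η ε̂)` with `K_η = J K J⁻¹`. -/
def τ : DoF → ℝ :=
  S.Bhat⁻¹ *ᵥ ((jac (X.η t))⁻¹ *ᵥ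
    (X.dh t + (jac (X.η t) * S.G.K * (jac (X.η t))⁻¹) *ᵥ X.eh t))

/-- The input term `J B̂ Γ τ = J B̂ Γ Jᵀ τ_η`. -/
def input : DoF → ℝ := (jac (X.η t) * S.Bhat * S.V.Γ) *ᵥ S.τ X t

/-- The output `y = η_c - η` of the error-domain observer. -/
def y : DoF → ℝ := X.ηc t - X.η t

/-- Right-hand sides of the three groups of observer equations, gains `3ω, 3ω², ω³`. -/
def yhDot : DoF → ℝ := fun i => X.eh t i + 3 * S.ω i * (y X t i - X.yh t i)
def ehDot : DoF → ℝ := fun i =>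
  X.dh t i - S.input X t i + 3 * S.ω i ^ 2 * (y X t i - X.yh t i)
def dhDot : DoF → ℝ := fun i => S.ω i ^ 3 * (y X t i - X.yh t i)

/-- Longitudinal part `ĥ_p* = h_p + δ_p ε̂_p` of the modified convergence vector field. -/
def h : Fin 3 → ℝ := S.P.hp S.G.kp (pos (X.η t)) + S.G.δp • pos (X.eh t)

/-- Squared length of the horizontal part of `ĥ_p*`. -/
def horiz : ℝ := S.h X t 0 ^ 2 + S.h X t 1 ^ 2

/-- The nonnegative times at which the auxiliary orientation is not frozen. -/
def regular : Set ℝ := {s | 0 ≤ s ∧ S.εf ≤ S.horiz X s}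

/-- The last non-frozen time up to `t`; it is `t` itself when `t` is not frozen. -/
def lastReg : ℝ := sSup {s | s ∈ S.regular X ∧ s ≤ t}

/-- `ĥ_x* cos ψ_a + ĥ_y* sin ψ_a`. -/
def g : ℝ := S.h X t 0 * Real.cos (X.ψa t) + S.h X t 1 * Real.sin (X.ψa t)

/-- The auxiliary pitch angle (frozen when necessary). -/
def θa : ℝ := Real.arctan (-S.h X (S.lastReg X t) 2 / S.g X (S.lastReg X t))

/-- Auxiliary orientation error `ē_a`. -/
def ea : Fin 2 → ℝ := ![S.θa X t - pitch (X.η t), X.ψa t - yaw (X.η t)]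

/-- The commanded surge velocity. -/
def uc : ℝ :=
  S.h X t 0 * (Real.cos (pitch (X.η t)) * Real.cos (yaw (X.η t))) +
  S.h X t 1 * (Real.cos (pitch (X.η t)) * Real.sin (yaw (X.η t))) -
  S.h X t 2 * Real.sin (pitch (X.η t))

/-- Estimate `η'_pc - ε̂_p` of the translational velocity in the global frame. -/
def velHat : Fin 3 → ℝ :=
  rotMat (roll (X.η t)) (pitch (X.η t)) (yaw (X.η t)) *ᵥ ![S.uc X t, 0, 0] - pos (X.eh t)

/-- Estimate of the time derivative of `ĥ_p*`. The field `h_p` is differentiated along the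
estimated velocity; written out by the chain and quotient rules this gives the expressions in the
gradients and Hessians of the level-surface functions. -/
def hDotHat : Fin 3 → ℝ :=
  fderiv ℝ (S.P.hp S.G.kp) (pos (X.η t)) (S.velHat X t) + S.G.δp • pos (S.ehDot X t)

/-- Estimates of the derivatives of the auxiliary angles, before freezing. -/
def ψaDotRaw : ℝ :=
  (S.hDotHat X t 1 * S.h X t 0 - S.hDotHat X t 0 * S.h X t 1) / S.horiz X t
def θaDotRaw : ℝ :=
  -(S.hDotHat X t 2 * S.g X t -
      S.h X t 2 * (S.hDotHat X t 0 * Real.cos (X.ψa t) + S.hDotHat X t 1 * Real.sin (X.ψa t)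
        - S.h X t 0 * S.ψaDotRaw X t * Real.sin (X.ψa t)
        + S.h X t 1 * S.ψaDotRaw X t * Real.cos (X.ψa t))) /
    (S.h X t 2 ^ 2 + S.g X t ^ 2)

/-- Angular part `ĥ_o*` of the modified convergence vector field. -/
def hθ : ℝ := S.θaDotRaw X (S.lastReg X t) + S.G.kθ * S.ea X t 0 + S.G.δo * X.eh t (Sum.inr 1)
def hψ : ℝ := S.ψaDotRaw X (S.lastReg X t) + S.G.kψ * S.ea X t 1 + S.G.δo * X.eh t (Sum.inr 2)

/-- The commanded pitch and yaw rates. -/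
def qc : ℝ := S.hθ X t
def rc : ℝ := S.hψ X t * Real.cos (pitch (X.η t))

/-- The roll stabiliser; the roll error is `e_φ = 0 - φ`. -/
def pc : ℝ :=
  S.fφ (0 - roll (X.η t)) t
    - Real.sin (roll (X.η t)) * Real.tan (pitch (X.η t)) * S.qc X t
    - Real.cos (roll (X.η t)) * Real.tan (pitch (X.η t)) * S.rc X t

/-- The commanded pseudovelocity. -/
def νc : DoF → ℝ := Sum.elim ![S.uc X t, 0, 0] ![S.pc X t, S.qc X t, S.rc X t]

/-- The commanded velocity `η'_c = J ν_c` as a function of time. -/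
def ηcDot : DoF → ℝ := jac (X.η t) *ᵥ S.νc X t

/-- The velocity tracking error `ε = η'_c - η'`. -/
def ε : DoF → ℝ := S.ηcDot X t - jac (X.η t) *ᵥ X.ν t

/-- Entrywise time derivative of the Jacobian along the motion. -/
def jacDot : Matrix DoF DoF ℝ :=
  Matrix.of fun i j => derivWithin (fun s => jac (X.η s) i j) (Set.Ici 0) t

/-- The global-frame quantities `M_η = J⁻ᵀ M J⁻¹`, `M_η⁻¹ = J M⁻¹ Jᵀ`, `Γ_η = J⁻ᵀ Γ Jᵀ`,
`B̂_η = J B̂ Jᵀ`, `Δ_η = J⁻ᵀ Δ J⁻¹`, and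
`μ_η = J⁻ᵀ μ - M_η J' ν`, `τ*_η = J⁻ᵀ τ*`, `τ_η = J⁻ᵀ τ`. -/
def Mη : Matrix DoF DoF ℝ := (jac (X.η t))⁻¹ᵀ * S.V.M * (jac (X.η t))⁻¹
def MηInv : Matrix DoF DoF ℝ := jac (X.η t) * S.V.M⁻¹ * (jac (X.η t))ᵀ
def Γη : Matrix DoF DoF ℝ := (jac (X.η t))⁻¹ᵀ * S.V.Γ * (jac (X.η t))ᵀ
def Bη : Matrix DoF DoF ℝ := jac (X.η t) * S.Bhat * (jac (X.η t))ᵀ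
def Δη : Matrix DoF DoF ℝ := (jac (X.η t))⁻¹ᵀ * S.V.Δ * (jac (X.η t))⁻¹
def μη : DoF → ℝ :=
  (jac (X.η t))⁻¹ᵀ *ᵥ S.V.mu (X.η t) (X.ν t) - S.Mη X t *ᵥ (jacDot X t *ᵥ X.ν t)
def τsη : DoF → ℝ := (jac (X.η t))⁻¹ᵀ *ᵥ S.τs t
def τη : DoF → ℝ := (jac (X.η t))⁻¹ᵀ *ᵥ S.τ X t

/-- The total disturbance
`d = η''_c + M_η⁻¹ (μ_η + τ*_η) - M_η⁻¹ Γ_η τ_η + B̂_η Γ_η τ_η`. -/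
def d : DoF → ℝ :=
  derivWithin (S.ηcDot X) (Set.Ici 0) t + S.MηInv X t *ᵥ (S.μη X t + S.τsη X t)
    - S.MηInv X t *ᵥ (S.Γη X t *ᵥ S.τη X t) + S.Bη X t *ᵥ (S.Γη X t *ᵥ S.τη X t)

/-- The modified total disturbance `d* = d + M_η⁻¹ Δ_η ε`. -/
def dStar : DoF → ℝ := S.d X t + (S.MηInv X t * S.Δη X t) *ᵥ S.ε X t

/-- The observation error `χ̃ = (y - ŷ, ε - ε̂, d - d̂)` in `ℝ¹⁸`. -/
def χ : Fin 3 × DoF → ℝ := fun k =>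
  ![y X t k.2 - X.yh t k.2, S.ε X t k.2 - X.eh t k.2, S.d X t k.2 - X.dh t k.2] k.1

/-- The signals form a solution on `[0, ∞)` of the closed loop, with admissible
configurations. -/
structure IsSolution : Prop where
  mem_D : ∀ t ≥ 0, pos (X.η t) ∈ S.P.D
  pitch_mem : ∀ t ≥ 0, pitch (X.η t) ∈ Set.Ioo (-(Real.pi / 2)) (Real.pi / 2)
  kinematics : ∀ t ≥ 0, HasDerivWithinAt X.η (jac (X.η t) *ᵥ X.ν t) (Set.Ici 0) t
  dynamics : ∀ t ≥ 0, HasDerivWithinAt X.ν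
    (-(S.V.M⁻¹ *ᵥ (S.V.mu (X.η t) (X.ν t) + S.τs t)) + S.V.M⁻¹ *ᵥ (S.V.Γ *ᵥ S.τ X t))
    (Set.Ici 0) t
  commanded : ∀ t ≥ 0, HasDerivWithinAt X.ηc (S.ηcDot X t) (Set.Ici 0) t
  commanded_init : X.ηc 0 = X.η 0
  observer_y : ∀ t ≥ 0, HasDerivWithinAt X.yh (S.yhDot X t) (Set.Ici 0) t
  observer_e : ∀ t ≥ 0, HasDerivWithinAt X.eh (S.ehDot X t) (Set.Ici 0) t
  observer_d : ∀ t ≥ 0, HasDerivWithinAt X.dh (S.dhDot X t) (Set.Ici 0) t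
  /-- The auxiliary yaw angle is a continuous argument of `ξ_d (ĥ_x*, ĥ_y*)`, frozen while the
  latter is too short. -/
  yaw_aux : ∀ t ∈ S.regular X,
    S.P.ξ * S.h X t 0 = Real.sqrt (S.horiz X t) * Real.cos (X.ψa t) ∧
    S.P.ξ * S.h X t 1 = Real.sqrt (S.horiz X t) * Real.sin (X.ψa t)
  yaw_aux_cont : ContinuousOn X.ψa (S.regular X)
  yaw_aux_frozen : ∀ t ≥ 0, X.ψa t = X.ψa (S.lastReg X t)
  /-- The commanded velocity is differentiable, so that the total disturbance makes sense. -/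
  commanded_diff : DifferentiableOn ℝ (S.ηcDot X) (Set.Ici 0)

/-- The external disturbance is bounded and Lipschitz. -/
def DisturbanceAdmissible : Prop :=
  (∃ C : ℝ, ∀ t ≥ 0, eNorm (S.τs t) ≤ C) ∧
  (∃ L : ℝ, ∀ t ≥ 0, ∀ t' ≥ 0, eNorm (S.τs t - S.τs t') ≤ L * |t - t'|)

/-- `‖d'‖ ≤ rdd` and `‖d*‖ ≤ rds` on `[0, ∞)`. The first bound is expressed as a Lipschitz bound
for `d`, since `τ*`, hence `d`, need not be differentiable at every time. -/
def DisturbanceBounds (rdd rds : ℝ) : Prop :=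
  (∀ t ≥ 0, ∀ t' ≥ 0, eNorm (S.d X t - S.d X t') ≤ rdd * |t - t'|) ∧
  (∀ t ≥ 0, eNorm (S.dStar X t) ≤ rds)

end Setup

/-- With the path `P`, the freezing threshold `εf`, the bandwidths `ω`, and the gains `κ = ρ / m`,
`k_o`, `k_θ`, `k_ψ`, `k_p`, `δ_o`, `δ_p`, the control law locally guarantees the path-following
objectives with the ultimate bounds `boundη` and `boundp`, for every vehicle with transversal
damping coefficients `ρ = κ m`, whenever `‖d'‖ ≤ rdd` and `‖d*‖ ≤ rds`. The errors are taken at the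
instant `T₀` from which on the roll angle vanishes. -/
def LocallyGuarantees (P : RefPath) (εf : ℝ) (ω : DoF → ℝ) (κ ko kθ kψ kp δo δp rdd rds : ℝ)
    (boundη boundp : ℝ) : Prop :=
  ∃ r > (0 : ℝ), ∀ V : Vehicle, V.Admissible →
    V.damp (Sum.inl 1) = κ * V.m → V.damp (Sum.inl 2) = κ * V.m →
    ∀ b : DoF → ℝ, (∀ i, b i ≠ 0) → ∀ (fφ : ℝ → ℝ → ℝ) (τs : ℝ → DoF → ℝ) (S : Setup),
    S = ⟨P, V, ⟨gainK κ ko, kθ, kψ, kp, δo, δp⟩, ω, b, εf, fφ, τs⟩ →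
    S.DisturbanceAdmissible →
    ∀ X : Signals, S.IsSolution X → S.DisturbanceBounds X rdd rds →
    ∀ T₀ ≥ (0 : ℝ), (∀ t > T₀, roll (X.η t) = 0) →
      eNorm (S.χ X T₀) < r → eNorm (S.ε X T₀) < r → eNorm (S.ea X T₀) < r →
      eNorm (P.ep (pos (X.η T₀))) < r →
      (∃ T ≥ (0 : ℝ), ∀ t ≥ T, eNorm (P.e2pi (X.η t)) ≤ boundη) ∧
      (∃ T ≥ (0 : ℝ), ∀ t ≥ T, eNorm (P.ep (pos (X.η t))) ≤ boundp)

end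

end VFOADR

open VFOADR

/-! The closed loop is a cascade of stable subsystems, and the guarantee is an invariance statement.
Each stage contracts at a rate set by its gain and is driven by the residual errors of the earlier
stages. A signal that starts below the level at which contraction outweighs the drive never exceeds
that level. The radius `δ` is taken below all these levels, so every bound holds from `T₀` on and no
convergence has to be proved.

Stage 1, observer (`observer_bounds`): the error dynamics of each degree of freedom have a triple
pole at `-ω`, and the rate of `d` is the only drive. This gives errors `O(rdd / ω²)` in `ε` and
`O(rdd / ω)` in `d`.

Stage 2, velocity error (`eNorm_pos_ε_le`, `abs_ε_inr_le`): `B̂` cancels, and the ADR gain on the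
actuated translational axes equals the environmental damping rate `κ = ρ / m` on the unactuated
ones. The whole translational error thus decays at the rate `κ`, and what feedback cannot reach
contributes `rds / κ`. The rotational axes are fully actuated.

Stage 3, auxiliary orientation (`abs_ea_le`): the feedforward rates are exact up to the observation
error, multiplied by the derivative of `h_p`, of size `O(1 + k_p)`.

Stage 4, position (`abs_grad_dot_add_le`): the tangent is orthogonal to both normals, so along the
field `h_p` each `s_j` decays at a rate proportional to `k_p`, with a coupling to the other one that
the non-collinearity constant `c < 1` makes weaker than the decay in the maximum norm. The
perturbation consists of the errors of the earlier stages.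

Stages 3 and 4 depend on each other, since the orientation is controlled only where the field is not
frozen, which is known only in a tube around the path. A bootstrap on the tube
(`IsSolution.invariant`) closes the circle.

The outcome is `‖e_p‖ ≤ 2 C₀ Q / k_p`, where `Q` is `perturbBound`, provided that `Q` is below a
constant and below a multiple of `k_p` (`exists_locallyGuarantees_of_small`). Claim 1 makes `Q`
small through slow disturbances and large `κ`. Claim 2 keeps `Q` below a fixed constant through
large `κ` and fast observers, while `k_p` grows. -/

namespace VFOADR

/-! ### Euclidean norm of coordinate vectors -/

section eNorm

variable {ι : Type} [Fintype ι]

lemma eNorm_eq_sqrt (v : ι → ℝ) : eNorm v = Real.sqrt (v ⬝ᵥ v) := by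
  simp [eNorm, EuclideanSpace.norm_eq, dotProduct, sq]

lemma eNorm_nonneg (v : ι → ℝ) : 0 ≤ eNorm v := norm_nonneg _

lemma eNorm_sq (v : ι → ℝ) : eNorm v ^ 2 = v ⬝ᵥ v := by
  rw [eNorm_eq_sqrt, Real.sq_sqrt]
  exact Finset.sum_nonneg fun i _ => mul_self_nonneg _

lemma abs_le_eNorm (v : ι → ℝ) (i : ι) : |v i| ≤ eNorm v := by
  simpa [eNorm] using PiLp.norm_apply_le (WithLp.toLp 2 v) i

lemma abs_dotProduct_le (v w : ι → ℝ) : |v ⬝ᵥ w| ≤ eNorm v * eNorm w := by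
  have h := abs_real_inner_le_norm (WithLp.toLp 2 w : EuclideanSpace ℝ ι) (WithLp.toLp 2 v)
  simp only [EuclideanSpace.inner_toLp_toLp] at h
  simpa [eNorm, mul_comm] using h

lemma eNorm_add_le (v w : ι → ℝ) : eNorm (v + w) ≤ eNorm v + eNorm w := by
  simpa [eNorm] using norm_add_le (WithLp.toLp 2 v : EuclideanSpace ℝ ι) (WithLp.toLp 2 w)

lemma eNorm_sub_le (v w : ι → ℝ) : eNorm (v - w) ≤ eNorm v + eNorm w := by
  simpa [eNorm] using norm_sub_le (WithLp.toLp 2 v : EuclideanSpace ℝ ι) (WithLp.toLp 2 w)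

lemma eNorm_smul (c : ℝ) (v : ι → ℝ) : eNorm (c • v) = |c| * eNorm v := by
  simpa [eNorm] using norm_smul c (WithLp.toLp 2 v : EuclideanSpace ℝ ι)

lemma eNorm_le_of_dotProduct_le {v : ι → ℝ} {B : ℝ} (hB : 0 ≤ B) (h : v ⬝ᵥ v ≤ B ^ 2) :
    eNorm v ≤ B := by
  rw [← eNorm_sq] at h
  exact le_of_sq_le_sq h hB

lemma eNorm_le_sum (v : ι → ℝ) : eNorm v ≤ ∑ i, |v i| := by
  refine eNorm_le_of_dotProduct_le (Finset.sum_nonneg fun i _ => abs_nonneg _) ?_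
  calc v ⬝ᵥ v = ∑ i, |v i| ^ 2 := by simp [dotProduct, sq]
    _ ≤ (∑ i, |v i|) ^ 2 := Finset.sum_sq_le_sq_sum_of_nonneg fun i _ => abs_nonneg _

lemma eNorm_sum_elim_le {κ : Type} [Fintype κ] (v : ι → ℝ) (w : κ → ℝ) :
    eNorm (Sum.elim v w) ≤ eNorm v + eNorm w := by
  refine eNorm_le_of_dotProduct_le (add_nonneg (eNorm_nonneg _) (eNorm_nonneg _)) ?_
  have h : Sum.elim v w ⬝ᵥ Sum.elim v w = eNorm v ^ 2 + eNorm w ^ 2 := by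
    simp [eNorm_sq, dotProduct]
  nlinarith [eNorm_nonneg v, eNorm_nonneg w]

end eNorm

/-! ### Barrier and bootstrap arguments on the half-line -/

/-- The sign of the derivative is needed only at the instants when `f` is exactly at the level `B`,
which is what makes the later estimates usable: there the size of the signal is known. -/
lemma le_of_deriv_neg_at_barrier {f f' : ℝ → ℝ} {a b B : ℝ}
    (hf : ∀ x ∈ Set.Icc a b, HasDerivWithinAt f (f' x) (Set.Icc a b) x) (ha : f a ≤ B)
    (hB : ∀ x ∈ Set.Ico a b, f x = B → f' x < 0) : ∀ x ∈ Set.Icc a b, f x ≤ B := by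
  intro x hx
  refine image_le_of_deriv_right_lt_deriv_boundary' (f := f) (f' := f') (a := a) (b := b)
    (B := fun _ => B) (B' := fun _ => 0) (fun x hx => (hf x hx).continuousWithinAt) ?_ ha
    continuousOn_const (fun x _ => hasDerivWithinAt_const _ _ _) hB hx
  intro x hx
  exact (hf x ⟨hx.1, hx.2.le⟩).mono_of_mem_nhdsWithin (Icc_mem_nhdsGE_of_mem hx)

lemma abs_le_of_deriv_at_barrier {f f' : ℝ → ℝ} {a b B : ℝ}
    (hf : ∀ x ∈ Set.Icc a b, HasDerivWithinAt f (f' x) (Set.Icc a b) x) (ha : |f a| ≤ B)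
    (hB : ∀ x ∈ Set.Ico a b, f x = B → f' x < 0)
    (hB' : ∀ x ∈ Set.Ico a b, f x = -B → 0 < f' x) : ∀ x ∈ Set.Icc a b, |f x| ≤ B := by
  intro x hx
  rw [abs_le] at ha ⊢
  refine ⟨?_, le_of_deriv_neg_at_barrier hf ha.2 hB x hx⟩
  have := le_of_deriv_neg_at_barrier (f := fun x => -f x) (f' := fun x => -f' x) (B := B)
    (fun x hx => (hf x hx).neg) (by linarith)
    (fun x hx h => by have := hB' x hx (by linarith); linarith) x hx
  linarith

/-- At `|f| = B` the term `-k f` outweighs the drive `u`. This replaces variation of constants, and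
`u` needs no regularity. -/
lemma abs_le_of_linear_ode {f u : ℝ → ℝ} {a b B k : ℝ}
    (hf : ∀ x ∈ Set.Icc a b, HasDerivWithinAt f (-k * f x + u x) (Set.Icc a b) x)
    (ha : |f a| ≤ B) (hu : ∀ x ∈ Set.Icc a b, |u x| < k * B) :
    ∀ x ∈ Set.Icc a b, |f x| ≤ B := by
  refine abs_le_of_deriv_at_barrier hf ha ?_ ?_
  · intro x hx h
    have := (abs_lt.1 (hu x ⟨hx.1, hx.2.le⟩)).2
    rw [h]; linarith
  · intro x hx h
    have := (abs_lt.1 (hu x ⟨hx.1, hx.2.le⟩)).1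
    rw [h]; linarith

/-- At the first instant with `f ≥ B`, the weak bound holds up to and including that instant by
continuity, so the self-improvement hypothesis gives a contradiction. -/
lemma forall_lt_of_bootstrap {f : ℝ → ℝ} {a B : ℝ} (hf : ContinuousOn f (Set.Ici a))
    (ha : f a < B) (h : ∀ t ≥ a, (∀ s ∈ Set.Icc a t, f s ≤ B) → f t < B) :
    ∀ t ≥ a, f t < B := by
  by_contra hcon
  push Not at hcon
  obtain ⟨t₁, ht₁, hBt₁⟩ := hcon
  set Z : Set ℝ := {t | t ∈ Set.Icc a t₁ ∧ B ≤ f t} with hZ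
  have hZc : IsClosed Z := by
    have hc : ContinuousOn f (Set.Icc a t₁) := hf.mono Set.Icc_subset_Ici_self
    exact hc.preimage_isClosed_of_isClosed isClosed_Icc isClosed_Ici
  have hne : Z.Nonempty := ⟨t₁, ⟨ht₁, le_rfl⟩, hBt₁⟩
  have hbdd : BddBelow Z := ⟨a, fun t ht => ht.1.1⟩
  have hmem := hZc.csInf_mem hne hbdd
  set τ := sInf Z
  have hlt : ∀ s, a ≤ s → s < τ → f s < B := by
    intro s has hs
    by_contra hc
    exact absurd (csInf_le hbdd ⟨⟨has, hs.le.trans hmem.1.2⟩, not_lt.1 hc⟩) (not_le.2 hs)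
  have haτ : a < τ := by
    rcases eq_or_lt_of_le hmem.1.1 with h' | h'
    · exact absurd hmem.2 (not_le.2 (h' ▸ ha))
    · exact h'
  have hle : f τ ≤ B := by
    have hc : ContinuousWithinAt f (Set.Ico a τ) τ :=
      (hf τ haτ.le).mono fun x hx => hx.1
    have hcl : τ ∈ closure (Set.Ico a τ) := by
      rw [closure_Ico haτ.ne]; exact ⟨haτ.le, le_rfl⟩
    exact hc.closure_le hcl continuousWithinAt_const fun s hs => (hlt s hs.1 hs.2).le
  refine absurd (h τ haτ.le ?_) (not_lt.2 hmem.2)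
  intro s hs
  rcases eq_or_lt_of_le hs.2 with h' | h'
  · exact h' ▸ hle
  · exact (hlt s hs.1 h').le

/-! ### The third-order observer of one degree of freedom -/

/-- A first-order low-pass filter driven by the increments of a Lipschitz signal `d`. -/
lemma abs_filter_le {g d : ℝ → ℝ} {a b ω L : ℝ} (hab : a ≤ b) (hω : 0 < ω) (hL : 0 ≤ L)
    (hd : ∀ t ∈ Set.Icc a b, |d b - d t| ≤ L * (b - t))
    (hg : ∀ t ∈ Set.Icc a b, HasDerivWithinAt g (-ω * (g t + d t)) (Set.Icc a b) t) :
    |g b + d b| ≤ |g a + d a| + L / ω := by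
  -- An integrating factor is used with `d` frozen at its final value, since `d` need not be
  -- differentiable. The weighted quantity has derivative `ω exp (ω (x - b)) (d b - d x)`, at most
  -- `L ω exp (ω (x - b)) (b - x)` in absolute value, which is the derivative of `L exp (ω (x - b))
  -- (b - x + 1 / ω)`. At `x = b` the latter leaves `L / ω`.
  have key : ∀ x ∈ Set.Icc a b, ‖Real.exp (ω * (x - b)) * (g x + d b)‖ ≤
      Real.exp (ω * (a - b)) * (|g a + d a| + L * (b - a)) +
        L * Real.exp (ω * (x - b)) * (b - x + 1 / ω)
        - L * Real.exp (ω * (a - b)) * (b - a + 1 / ω) := by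
    intro x hx
    refine image_norm_le_of_norm_deriv_right_le_deriv_boundary'
      (f := fun x => Real.exp (ω * (x - b)) * (g x + d b))
      (f' := fun x => Real.exp (ω * (x - b)) * ω * (g x + d b) +
        Real.exp (ω * (x - b)) * (-ω * (g x + d x)))
      (B := fun x => Real.exp (ω * (a - b)) * (|g a + d a| + L * (b - a)) +
        L * Real.exp (ω * (x - b)) * (b - x + 1 / ω)
        - L * Real.exp (ω * (a - b)) * (b - a + 1 / ω))
      (B' := fun x => L * (Real.exp (ω * (x - b)) * ω) * (b - x + 1 / ω) +
        L * Real.exp (ω * (x - b)) * (-1)) ?_ ?_ ?_ ?_ ?_ ?_ hx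
    · intro y hy
      have := (hg y hy).continuousWithinAt
      fun_prop
    · intro y hy
      have h1 : HasDerivWithinAt g (-ω * (g y + d y)) (Set.Ici y) y :=
        (hg y ⟨hy.1, hy.2.le⟩).mono_of_mem_nhdsWithin (Icc_mem_nhdsGE_of_mem hy)
      have h2 : HasDerivAt (fun x => Real.exp (ω * (x - b))) (Real.exp (ω * (y - b)) * ω) y := by
        have := (((hasDerivAt_id y).sub_const b).const_mul ω).exp
        simpa using this
      exact h2.hasDerivWithinAt.mul (h1.add_const (d b))
    · have h2 : |g a + d b| ≤ |g a + d a| + L * (b - a) := by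
        have h3 := hd a ⟨le_rfl, hab⟩
        have : g a + d b = (g a + d a) + (d b - d a) := by ring
        rw [this]; exact (abs_add_le _ _).trans (by linarith)
      rw [norm_mul, Real.norm_eq_abs, Real.norm_eq_abs, abs_of_pos (Real.exp_pos _),
        add_sub_cancel_right]
      gcongr
    · fun_prop
    · intro y _
      have h2 : HasDerivAt (fun x => Real.exp (ω * (x - b))) (Real.exp (ω * (y - b)) * ω) y := by
        have := (((hasDerivAt_id y).sub_const b).const_mul ω).exp
        simpa using this
      have h3 : HasDerivAt (fun x => b - x + 1 / ω) (-1) y := by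
        simpa using ((hasDerivAt_id y).const_sub b).add_const (1 / ω)
      exact ((((h2.const_mul L).mul h3).const_add
        (Real.exp (ω * (a - b)) * (|g a + d a| + L * (b - a)))).sub_const _).hasDerivWithinAt
    · intro y hy
      have h1 := hd y ⟨hy.1, hy.2.le⟩
      have h2 : Real.exp (ω * (y - b)) * ω * (g y + d b) +
        Real.exp (ω * (y - b)) * (-ω * (g y + d y)) =
        Real.exp (ω * (y - b)) * ω * (d b - d y) := by ring
      rw [h2, Real.norm_eq_abs, abs_mul, abs_of_pos (by positivity)]
      calc Real.exp (ω * (y - b)) * ω * |d b - d y|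
          ≤ Real.exp (ω * (y - b)) * ω * (L * (b - y)) := by gcongr
        _ = _ := by field_simp; ring
  have h := key b ⟨hab, le_rfl⟩
  have hE : Real.exp (ω * (a - b)) ≤ 1 := by
    rw [Real.exp_le_one_iff]; nlinarith
  have h1 : Real.exp (ω * (a - b)) * |g a + d a| ≤ |g a + d a| :=
    mul_le_of_le_one_left (abs_nonneg _) hE
  have h2 : 0 ≤ L * Real.exp (ω * (a - b)) * (1 / ω) := by positivity
  simp only [sub_self, mul_zero, Real.exp_zero, one_mul, zero_add, mul_one,
    Real.norm_eq_abs] at h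
  have h3 : L * (1 / ω) = L / ω := by ring
  nlinarith

/-- Error bounds of the third-order observer of a double integrator with bandwidth `ω` and an
`L`-Lipschitz disturbance `d`, after an instant with small errors. -/
lemma observer_bounds {y e d dh : ℝ → ℝ} {a b ω L r : ℝ} (hab : a ≤ b) (hω : 0 < ω) (hL : 0 < L)
    (hd : ∀ s ∈ Set.Icc a b, ∀ t ∈ Set.Icc a b, |d s - d t| ≤ L * |s - t|)
    (hy : ∀ t ∈ Set.Icc a b, HasDerivWithinAt y (e t - 3 * ω * y t) (Set.Icc a b) t)
    (he : ∀ t ∈ Set.Icc a b, HasDerivWithinAt e (d t - dh t - 3 * ω ^ 2 * y t) (Set.Icc a b) t)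
    (hdh : ∀ t ∈ Set.Icc a b, HasDerivWithinAt dh (ω ^ 3 * y t) (Set.Icc a b) t)
    (hy0 : |y a| ≤ r) (he0 : |e a| ≤ r) (hd0 : |d a - dh a| ≤ r)
    (hrω : r * (1 + ω + ω ^ 2) * ω ≤ L) :
    |e b| ≤ 11 * L / ω ^ 2 ∧ |d b - dh b| ≤ 9 * L / ω := by
  have hr0 : 0 ≤ r := (abs_nonneg _).trans hy0
  -- With `d̃ = d - dh`, the coordinates `y`, `e - 2ωy` and `d̃ - ωe + ω²y` turn the triple pole
  -- into a chain of first-order filters of rate `ω`, each driven by the next, the last one by the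
  -- increments of `d`. The levels `4L/ω³`, `3L/ω²`, `2L/ω` have increasing constants along the
  -- chain, so that each barrier is strict. Transforming back gives `3 + 2 · 4 = 11` and `2 + 3 + 4
  -- = 9`.
  have h3 : ∀ t ∈ Set.Icc a b, |d t - dh t - ω * e t + ω ^ 2 * y t| ≤ 2 * L / ω := by
    intro t ht
    have hsub : Set.Icc a t ⊆ Set.Icc a b := Set.Icc_subset_Icc_right ht.2
    have := abs_filter_le (g := fun t => -dh t - ω * e t + ω ^ 2 * y t) (d := d) (a := a) (b := t)
      (ω := ω) (L := L) ht.1 hω hL.le ?_ ?_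
    · have h4 : |-dh a - ω * e a + ω ^ 2 * y a + d a| ≤ r * (1 + ω + ω ^ 2) := by
        rw [abs_le] at hy0 he0 hd0 ⊢
        constructor <;> nlinarith [sq_nonneg ω]
      have h5 : r * (1 + ω + ω ^ 2) ≤ L / ω := by
        rw [le_div_iff₀ hω]; exact hrω
      have h6 : d t - dh t - ω * e t + ω ^ 2 * y t = -dh t - ω * e t + ω ^ 2 * y t + d t := by ring
      rw [h6]
      calc _ ≤ _ := this
        _ ≤ L / ω + L / ω := by linarith
        _ = _ := by ring
    · intro s hs
      have := hd t ht s (hsub hs)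
      rwa [abs_of_nonneg (sub_nonneg.2 hs.2)] at this
    · intro s hs
      have := (((hdh s (hsub hs)).neg.sub ((he s (hsub hs)).const_mul ω)).add
        ((hy s (hsub hs)).const_mul (ω ^ 2))).mono hsub
      refine this.congr_deriv ?_
      ring
  have h2 : ∀ t ∈ Set.Icc a b, |e t - 2 * ω * y t| ≤ 3 * L / ω ^ 2 := by
    refine abs_le_of_linear_ode (k := ω)
      (u := fun t => d t - dh t - ω * e t + ω ^ 2 * y t) ?_ ?_ ?_
    · intro t ht
      exact ((he t ht).sub ((hy t ht).const_mul (2 * ω))).congr_deriv (by ring)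
    · rw [le_div_iff₀ (by positivity)]
      have : |e a - 2 * ω * y a| ≤ r * (1 + 2 * ω) := by
        rw [abs_le] at hy0 he0 ⊢
        constructor <;> nlinarith
      calc |e a - 2 * ω * y a| * ω ^ 2 ≤ r * (1 + 2 * ω) * ω ^ 2 := by gcongr
        _ ≤ 3 * (r * (1 + ω + ω ^ 2) * ω) := by
          nlinarith [mul_nonneg hr0 hω.le, mul_nonneg (mul_nonneg hr0 hω.le) hω.le,
            mul_nonneg (mul_nonneg (mul_nonneg hr0 hω.le) hω.le) hω.le]
        _ ≤ 3 * L := by linarith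
    · intro t ht
      refine (h3 t ht).trans_lt ?_
      have : ω * (3 * L / ω ^ 2) = 3 * L / ω := by field_simp
      rw [this]; gcongr; norm_num
  have h1 : ∀ t ∈ Set.Icc a b, |y t| ≤ 4 * L / ω ^ 3 := by
    refine abs_le_of_linear_ode (k := ω) (u := fun t => e t - 2 * ω * y t) ?_ ?_ ?_
    · intro t ht
      exact (hy t ht).congr_deriv (by ring)
    · rw [le_div_iff₀ (by positivity)]
      calc |y a| * ω ^ 3 ≤ r * ω ^ 3 := by gcongr
        _ ≤ r * (1 + ω + ω ^ 2) * ω := by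
          nlinarith [mul_nonneg hr0 hω.le, mul_nonneg (mul_nonneg hr0 hω.le) hω.le]
        _ ≤ 4 * L := by linarith
    · intro t ht
      refine (h2 t ht).trans_lt ?_
      have : ω * (4 * L / ω ^ 3) = 4 * L / ω ^ 2 := by field_simp
      rw [this]; gcongr; norm_num
  have hb : b ∈ Set.Icc a b := ⟨hab, le_rfl⟩
  have g1 := h1 b hb
  have g2 := h2 b hb
  have g3 := h3 b hb
  have k1 : ω * |y b| ≤ 4 * L / ω ^ 2 := by
    calc ω * |y b| ≤ ω * (4 * L / ω ^ 3) := by gcongr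
      _ = _ := by field_simp
  have k2 : ω * |e b - 2 * ω * y b| ≤ 3 * L / ω := by
    calc ω * |e b - 2 * ω * y b| ≤ ω * (3 * L / ω ^ 2) := by gcongr
      _ = _ := by field_simp
  have k3 : ω ^ 2 * |y b| ≤ 4 * L / ω := by
    calc ω ^ 2 * |y b| ≤ ω ^ 2 * (4 * L / ω ^ 3) := by gcongr
      _ = _ := by field_simp
  constructor
  · calc |e b| = |(e b - 2 * ω * y b) + 2 * (ω * y b)| := by congr 1; ring
      _ ≤ |e b - 2 * ω * y b| + 2 * (ω * |y b|) := by
        refine (abs_add_le _ _).trans ?_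
        rw [abs_mul 2, abs_mul ω, abs_of_pos hω, abs_two]
      _ ≤ 3 * L / ω ^ 2 + 2 * (4 * L / ω ^ 2) := by gcongr
      _ = _ := by ring
  · calc |d b - dh b| = |(d b - dh b - ω * e b + ω ^ 2 * y b) + ω * (e b - 2 * ω * y b)
          + ω ^ 2 * y b| := by congr 1; ring
      _ ≤ |d b - dh b - ω * e b + ω ^ 2 * y b| + ω * |e b - 2 * ω * y b| + ω ^ 2 * |y b| := by
        refine (abs_add_three _ _ _).trans ?_
        rw [abs_mul, abs_mul (ω ^ 2), abs_of_pos hω, abs_of_pos (by positivity : 0 < ω ^ 2)]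
      _ ≤ 2 * L / ω + 3 * L / ω + 4 * L / ω := by gcongr
      _ = _ := by ring

/-! ### The Jacobian of the kinematics -/

lemma rotMat_mul_transpose (φ θ ψ : ℝ) : rotMat φ θ ψ * (rotMat φ θ ψ)ᵀ = 1 := by
  have h1 := Real.sin_sq_add_cos_sq φ
  have h2 := Real.sin_sq_add_cos_sq θ
  have h3 := Real.sin_sq_add_cos_sq ψ
  have e1 : Real.sin φ ^ 2 = 1 - Real.cos φ ^ 2 := by linarith
  have e2 : Real.sin θ ^ 2 = 1 - Real.cos θ ^ 2 := by linarith
  have e3 : Real.sin ψ ^ 2 = 1 - Real.cos ψ ^ 2 := by linarith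
  ext i j
  fin_cases i <;> fin_cases j <;>
    simp [rotMat, Matrix.mul_apply, Fin.sum_univ_three] <;> ring_nf <;>
    simp only [e1, e2, e3] <;> ring

lemma det_angMat {φ θ : ℝ} (hθ : Real.cos θ ≠ 0) : (angMat φ θ).det = (Real.cos θ)⁻¹ := by
  rw [det_fin_three]
  simp [angMat]
  field_simp
  linarith [Real.sin_sq_add_cos_sq φ]

lemma isUnit_det_jac {η : DoF → ℝ} (hθ : Real.cos (pitch η) ≠ 0) : IsUnit (jac η).det := by
  rw [jac, det_fromBlocks_zero₂₁, IsUnit.mul_iff]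
  refine ⟨?_, ?_⟩
  · exact (Matrix.isUnit_iff_isUnit_det _).1
      (IsUnit.of_mul_eq_one _ (rotMat_mul_transpose _ _ _))
  · rw [det_angMat hθ]; exact (inv_ne_zero hθ).isUnit

lemma jac_inv {η : DoF → ℝ} (hθ : Real.cos (pitch η) ≠ 0) :
    (jac η)⁻¹ = fromBlocks (rotMat (roll η) (pitch η) (yaw η))ᵀ 0 0
      (angMat (roll η) (pitch η))⁻¹ := by
  refine inv_eq_right_inv ?_
  rw [jac, fromBlocks_multiply, rotMat_mul_transpose, mul_nonsing_inv]
  · simp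
  · rw [det_angMat hθ]; exact (inv_ne_zero hθ).isUnit

lemma differentiableWithinAt_rotMat {a b c : ℝ → ℝ} {s : Set ℝ} {t : ℝ}
    (ha : DifferentiableWithinAt ℝ a s t) (hb : DifferentiableWithinAt ℝ b s t)
    (hc : DifferentiableWithinAt ℝ c s t) (i j : Fin 3) :
    DifferentiableWithinAt ℝ (fun s => rotMat (a s) (b s) (c s) i j) s t := by
  have h1 := ha.sin
  have h2 := ha.cos
  have h3 := hb.sin
  have h4 := hb.cos
  have h5 := hc.sin
  have h6 := hc.cos
  match i, j with
  | 0, 0 => exact h6.mul h4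
  | 0, 1 => exact ((h6.mul h1).mul h3).sub (h2.mul h5)
  | 0, 2 => exact ((h6.mul h2).mul h3).add (h1.mul h5)
  | 1, 0 => exact h5.mul h4
  | 1, 1 => exact ((h5.mul h1).mul h3).add (h2.mul h6)
  | 1, 2 => exact ((h5.mul h2).mul h3).sub (h1.mul h6)
  | 2, 0 => exact h3.neg
  | 2, 1 => exact h1.mul h4
  | 2, 2 => exact h2.mul h4

lemma differentiableWithinAt_angMat {a b : ℝ → ℝ} {s : Set ℝ} {t : ℝ}
    (ha : DifferentiableWithinAt ℝ a s t) (hb : DifferentiableWithinAt ℝ b s t)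
    (h : Real.cos (b t) ≠ 0) (i j : Fin 3) :
    DifferentiableWithinAt ℝ (fun s => angMat (a s) (b s) i j) s t := by
  have h1 := ha.sin
  have h2 := ha.cos
  have h3 := hb.cos
  have h4 : DifferentiableWithinAt ℝ (fun s => Real.tan (b s)) s t :=
    (Real.differentiableAt_tan.2 h).comp_differentiableWithinAt t hb
  match i, j with
  | 0, 0 => exact differentiableWithinAt_const 1
  | 0, 1 => exact h1.mul h4
  | 0, 2 => exact h2.mul h4
  | 1, 0 => exact differentiableWithinAt_const 0
  | 1, 1 => exact h2
  | 1, 2 => exact h1.neg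
  | 2, 0 => exact differentiableWithinAt_const 0
  | 2, 1 => exact h1.div h3 h
  | 2, 2 => exact h2.div h3 h

lemma differentiableWithinAt_jac {η : ℝ → DoF → ℝ} {s : Set ℝ} {t : ℝ}
    (h : DifferentiableWithinAt ℝ η s t) (hθ : Real.cos (pitch (η t)) ≠ 0) (i j : DoF) :
    DifferentiableWithinAt ℝ (fun s => jac (η s) i j) s t := by
  have hi : ∀ k, DifferentiableWithinAt ℝ (fun s => η s k) s t := differentiableWithinAt_pi.1 h
  rcases i with i | i <;> rcases j with j | j
  · exact differentiableWithinAt_rotMat (hi _) (hi _) (hi _) i j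
  · exact differentiableWithinAt_const 0
  · exact differentiableWithinAt_const 0
  · exact differentiableWithinAt_angMat (hi _) (hi _) hθ i j

lemma hasDerivWithinAt_mulVec {A : ℝ → Matrix DoF DoF ℝ} {A' : Matrix DoF DoF ℝ}
    {v : ℝ → DoF → ℝ} {v' : DoF → ℝ} {s : Set ℝ} {t : ℝ}
    (hA : ∀ i j, HasDerivWithinAt (fun s => A s i j) (A' i j) s t)
    (hv : HasDerivWithinAt v v' s t) :
    HasDerivWithinAt (fun s => A s *ᵥ v s) (A' *ᵥ v t + A t *ᵥ v') s t := by
  rw [hasDerivWithinAt_pi] at hv ⊢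
  intro i
  have := HasDerivWithinAt.fun_sum (u := Finset.univ) (fun j _ => (hA i j).mul (hv j))
  refine this.congr_deriv ?_
  simp [mulVec, dotProduct, Finset.sum_add_distrib]

/-! ### The vehicle in the global frame -/

namespace Vehicle

variable {V : Vehicle}

lemma Admissible.isUnit_det_Io (hV : V.Admissible) : IsUnit V.Io.det :=
  (Matrix.isUnit_iff_isUnit_det _).1 (PosDef.isUnit hV.Io_posDef)

lemma M_inv (hV : V.Admissible) :
    V.M⁻¹ = fromBlocks (V.m⁻¹ • (1 : Matrix (Fin 3) (Fin 3) ℝ)) 0 0 V.Io⁻¹ := by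
  have hm : V.m ≠ 0 := hV.m_pos.ne'
  refine inv_eq_right_inv ?_
  rw [M, fromBlocks_multiply, mul_nonsing_inv _ hV.isUnit_det_Io]
  simp [hm, fromBlocks_one]

lemma M_inv_mul_M (hV : V.Admissible) : V.M⁻¹ * V.M = 1 := by
  have hm : V.m ≠ 0 := hV.m_pos.ne'
  rw [M_inv hV, M, fromBlocks_multiply, nonsing_inv_mul _ hV.isUnit_det_Io]
  simp [hm, fromBlocks_one]

end Vehicle

namespace Setup

variable {S : Setup} {X : Signals} {t : ℝ}

lemma IsSolution.cos_pitch_pos (h : S.IsSolution X) (ht : 0 ≤ t) :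
    0 < Real.cos (pitch (X.η t)) := Real.cos_pos_of_mem_Ioo (h.pitch_mem t ht)

/-- `B̂` and `Γ` are diagonal, hence commute, and the estimate `B̂` cancels. Its mismatch with the
true inertia survives only inside `d`, whose bounds are assumed; this is why the radius can be
uniform in `B̂`. -/
lemma input_eq (hb : ∀ i, S.b i ≠ 0) :
    S.input X t = (jac (X.η t) * S.V.Γ * (jac (X.η t))⁻¹) *ᵥ
      (X.dh t + (jac (X.η t) * S.G.K * (jac (X.η t))⁻¹) *ᵥ X.eh t) := by
  have hB : S.Bhat * S.V.Γ * S.Bhat⁻¹ = S.V.Γ := by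
    have hu : IsUnit S.Bhat.det := by
      rw [Bhat, det_diagonal]
      exact (Finset.prod_ne_zero_iff.2 fun i _ => hb i).isUnit
    have hc : S.Bhat * S.V.Γ = S.V.Γ * S.Bhat := by
      simp only [Bhat, Vehicle.Γ, diagonal_mul_diagonal, mul_comm]
    rw [hc, Matrix.mul_assoc, mul_nonsing_inv _ hu, Matrix.mul_one]
  rw [input, τ, mulVec_mulVec, mulVec_mulVec]
  congr 1
  calc jac (X.η t) * S.Bhat * S.V.Γ * S.Bhat⁻¹ * (jac (X.η t))⁻¹
      = jac (X.η t) * (S.Bhat * S.V.Γ * S.Bhat⁻¹) * (jac (X.η t))⁻¹ := by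
        simp only [Matrix.mul_assoc]
    _ = _ := by rw [hB]

/-- In the body frame the factors `J⁻ᵀ` cancel against the `Jᵀ` of `M_η⁻¹`, and `M_η⁻¹ M_η = 1`
turns the last term of `μ_η` into `-J' ν`. These are the terms produced by differentiating `η'_c - J
ν`. -/
lemma d_eq (h : S.IsSolution X) (hV : S.V.Admissible) (ht : 0 ≤ t) :
    S.d X t = derivWithin (S.ηcDot X) (Set.Ici 0) t
      + (jac (X.η t) * S.V.M⁻¹) *ᵥ (S.V.mu (X.η t) (X.ν t) + S.τs t)
      - jacDot X t *ᵥ X.ν t - (jac (X.η t) * S.V.M⁻¹) *ᵥ (S.V.Γ *ᵥ S.τ X t) + S.input X t := by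
  have hJ := isUnit_det_jac (h.cos_pitch_pos ht).ne'
  have hJt : (jac (X.η t))ᵀ * (jac (X.η t))⁻¹ᵀ = 1 := by
    rw [← transpose_mul, nonsing_inv_mul _ hJ, transpose_one]
  have hM := Vehicle.M_inv_mul_M hV
  generalize hJe : jac (X.η t) = J at *
  have e1 : S.MηInv X t * (J⁻¹ᵀ) = J * S.V.M⁻¹ := by
    rw [MηInv, hJe, Matrix.mul_assoc, hJt, Matrix.mul_one]
  have e2 : S.MηInv X t * S.Mη X t = 1 := by
    rw [Mη, hJe, ← Matrix.mul_assoc, ← Matrix.mul_assoc, e1, Matrix.mul_assoc J, hM,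
      Matrix.mul_one, mul_nonsing_inv _ hJ]
  have e3 : S.MηInv X t *ᵥ (S.μη X t + S.τsη X t) =
      (J * S.V.M⁻¹) *ᵥ (S.V.mu (X.η t) (X.ν t) + S.τs t) - jacDot X t *ᵥ X.ν t := by
    rw [μη, τsη, hJe, mulVec_add, mulVec_sub, mulVec_mulVec, mulVec_mulVec, mulVec_mulVec,
      mulVec_mulVec, e1, e2, Matrix.one_mul, mulVec_add]
    abel
  have e4 : S.Γη X t *ᵥ S.τη X t = J⁻¹ᵀ *ᵥ (S.V.Γ *ᵥ S.τ X t) := by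
    rw [Γη, τη, hJe, mulVec_mulVec, mulVec_mulVec, Matrix.mul_assoc, hJt, Matrix.mul_one]
  have e5 : S.Bη X t *ᵥ (J⁻¹ᵀ *ᵥ (S.V.Γ *ᵥ S.τ X t)) = S.input X t := by
    rw [Bη, input, hJe, mulVec_mulVec, mulVec_mulVec, Matrix.mul_assoc (J * S.Bhat), hJt,
      Matrix.mul_one]
  rw [d, e3, e4, e5, mulVec_mulVec, e1]
  abel

lemma hasDerivWithinAt_ε (h : S.IsSolution X) (hV : S.V.Admissible) (ht : 0 ≤ t) :
    HasDerivWithinAt (S.ε X) (S.d X t - S.input X t) (Set.Ici 0) t := by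
  have h1 := (h.commanded_diff t ht).hasDerivWithinAt
  have h2 : HasDerivWithinAt (fun s => jac (X.η s) *ᵥ X.ν s) _ _ t :=
    hasDerivWithinAt_mulVec (A' := jacDot X t) (fun i j => by
      simpa [jacDot] using (differentiableWithinAt_jac
        (h.kinematics t ht).differentiableWithinAt (h.cos_pitch_pos ht).ne' i j).hasDerivWithinAt)
      (h.dynamics t ht)
  refine (h1.sub h2).congr_deriv ?_
  rw [d_eq h hV ht, mulVec_add, mulVec_neg, mulVec_mulVec, mulVec_mulVec]
  abel

end Setup

/-! ### Decay of the velocity tracking errors. -/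

lemma eNorm_le_two_mul {v : Fin 3 → ℝ} {B : ℝ} (h : ∀ i, |v i| ≤ B) : eNorm v ≤ 2 * B := by
  have hB : 0 ≤ B := (abs_nonneg _).trans (h 0)
  refine eNorm_le_of_dotProduct_le (by positivity) ?_
  have h1 : ∀ i, v i * v i ≤ B ^ 2 := fun i => by
    rw [← sq, ← sq_abs]; exact pow_le_pow_left₀ (abs_nonneg _) (h i) 2
  rw [dotProduct, Fin.sum_univ_three]
  nlinarith [h1 0, h1 1, h1 2]

lemma pos_fromBlocks_mulVec (A D : Matrix (Fin 3) (Fin 3) ℝ) (v : DoF → ℝ) :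
    pos (fromBlocks A 0 0 D *ᵥ v) = A *ᵥ pos v := by
  ext i
  simp [pos, fromBlocks_mulVec, Function.comp_def]
  rfl

lemma fromBlocks_mulVec_inr (A D : Matrix (Fin 3) (Fin 3) ℝ) (v : DoF → ℝ) (i : Fin 3) :
    (fromBlocks A 0 0 D *ᵥ v) (Sum.inr i) = (D *ᵥ fun j => v (Sum.inr j)) i := by
  simp [fromBlocks_mulVec, Function.comp_def]

/-- The gain is scalar on each diagonal block, so it commutes with the block-diagonal Jacobian. -/
lemma jac_mul_gainK_mul_inv {η : DoF → ℝ} (hθ : Real.cos (pitch η) ≠ 0) (κ ko : ℝ) :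
    jac η * gainK κ ko * (jac η)⁻¹ = gainK κ ko := by
  have h : jac η * gainK κ ko = gainK κ ko * jac η := by
    simp [jac, gainK, fromBlocks_multiply]
  rw [h, Matrix.mul_assoc, mul_nonsing_inv _ (isUnit_det_jac hθ), Matrix.mul_one]

/-- Dissipation in the translational velocity error: actuated axes (`γ i = 1`) are damped by
feedback, the remaining ones (`γ i = 0`) by the environment. -/
lemma dotProduct_tracking_le {R : Matrix (Fin 3) (Fin 3) ℝ} (hR : R * Rᵀ = 1) {γ a : Fin 3 → ℝ}
    {κ : ℝ} (hκ : 0 ≤ κ) (hγ : ∀ i, γ i = 1 ∨ (γ i = 0 ∧ a i = κ)) (e eh d dh : Fin 3 → ℝ) :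
    e ⬝ᵥ (d - (R * diagonal γ * Rᵀ) *ᵥ (dh + κ • eh)) ≤ -κ * eNorm e ^ 2 +
      eNorm e * (eNorm (d + (R * diagonal a * Rᵀ) *ᵥ e) + eNorm (d - dh) +
        κ * eNorm (e - eh)) := by
  have hnorm : ∀ v, eNorm (Rᵀ *ᵥ v) = eNorm v := fun v => by
    rw [eNorm_eq_sqrt, eNorm_eq_sqrt, dotProduct_mulVec, vecMul_transpose, mulVec_mulVec, hR,
      one_mulVec]
  have hdot : ∀ v w, v ⬝ᵥ w = (Rᵀ *ᵥ v) ⬝ᵥ (Rᵀ *ᵥ w) := fun v w => by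
    rw [dotProduct_mulVec, vecMul_transpose, mulVec_mulVec, hR, one_mulVec]
  have hRR : Rᵀ * R = 1 := mul_eq_one_comm.1 hR
  have hconj : ∀ (g v : Fin 3 → ℝ), Rᵀ *ᵥ ((R * diagonal g * Rᵀ) *ᵥ v) = diagonal g *ᵥ (Rᵀ *ᵥ v) :=
    fun g v => by
      rw [mulVec_mulVec, mulVec_mulVec, ← Matrix.mul_assoc, ← Matrix.mul_assoc, hRR,
        Matrix.one_mul]
  set β := Rᵀ *ᵥ e with hβ
  set q := d + (R * diagonal a * Rᵀ) *ᵥ e with hq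
  -- In body coordinates `β = Rᵀ e` every axis contributes `-κ β i ^ 2`. On an actuated axis the
  -- remainder is `(d - dh) + κ (e - eh)`; on an unactuated one `d = q - a e` in body coordinates
  -- with `a i = κ`, and the remainder is `q`. The factors `γ i` and `1 - γ i` only mask components
  -- of `β`, so both remainders pair with vectors no longer than `e`.
  have h1 : e ⬝ᵥ (d - (R * diagonal γ * Rᵀ) *ᵥ (dh + κ • eh)) = -κ * (β ⬝ᵥ β) +
      ((fun i => γ i * β i) ⬝ᵥ (Rᵀ *ᵥ ((d - dh) + κ • (e - eh))) +
      (fun i => (1 - γ i) * β i) ⬝ᵥ (Rᵀ *ᵥ q)) := by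
    rw [hdot, mulVec_sub, hconj, hq]
    simp only [mulVec_add, mulVec_sub, mulVec_smul, hconj, ← hβ]
    simp only [dotProduct, Finset.mul_sum, ← Finset.sum_add_distrib]
    refine Finset.sum_congr rfl fun i _ => ?_
    simp only [Pi.add_apply, Pi.sub_apply, Pi.smul_apply, smul_eq_mul, mulVec_diagonal]
    rcases hγ i with h | ⟨h, h'⟩
    · rw [h]; ring
    · rw [h, h']; ring
  have hle : ∀ g : Fin 3 → ℝ, (∀ i, g i = 0 ∨ g i = 1) →
      eNorm (fun i => g i * β i) ≤ eNorm β := fun g hg => by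
    refine eNorm_le_of_dotProduct_le (eNorm_nonneg _) ?_
    rw [eNorm_sq]
    refine Finset.sum_le_sum fun i _ => ?_
    rcases hg i with h | h
    · simp only [h]; nlinarith [mul_self_nonneg (β i)]
    · simp [h]
  have h2 := (le_abs_self _).trans
    (abs_dotProduct_le (fun i => γ i * β i) (Rᵀ *ᵥ ((d - dh) + κ • (e - eh))))
  have h3 := (le_abs_self _).trans (abs_dotProduct_le (fun i => (1 - γ i) * β i) (Rᵀ *ᵥ q))
  have h4 := hle γ fun i => by
    rcases hγ i with h | ⟨h, -⟩ <;> simp [h]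
  have h5 := hle (fun i => 1 - γ i) fun i => by
    rcases hγ i with h | ⟨h, -⟩ <;> simp [h]
  rw [hnorm] at h2 h3
  rw [show eNorm β = eNorm e from hnorm e] at h4 h5
  have h6 : eNorm ((d - dh) + κ • (e - eh)) ≤ eNorm (d - dh) + κ * eNorm (e - eh) := by
    refine (eNorm_add_le _ _).trans ?_
    rw [eNorm_smul, abs_of_nonneg hκ]
  have h7 : β ⬝ᵥ β = eNorm e ^ 2 := by rw [← eNorm_sq, hnorm]
  rw [h1, h7]
  have h8 := mul_le_mul h4 h6 (eNorm_nonneg _) (eNorm_nonneg e)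
  have h9 := mul_le_mul_of_nonneg_right h5 (eNorm_nonneg q)
  nlinarith

namespace Setup

variable {S : Setup} {X : Signals} {t : ℝ} {κ ko : ℝ}

/-- All rotational axes are actuated, so the angular block is `T T⁻¹ = 1`; missing actuators show
only in the translational block, where `R⁻¹ = Rᵀ`. -/
lemma jac_mul_Γ_mul_inv (h : S.IsSolution X) (ht : 0 ≤ t) :
    jac (X.η t) * S.V.Γ * (jac (X.η t))⁻¹ =
      fromBlocks (rotMat (roll (X.η t)) (pitch (X.η t)) (yaw (X.η t)) *
        diagonal ![1, S.V.actV, S.V.actW] *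
        (rotMat (roll (X.η t)) (pitch (X.η t)) (yaw (X.η t)))ᵀ) 0 0 1 := by
  have hΓ : S.V.Γ = fromBlocks (diagonal ![1, S.V.actV, S.V.actW]) 0 0 1 := by
    rw [Vehicle.Γ, ← fromBlocks_diagonal, ← diagonal_one]
    congr 2
    ext i; fin_cases i <;> rfl
  have hc := (h.cos_pitch_pos ht).ne'
  rw [jac_inv hc, hΓ, jac, fromBlocks_multiply, fromBlocks_multiply]
  simp [mul_nonsing_inv _ (show IsUnit (angMat (roll (X.η t)) (pitch (X.η t))).det by
    rw [det_angMat hc]; exact (inv_ne_zero hc).isUnit)]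

lemma pos_input (h : S.IsSolution X) (hb : ∀ i, S.b i ≠ 0) (hK : S.G.K = gainK κ ko)
    (ht : 0 ≤ t) :
    pos (S.input X t) = (rotMat (roll (X.η t)) (pitch (X.η t)) (yaw (X.η t)) *
        diagonal ![1, S.V.actV, S.V.actW] *
        (rotMat (roll (X.η t)) (pitch (X.η t)) (yaw (X.η t)))ᵀ) *ᵥ
      (pos (X.dh t) + κ • pos (X.eh t)) := by
  rw [input_eq hb, jac_mul_Γ_mul_inv h ht, hK, jac_mul_gainK_mul_inv (h.cos_pitch_pos ht).ne',
    pos_fromBlocks_mulVec]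
  congr 1
  have := pos_fromBlocks_mulVec (κ • 1) (ko • 1) (X.eh t)
  rw [smul_mulVec, one_mulVec] at this
  rw [← this]
  rfl

lemma input_inr (h : S.IsSolution X) (hb : ∀ i, S.b i ≠ 0) (hK : S.G.K = gainK κ ko)
    (ht : 0 ≤ t) (i : Fin 3) :
    S.input X t (Sum.inr i) = X.dh t (Sum.inr i) + ko * X.eh t (Sum.inr i) := by
  rw [input_eq hb, jac_mul_Γ_mul_inv h ht, hK, jac_mul_gainK_mul_inv (h.cos_pitch_pos ht).ne',
    fromBlocks_mulVec_inr, one_mulVec, Pi.add_apply, gainK, fromBlocks_mulVec_inr, smul_mulVec,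
    one_mulVec]
  rfl

/-- The mass is scalar in the translational block, so the added damping term is `R diag (damp / m)
Rᵀ ε_p`. On the transversal axes its coefficients will equal `κ`, as `dotProduct_tracking_le`
requires of unactuated axes. -/
lemma pos_dStar (h : S.IsSolution X) (hV : S.V.Admissible) (ht : 0 ≤ t) :
    pos (S.dStar X t) = pos (S.d X t) +
      (rotMat (roll (X.η t)) (pitch (X.η t)) (yaw (X.η t)) *
        diagonal (fun i => S.V.m⁻¹ * S.V.damp (Sum.inl i)) *
        (rotMat (roll (X.η t)) (pitch (X.η t)) (yaw (X.η t)))ᵀ) *ᵥ pos (S.ε X t) := by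
  have hc := (h.cos_pitch_pos ht).ne'
  have hJ := isUnit_det_jac hc
  have hJt : (jac (X.η t))ᵀ * (jac (X.η t))⁻¹ᵀ = 1 := by
    rw [← transpose_mul, nonsing_inv_mul _ hJ, transpose_one]
  have h1 : S.MηInv X t * S.Δη X t = jac (X.η t) * (S.V.M⁻¹ * S.V.Δ) * (jac (X.η t))⁻¹ := by
    rw [MηInv, Δη]
    calc _ = jac (X.η t) * S.V.M⁻¹ * ((jac (X.η t))ᵀ * (jac (X.η t))⁻¹ᵀ) * S.V.Δ *
          (jac (X.η t))⁻¹ := by simp only [Matrix.mul_assoc]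
      _ = _ := by rw [hJt, Matrix.mul_one]; simp only [Matrix.mul_assoc]
  have hΔ : S.V.Δ = fromBlocks (diagonal fun i => S.V.damp (Sum.inl i)) 0 0
      (diagonal fun i => S.V.damp (Sum.inr i)) := by
    rw [Vehicle.Δ, fromBlocks_diagonal]
    congr 1
    ext i; cases i <;> rfl
  have h2 : S.V.m⁻¹ • diagonal (fun i : Fin 3 => S.V.damp (Sum.inl i)) =
      diagonal fun i => S.V.m⁻¹ * S.V.damp (Sum.inl i) := by
    rw [← diagonal_smul]; rfl
  have h3 : jac (X.η t) * (S.V.M⁻¹ * S.V.Δ) * (jac (X.η t))⁻¹ =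
      fromBlocks (rotMat (roll (X.η t)) (pitch (X.η t)) (yaw (X.η t)) *
        diagonal (fun i => S.V.m⁻¹ * S.V.damp (Sum.inl i)) *
        (rotMat (roll (X.η t)) (pitch (X.η t)) (yaw (X.η t)))ᵀ) 0 0
        (angMat (roll (X.η t)) (pitch (X.η t)) * (S.V.Io⁻¹ *
          diagonal fun i => S.V.damp (Sum.inr i)) *
          (angMat (roll (X.η t)) (pitch (X.η t)))⁻¹) := by
    rw [jac_inv hc, Vehicle.M_inv hV, hΔ, jac, fromBlocks_multiply, fromBlocks_multiply,
      fromBlocks_multiply, ← h2]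
    simp
  rw [dStar, h1, h3, ← pos_fromBlocks_mulVec]
  rfl

/-- The translational velocity error stays small after an instant at which it is small. -/
lemma eNorm_pos_ε_le (h : S.IsSolution X) (hV : S.V.Admissible) (hb : ∀ i, S.b i ≠ 0)
    (hK : S.G.K = gainK κ ko) (hκ : 0 < κ)
    (h1 : S.V.damp (Sum.inl 1) = κ * S.V.m) (h2 : S.V.damp (Sum.inl 2) = κ * S.V.m)
    {T₀ rds Ee Ed B : ℝ} (hT₀ : 0 ≤ T₀)
    (hds : ∀ t ≥ 0, eNorm (S.dStar X t) ≤ rds)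
    (he : ∀ t ≥ T₀, ∀ i, |S.ε X t i - X.eh t i| ≤ Ee)
    (hd : ∀ t ≥ T₀, ∀ i, |S.d X t i - X.dh t i| ≤ Ed)
    (hinit : eNorm (S.ε X T₀) ≤ B) (hB : rds + 2 * Ed + κ * (2 * Ee) < κ * B) :
    ∀ t ≥ T₀, eNorm (pos (S.ε X t)) ≤ B := by
  intro t ht
  have hB0 : 0 ≤ B := (eNorm_nonneg _).trans hinit
  have hpos : ∀ v : DoF → ℝ, eNorm (pos v) ≤ eNorm v := fun v => by
    refine eNorm_le_of_dotProduct_le (eNorm_nonneg _) ?_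
    rw [eNorm_sq]
    simp only [dotProduct, Fintype.sum_sum_type, pos]
    exact le_add_of_nonneg_right (Finset.sum_nonneg fun i _ => mul_self_nonneg _)
  refine eNorm_le_of_dotProduct_le hB0 ?_
  -- The barrier is applied to the squared norm, which is differentiable also where the error
  -- vanishes.
  refine le_of_deriv_neg_at_barrier (a := T₀) (b := t)
    (f := fun s => pos (S.ε X s) ⬝ᵥ pos (S.ε X s))
    (f' := fun s => 2 * (pos (S.ε X s) ⬝ᵥ pos (S.d X s - S.input X s))) ?_ ?_ ?_ t ⟨ht, le_rfl⟩
  · intro s hs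
    have h3 := (hasDerivWithinAt_ε h hV (hT₀.trans hs.1)).mono
      (fun u hu => hT₀.trans hu.1 : Set.Icc T₀ t ⊆ Set.Ici 0)
    rw [hasDerivWithinAt_pi] at h3
    have := HasDerivWithinAt.fun_sum (u := Finset.univ)
      (fun (i : Fin 3) _ => (h3 (Sum.inl i)).mul (h3 (Sum.inl i)))
    refine this.congr_deriv ?_
    rw [dotProduct, Finset.mul_sum]
    refine Finset.sum_congr rfl fun i _ => ?_
    simp only [pos]; ring
  · rw [← eNorm_sq]
    exact pow_le_pow_left₀ (eNorm_nonneg _) ((hpos _).trans hinit) 2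
  · intro s hs hsB
    have hs0 : 0 ≤ s := hT₀.trans hs.1
    have hn : eNorm (pos (S.ε X s)) = B := by
      rw [← eNorm_sq] at hsB
      exact (pow_left_inj₀ (eNorm_nonneg _) hB0 two_ne_zero).1 hsB
    have hm := hV.m_pos.ne'
    -- Surge is always actuated, so its damping coefficient is free; sway and heave are either
    -- actuated or damped at the rate `κ`.
    have hdec := dotProduct_tracking_le (R := rotMat (roll (X.η s)) (pitch (X.η s)) (yaw (X.η s)))
      (rotMat_mul_transpose _ _ _) (γ := ![1, S.V.actV, S.V.actW])
      (a := fun i => S.V.m⁻¹ * S.V.damp (Sum.inl i)) hκ.le (by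
        intro i
        fin_cases i
        · simp
        · rcases hV.actV_mem with h' | h' <;> simp [h', h1]
          field_simp
        · rcases hV.actW_mem with h' | h' <;> simp [h', h2]
          field_simp) (pos (S.ε X s)) (pos (X.eh s)) (pos (S.d X s)) (pos (X.dh s))
    rw [← pos_input h hb hK hs0, ← pos_dStar h hV hs0, hn] at hdec
    have k1 : eNorm (pos (S.dStar X s)) ≤ rds := (hpos _).trans (hds s hs0)
    have k2 : eNorm (pos (S.d X s) - pos (X.dh s)) ≤ 2 * Ed :=
      eNorm_le_two_mul fun i => hd s hs.1 _
    have k3 : eNorm (pos (S.ε X s) - pos (X.eh s)) ≤ 2 * Ee :=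
      eNorm_le_two_mul fun i => he s hs.1 _
    have hBpos : 0 < B := by
      have : 0 < κ * B := by
        refine lt_of_le_of_lt ?_ hB
        have := eNorm_nonneg (pos (S.dStar X s))
        have := eNorm_nonneg (pos (S.d X s) - pos (X.dh s))
        have := eNorm_nonneg (pos (S.ε X s) - pos (X.eh s))
        have : 0 ≤ κ * (2 * Ee) := mul_nonneg hκ.le (by linarith)
        linarith
      exact pos_of_mul_pos_right this hκ.le
    have hpsub : pos (S.d X s - S.input X s) = pos (S.d X s) - pos (S.input X s) := rfl
    rw [hpsub]
    have k4 := mul_le_mul_of_nonneg_left k3 hκ.le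
    have k5 : B * (eNorm (pos (S.dStar X s)) + eNorm (pos (S.d X s) - pos (X.dh s)) +
        κ * eNorm (pos (S.ε X s) - pos (X.eh s))) < B * (κ * B) :=
      mul_lt_mul_of_pos_left (by linarith) hBpos
    nlinarith

/-- The rotational velocity errors stay small after an instant at which they are small. -/
lemma abs_ε_inr_le (h : S.IsSolution X) (hV : S.V.Admissible) (hb : ∀ i, S.b i ≠ 0)
    (hK : S.G.K = gainK κ ko) (hko : 0 < ko) {T₀ Ee Ed B : ℝ} (hT₀ : 0 ≤ T₀)
    (he : ∀ t ≥ T₀, ∀ i, |S.ε X t i - X.eh t i| ≤ Ee)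
    (hd : ∀ t ≥ T₀, ∀ i, |S.d X t i - X.dh t i| ≤ Ed)
    (hinit : eNorm (S.ε X T₀) ≤ B) (hB : Ed + ko * Ee < ko * B) (i : Fin 3) :
    ∀ t ≥ T₀, |S.ε X t (Sum.inr i)| ≤ B := by
  intro t ht
  refine abs_le_of_linear_ode (k := ko) (a := T₀) (b := t)
    (f := fun s => S.ε X s (Sum.inr i))
    (u := fun s => (S.d X s (Sum.inr i) - X.dh s (Sum.inr i)) +
      ko * (S.ε X s (Sum.inr i) - X.eh s (Sum.inr i))) ?_ ?_ ?_ t ⟨ht, le_rfl⟩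
  · intro s hs
    have hs0 : 0 ≤ s := hT₀.trans hs.1
    have h3 := (hasDerivWithinAt_ε h hV hs0).mono
      (fun u hu => hT₀.trans hu.1 : Set.Icc T₀ t ⊆ Set.Ici 0)
    rw [hasDerivWithinAt_pi] at h3
    refine (h3 (Sum.inr i)).congr_deriv ?_
    rw [Pi.sub_apply, input_inr h hb hK hs0]
    ring
  · exact (abs_le_eNorm _ _).trans hinit
  · intro s hs
    refine (abs_add_le _ _).trans_lt ?_
    rw [abs_mul, abs_of_pos hko]
    have := mul_le_mul_of_nonneg_left (he s hs.1 (Sum.inr i)) hko.le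
    linarith [hd s hs.1 (Sum.inr i)]

/-- The observation errors stay small after an instant at which they are small. -/
lemma observer_errors_le (h : S.IsSolution X) (hV : S.V.Admissible) {T₀ rdd r Ω : ℝ}
    (hT₀ : 0 ≤ T₀) (hrdd : 0 < rdd) (hΩ : 0 < Ω) (hω : ∀ i, Ω ≤ S.ω i)
    (hd : ∀ t ≥ 0, ∀ t' ≥ 0, eNorm (S.d X t - S.d X t') ≤ rdd * |t - t'|)
    (hinit : eNorm (S.χ X T₀) ≤ r)
    (hr : ∀ i, r * (1 + S.ω i + S.ω i ^ 2) * S.ω i ≤ rdd) :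
    ∀ t ≥ T₀, ∀ i, |S.ε X t i - X.eh t i| ≤ 11 * rdd / Ω ^ 2 ∧
      |S.d X t i - X.dh t i| ≤ 9 * rdd / Ω := by
  intro t ht i
  have hωi : 0 < S.ω i := hΩ.trans_le (hω i)
  have hsub : Set.Icc T₀ t ⊆ Set.Ici 0 := fun u hu => hT₀.trans hu.1
  have hχ : ∀ k, |S.χ X T₀ k| ≤ r := fun k => (abs_le_eNorm _ _).trans hinit
  have key := observer_bounds (y := fun s => y X s i - X.yh s i)
    (e := fun s => S.ε X s i - X.eh s i) (d := fun s => S.d X s i) (dh := fun s => X.dh s i)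
    (a := T₀) (b := t) (ω := S.ω i) (L := rdd) (r := r) ht hωi hrdd ?_ ?_ ?_ ?_
    (hχ (0, i)) (hχ (1, i)) (hχ (2, i)) (hr i)
  · refine ⟨key.1.trans ?_, key.2.trans ?_⟩
    · have := hω i
      gcongr
    · have := hω i
      gcongr
  · intro s hs s' hs'
    exact (abs_le_eNorm (S.d X s - S.d X s') i).trans (hd s (hsub hs) s' (hsub hs'))
  · intro s hs
    have hs0 := hsub hs
    have h1 := (hasDerivWithinAt_pi.1 ((h.commanded s hs0).mono hsub)) i
    have h2 := (hasDerivWithinAt_pi.1 ((h.kinematics s hs0).mono hsub)) i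
    have h3 := (hasDerivWithinAt_pi.1 ((h.observer_y s hs0).mono hsub)) i
    refine ((h1.sub h2).sub h3).congr_deriv ?_
    simp only [ε, yhDot, Pi.sub_apply]
    ring
  · intro s hs
    have hs0 := hsub hs
    have h1 := (hasDerivWithinAt_pi.1 ((hasDerivWithinAt_ε h hV hs0).mono hsub)) i
    have h2 := (hasDerivWithinAt_pi.1 ((h.observer_e s hs0).mono hsub)) i
    refine (h1.sub h2).congr_deriv ?_
    simp only [ehDot, Pi.sub_apply]
    ring
  · intro s hs
    exact (hasDerivWithinAt_pi.1 ((h.observer_d s (hsub hs)).mono hsub)) i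

end Setup

/-! ### Geometry of the reference path -/

lemma eNorm_eq_zero {ι : Type} [Fintype ι] {v : ι → ℝ} : eNorm v = 0 ↔ v = 0 := by
  simp [eNorm]

lemma norm_le_eNorm {ι : Type} [Fintype ι] (v : ι → ℝ) : ‖v‖ ≤ eNorm v :=
  (pi_norm_le_iff_of_nonneg (eNorm_nonneg v)).2 fun i => by
    rw [Real.norm_eq_abs]; exact abs_le_eNorm v i

lemma continuous_eNorm {ι : Type} [Fintype ι] : Continuous (eNorm (ι := ι)) :=
  continuous_norm.comp (PiLp.continuous_toLp 2 _)

lemma contDiffAt_eNorm {ι : Type} [Fintype ι] {v : ι → ℝ} (hv : v ≠ 0) {n : WithTop ℕ∞} :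
    ContDiffAt ℝ n eNorm v := by
  have h : ContDiffAt ℝ n (fun w : ι → ℝ => Real.sqrt (∑ i, w i * w i)) v := by
    refine ContDiffAt.sqrt (by fun_prop) ?_
    have := (eNorm_eq_zero (v := v)).not.2 hv
    rw [eNorm_eq_sqrt] at this
    exact fun h => this (by simp [dotProduct, h])
  exact h.congr_of_eventuallyEq (Filter.Eventually.of_forall fun w => eNorm_eq_sqrt w)

/-- The opposite of a vector, brought to unit length. -/
noncomputable def negUnit (v : Fin 3 → ℝ) : Fin 3 → ℝ := -((eNorm v)⁻¹ • v)

lemma eNorm_negUnit {v : Fin 3 → ℝ} (hv : v ≠ 0) : eNorm (negUnit v) = 1 := by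
  have := (eNorm_eq_zero (v := v)).not.2 hv
  rw [negUnit, ← smul_neg, eNorm_smul, abs_of_nonneg (inv_nonneg.2 (eNorm_nonneg _))]
  have h : eNorm (-v) = eNorm v := by simp [eNorm]
  rw [h, inv_mul_cancel₀ this]

lemma eNorm_smul_negUnit {v : Fin 3 → ℝ} (hv : v ≠ 0) : v = -(eNorm v • negUnit v) := by
  have := (eNorm_eq_zero (v := v)).not.2 hv
  rw [negUnit, smul_neg, neg_neg, smul_smul, mul_inv_cancel₀ this, one_smul]

lemma negUnit_dotProduct_negUnit (v w : Fin 3 → ℝ) :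
    negUnit v ⬝ᵥ negUnit w = (eNorm v)⁻¹ * (eNorm w)⁻¹ * (v ⬝ᵥ w) := by
  simp [negUnit]
  ring

/-- Common perpendicular of two vectors, brought to unit length. -/
noncomputable def unitCross (σ : ℝ) (v w : Fin 3 → ℝ) : Fin 3 → ℝ :=
  (σ * (eNorm (crossProduct (negUnit v) (negUnit w)))⁻¹) •
    crossProduct (negUnit v) (negUnit w)

lemma contDiffAt_negUnit {v : Fin 3 → ℝ} (hv : v ≠ 0) {n : WithTop ℕ∞} :
    ContDiffAt ℝ n negUnit v := by
  have := (contDiffAt_eNorm hv (n := n)).inv ((eNorm_eq_zero (v := v)).not.2 hv)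
  exact (this.smul contDiffAt_id).neg

lemma contDiff_crossProduct {n : WithTop ℕ∞} :
    ContDiff ℝ n fun x : (Fin 3 → ℝ) × (Fin 3 → ℝ) => crossProduct x.1 x.2 := by
  rw [contDiff_pi]
  intro i
  simp only [cross_apply]
  have h (j : Fin 3) : ContDiff ℝ n fun x : (Fin 3 → ℝ) × (Fin 3 → ℝ) => x.1 j :=
    (contDiff_apply ℝ ℝ j).comp contDiff_fst
  have h' (j : Fin 3) : ContDiff ℝ n fun x : (Fin 3 → ℝ) × (Fin 3 → ℝ) => x.2 j :=
    (contDiff_apply ℝ ℝ j).comp contDiff_snd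
  match i with
  | 0 => exact ((h 1).mul (h' 2)).sub ((h 2).mul (h' 1))
  | 1 => exact ((h 2).mul (h' 0)).sub ((h 0).mul (h' 2))
  | 2 => exact ((h 0).mul (h' 1)).sub ((h 1).mul (h' 0))

lemma contDiffAt_unitCross (σ : ℝ) {x : (Fin 3 → ℝ) × (Fin 3 → ℝ)} (h1 : x.1 ≠ 0) (h2 : x.2 ≠ 0)
    (h : crossProduct (negUnit x.1) (negUnit x.2) ≠ 0) {n : WithTop ℕ∞} :
    ContDiffAt ℝ n (fun x : (Fin 3 → ℝ) × (Fin 3 → ℝ) => unitCross σ x.1 x.2) x := by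
  have hu : ContDiffAt ℝ n (fun x : (Fin 3 → ℝ) × (Fin 3 → ℝ) =>
      crossProduct (negUnit x.1) (negUnit x.2)) x := by
    have := (((contDiffAt_negUnit h1 (n := n)).comp x contDiffAt_fst).prodMk
      ((contDiffAt_negUnit h2 (n := n)).comp x contDiffAt_snd))
    exact contDiff_crossProduct.contDiffAt.comp x this
  have hc : ContDiffAt ℝ n eNorm (crossProduct (negUnit x.1) (negUnit x.2)) := contDiffAt_eNorm h
  have hn : ContDiffAt ℝ n (fun x : (Fin 3 → ℝ) × (Fin 3 → ℝ) =>
      (eNorm (crossProduct (negUnit x.1) (negUnit x.2)))⁻¹) x :=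
    ContDiffAt.inv (ContDiffAt.comp (g := eNorm) x hc hu) (eNorm_eq_zero.not.2 h)
  exact (contDiffAt_const.mul hn).smul hu

lemma exists_bound_fderiv_of_isCompact {E F : Type*} [NormedAddCommGroup E] [NormedSpace ℝ E]
    [NormedAddCommGroup F] [NormedSpace ℝ F] {f : E → F} {K : Set E} (hK : IsCompact K)
    (hf : ∀ x ∈ K, ContDiffAt ℝ 1 f x) : ∃ C : ℝ, 0 ≤ C ∧ ∀ x ∈ K, ‖fderiv ℝ f x‖ ≤ C := by
  have hc : ContinuousOn (fderiv ℝ f) K := fun x hx =>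
    ((hf x hx).continuousAt_fderiv (by norm_num)).continuousWithinAt
  obtain ⟨C, hC⟩ := hK.exists_bound_of_continuousOn hc
  exact ⟨max C 0, le_max_right _ _, fun x hx => (hC x hx).trans (le_max_left _ _)⟩

lemma exists_hasFDerivAt_comp {E F G : Type*} [NormedAddCommGroup E] [NormedSpace ℝ E]
    [NormedAddCommGroup F] [NormedSpace ℝ F] [NormedAddCommGroup G] [NormedSpace ℝ G]
    {f : F → G} {g : E → F} {g' : E →L[ℝ] F} {x : E} {a b : ℝ}
    (hf : DifferentiableAt ℝ f (g x)) (ha : ‖fderiv ℝ f (g x)‖ ≤ a)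
    (hg : HasFDerivAt g g' x) (hb : ‖g'‖ ≤ b) :
    ∃ L : E →L[ℝ] G, HasFDerivAt (fun y => f (g y)) L x ∧ ‖L‖ ≤ a * b :=
  ⟨_, hf.hasFDerivAt.comp x hg, (ContinuousLinearMap.opNorm_comp_le _ _).trans
    (mul_le_mul ha hb (norm_nonneg _) ((norm_nonneg _).trans ha))⟩

/-- Lagrange's identity: a bound below one on the cosine keeps the cross product of the normals away
from zero. -/
lemma eNorm_crossProduct_sq {v w : Fin 3 → ℝ} (hv : v ≠ 0) (hw : w ≠ 0) :
    eNorm (crossProduct (negUnit v) (negUnit w)) ^ 2 = 1 - (negUnit v ⬝ᵥ negUnit w) ^ 2 := by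
  rw [eNorm_sq, cross_dot_cross, ← eNorm_sq, ← eNorm_sq, eNorm_negUnit hv, eNorm_negUnit hw,
    dotProduct_comm (negUnit w)]
  ring

/-- Quantitative form of the standing assumptions on the path. -/
structure RefPath.Bounds (P : RefPath) (lo hi c C : ℝ) : Prop where
  lo_pos : 0 < lo
  hi_pos : 0 < hi
  c_nonneg : 0 ≤ c
  c_lt : c < 1
  C_nonneg : 0 ≤ C
  lo_le : ∀ j, ∀ p ∈ P.D, lo ≤ eNorm (P.grad j p)
  le_hi : ∀ j, ∀ p ∈ P.D, eNorm (P.grad j p) ≤ hi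
  dot_le : ∀ p ∈ P.D,
    |P.grad 0 p ⬝ᵥ P.grad 1 p| ≤ c * (eNorm (P.grad 0 p) * eNorm (P.grad 1 p))
  deriv_le : ∀ j, ∀ p ∈ P.D, ‖fderiv ℝ (P.s j) p‖ ≤ C
  deriv2_le : ∀ j, ∀ p ∈ P.D, ‖fderiv ℝ (fderiv ℝ (P.s j)) p‖ ≤ C

lemma RefPath.Admissible.exists_bounds {P : RefPath} (hP : P.Admissible) :
    ∃ lo hi c C : ℝ, P.Bounds lo hi c C := by
  obtain ⟨lo₀, hi₀, h0, hb0⟩ := hP.grad_bounds 0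
  obtain ⟨lo₁, hi₁, h1, hb1⟩ := hP.grad_bounds 1
  obtain ⟨c, hc, hcol⟩ := hP.noncollinear
  obtain ⟨C₀, hC0⟩ := hP.deriv_bounds 0
  obtain ⟨C₁, hC1⟩ := hP.deriv_bounds 1
  have key : ∀ j, ∀ p ∈ P.D, ∀ k : ℕ, 1 ≤ k → k ≤ 3 →
      ‖iteratedFDeriv ℝ k (P.s j) p‖ ≤ max (max C₀ C₁) 0 := by
    intro j p hp k hk hk'
    fin_cases j
    · exact (hC0 p hp k hk hk').trans ((le_max_left _ _).trans (le_max_left _ _))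
    · exact (hC1 p hp k hk hk').trans ((le_max_right _ _).trans (le_max_left _ _))
  -- The maxima with `0` and `1` matter only for empty `D`, where the given constants may have the
  -- wrong sign.
  refine ⟨min lo₀ lo₁, max (max hi₀ hi₁) 1, max c 0, max (max C₀ C₁) 0,
    lt_min h0 h1, lt_max_of_lt_right one_pos, le_max_right _ _, max_lt hc one_pos,
    le_max_right _ _, ?_, ?_, ?_, ?_, ?_⟩
  · intro j p hp
    fin_cases j
    · exact (min_le_left _ _).trans (hb0 p hp).1.le
    · exact (min_le_right _ _).trans (hb1 p hp).1.le
  · intro j p hp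
    fin_cases j
    · exact (hb0 p hp).2.le.trans ((le_max_left _ _).trans (le_max_left _ _))
    · exact (hb1 p hp).2.le.trans ((le_max_right _ _).trans (le_max_left _ _))
  · intro p hp
    refine (hcol p hp).trans ?_
    exact mul_le_mul_of_nonneg_right (le_max_left _ _)
      (mul_nonneg (eNorm_nonneg _) (eNorm_nonneg _))
  · intro j p hp
    have := key j p hp 1 le_rfl (by norm_num)
    rwa [← norm_iteratedFDeriv_fderiv, norm_iteratedFDeriv_zero] at this
  · intro j p hp
    have := key j p hp 2 (by norm_num) (by norm_num)
    rwa [← norm_iteratedFDeriv_fderiv, ← norm_iteratedFDeriv_fderiv,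
      norm_iteratedFDeriv_zero] at this

namespace RefPath

variable {P : RefPath} {lo hi c C : ℝ} {p : Fin 3 → ℝ}

namespace Bounds

lemma grad_ne_zero (hb : P.Bounds lo hi c C) (hp : p ∈ P.D) (j : Fin 2) : P.grad j p ≠ 0 := by
  refine eNorm_eq_zero.not.1 ?_
  exact (hb.lo_pos.trans_le (hb.lo_le j p hp)).ne'

lemma eNorm_normal (hb : P.Bounds lo hi c C) (hp : p ∈ P.D) (j : Fin 2) :
    eNorm (P.normal j p) = 1 := eNorm_negUnit (hb.grad_ne_zero hp j)

lemma grad_eq (hb : P.Bounds lo hi c C) (hp : p ∈ P.D) (j : Fin 2) :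
    P.grad j p = -(eNorm (P.grad j p) • P.normal j p) := eNorm_smul_negUnit (hb.grad_ne_zero hp j)

lemma abs_normal_dot (hb : P.Bounds lo hi c C) (hp : p ∈ P.D) :
    |P.normal 0 p ⬝ᵥ P.normal 1 p| ≤ c := by
  have h0 := hb.lo_pos.trans_le (hb.lo_le 0 p hp)
  have h1 := hb.lo_pos.trans_le (hb.lo_le 1 p hp)
  have := negUnit_dotProduct_negUnit (P.grad 0 p) (P.grad 1 p)
  change P.normal 0 p ⬝ᵥ P.normal 1 p = _ at this
  rw [this, abs_mul, abs_of_pos (by positivity), ← mul_inv, inv_mul_le_iff₀ (by positivity),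
    mul_comm _ c]
  exact hb.dot_le p hp

lemma cross_ne_zero (hb : P.Bounds lo hi c C) (hp : p ∈ P.D) :
    crossProduct (P.normal 0 p) (P.normal 1 p) ≠ 0 := by
  refine eNorm_eq_zero.not.1 fun h => ?_
  have h1 := eNorm_crossProduct_sq (hb.grad_ne_zero hp 0) (hb.grad_ne_zero hp 1)
  change eNorm (crossProduct (P.normal 0 p) (P.normal 1 p)) ^ 2 =
    1 - (P.normal 0 p ⬝ᵥ P.normal 1 p) ^ 2 at h1
  have h2 := abs_le.1 (hb.abs_normal_dot hp)
  rw [h] at h1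
  nlinarith [hb.c_lt, hb.c_nonneg]

lemma eNorm_tangent (hb : P.Bounds lo hi c C) (hσ : P.σ = 1 ∨ P.σ = -1) (hp : p ∈ P.D) :
    eNorm (P.tangent p) = 1 := by
  have h := eNorm_eq_zero.not.2 (hb.cross_ne_zero hp)
  have hs : |P.σ| = 1 := by rcases hσ with h | h <;> simp [h]
  rw [tangent, eNorm_smul, abs_mul, hs, one_mul, abs_of_nonneg (inv_nonneg.2 (eNorm_nonneg _)),
    inv_mul_cancel₀ h]

lemma contDiffAt_s (hP : P.Admissible) (hp : p ∈ P.D) (j : Fin 2) :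
    ContDiffAt ℝ 3 (P.s j) p := (hP.contDiffOn j).contDiffAt (hP.isOpen_D.mem_nhds hp)

/-- Evaluation of a linear form at the vectors of the standard basis. -/
noncomputable def coords : ((Fin 3 → ℝ) →L[ℝ] ℝ) →L[ℝ] (Fin 3 → ℝ) :=
  ContinuousLinearMap.pi fun i => ContinuousLinearMap.apply ℝ ℝ (Pi.single i 1)

lemma norm_coords_le : ‖coords‖ ≤ 1 := by
  refine ContinuousLinearMap.opNorm_le_bound _ zero_le_one fun φ => ?_
  rw [one_mul]
  refine (pi_norm_le_iff_of_nonneg (norm_nonneg _)).2 fun i => ?_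
  have := φ.le_opNorm (Pi.single i (1 : ℝ))
  rw [Pi.norm_single, norm_one, mul_one] at this
  exact this

lemma hasFDerivAt_grad (hP : P.Admissible) (hp : p ∈ P.D) (j : Fin 2) :
    HasFDerivAt (P.grad j) (coords.comp (fderiv ℝ (fderiv ℝ (P.s j)) p)) p := by
  have h1 : ContDiffAt ℝ 1 (fderiv ℝ (P.s j)) p :=
    (contDiffAt_s hP hp j).fderiv_right (by norm_num)
  exact coords.hasFDerivAt.comp p (h1.differentiableAt (by norm_num)).hasFDerivAt

lemma norm_fderiv_grad_le (hb : P.Bounds lo hi c C) (hp : p ∈ P.D) (j : Fin 2) :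
    ‖coords.comp (fderiv ℝ (fderiv ℝ (P.s j)) p)‖ ≤ C := by
  refine (ContinuousLinearMap.opNorm_comp_le _ _).trans ?_
  have h := hb.deriv2_le j p hp
  calc ‖coords‖ * ‖fderiv ℝ (fderiv ℝ (P.s j)) p‖ ≤ 1 * ‖fderiv ℝ (fderiv ℝ (P.s j)) p‖ := by
        gcongr; exact norm_coords_le
    _ ≤ C := by rwa [one_mul]

/-- The domain `D` need not be compact, but the pair of gradients stays in this compact set, on
which the unit normals and the unit tangent are smooth functions of the pair. Uniform derivative
bounds for the frame then follow from those on the Hessians. -/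
lemma isCompact_gradients (lo hi c : ℝ) : IsCompact {x : (Fin 3 → ℝ) × (Fin 3 → ℝ) |
    (lo ≤ eNorm x.1 ∧ eNorm x.1 ≤ hi) ∧ (lo ≤ eNorm x.2 ∧ eNorm x.2 ≤ hi) ∧
      |x.1 ⬝ᵥ x.2| ≤ c * (eNorm x.1 * eNorm x.2)} := by
  have h1 : Continuous fun x : (Fin 3 → ℝ) × (Fin 3 → ℝ) => eNorm x.1 :=
    continuous_eNorm.comp continuous_fst
  have h2 : Continuous fun x : (Fin 3 → ℝ) × (Fin 3 → ℝ) => eNorm x.2 :=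
    continuous_eNorm.comp continuous_snd
  have h3 : Continuous fun x : (Fin 3 → ℝ) × (Fin 3 → ℝ) => x.1 ⬝ᵥ x.2 :=
    continuous_fst.dotProduct continuous_snd
  refine (isCompact_closedBall (0 : (Fin 3 → ℝ) × (Fin 3 → ℝ)) hi).of_isClosed_subset ?_ ?_
  · refine ((isClosed_le continuous_const h1).inter (isClosed_le h1 continuous_const)).inter
      (((isClosed_le continuous_const h2).inter (isClosed_le h2 continuous_const)).inter
        (isClosed_le h3.abs (continuous_const.mul (h1.mul h2))))
  · rintro x ⟨⟨-, hx1⟩, ⟨-, hx2⟩, -⟩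
    rw [mem_closedBall_zero_iff, Prod.norm_def]
    exact max_le ((norm_le_eNorm _).trans hx1) ((norm_le_eNorm _).trans hx2)

lemma isCompact_annulus (lo hi : ℝ) :
    IsCompact {v : Fin 3 → ℝ | lo ≤ eNorm v ∧ eNorm v ≤ hi} := by
  refine (isCompact_closedBall (0 : Fin 3 → ℝ) hi).of_isClosed_subset
    ((isClosed_le continuous_const continuous_eNorm).inter
      (isClosed_le continuous_eNorm continuous_const)) ?_
  rintro x ⟨-, hx⟩
  exact mem_closedBall_zero_iff.2 ((norm_le_eNorm _).trans hx)

/-- The tangent and the normals have bounded derivatives. -/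
lemma exists_bound_fderiv_frame (hb : P.Bounds lo hi c C) (hP : P.Admissible) :
    ∃ A : ℝ, 0 ≤ A ∧ ∀ p ∈ P.D,
      (∃ T' : (Fin 3 → ℝ) →L[ℝ] (Fin 3 → ℝ), HasFDerivAt P.tangent T' p ∧ ‖T'‖ ≤ A) ∧
      ∀ j, ∃ N' : (Fin 3 → ℝ) →L[ℝ] (Fin 3 → ℝ), HasFDerivAt (P.normal j) N' p ∧ ‖N'‖ ≤ A := by
  set K : Set ((Fin 3 → ℝ) × (Fin 3 → ℝ)) := {x : (Fin 3 → ℝ) × (Fin 3 → ℝ) |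
    (lo ≤ eNorm x.1 ∧ eNorm x.1 ≤ hi) ∧ (lo ≤ eNorm x.2 ∧ eNorm x.2 ≤ hi) ∧
      |x.1 ⬝ᵥ x.2| ≤ c * (eNorm x.1 * eNorm x.2)} with hK
  have hKc : IsCompact K := isCompact_gradients lo hi c
  have hne : ∀ v : Fin 3 → ℝ, lo ≤ eNorm v → v ≠ 0 := fun v hv =>
    eNorm_eq_zero.not.1 (hb.lo_pos.trans_le hv).ne'
  obtain ⟨A₁, hA₁, hT⟩ := exists_bound_fderiv_of_isCompact hKc
    (f := fun x : (Fin 3 → ℝ) × (Fin 3 → ℝ) => unitCross P.σ x.1 x.2) (by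
      rintro x ⟨⟨h1, -⟩, ⟨h2, -⟩, h3⟩
      refine contDiffAt_unitCross _ (hne _ h1) (hne _ h2) ?_
      refine eNorm_eq_zero.not.1 fun h => ?_
      have h4 := eNorm_crossProduct_sq (hne _ h1) (hne _ h2)
      have h5 : |negUnit x.1 ⬝ᵥ negUnit x.2| ≤ c := by
        have h6 := hb.lo_pos.trans_le h1
        have h7 := hb.lo_pos.trans_le h2
        rw [negUnit_dotProduct_negUnit, abs_mul, abs_of_pos (by positivity), ← mul_inv,
          inv_mul_le_iff₀ (by positivity), mul_comm _ c]
        exact h3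
      have h8 := abs_le.1 h5
      rw [h] at h4
      nlinarith [hb.c_lt, hb.c_nonneg])
  obtain ⟨A₂, hA₂, hN⟩ := exists_bound_fderiv_of_isCompact (f := negUnit)
    (isCompact_annulus lo hi) fun x hx => contDiffAt_negUnit (hne _ hx.1)
  refine ⟨max A₁ A₂ * C, mul_nonneg (hA₁.trans (le_max_left _ _)) hb.C_nonneg, fun p hp => ?_⟩
  have hG : ∀ j, HasFDerivAt (P.grad j) _ p := fun j => hasFDerivAt_grad hP hp j
  have hGC := norm_fderiv_grad_le hb hp
  constructor
  · have hx : (P.grad 0 p, P.grad 1 p) ∈ K :=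
      ⟨⟨hb.lo_le 0 p hp, hb.le_hi 0 p hp⟩, ⟨hb.lo_le 1 p hp, hb.le_hi 1 p hp⟩, hb.dot_le p hp⟩
    have hcr : crossProduct (negUnit (P.grad 0 p)) (negUnit (P.grad 1 p)) ≠ 0 :=
      hb.cross_ne_zero hp
    have hd : DifferentiableAt ℝ (fun x : (Fin 3 → ℝ) × (Fin 3 → ℝ) => unitCross P.σ x.1 x.2)
        (P.grad 0 p, P.grad 1 p) :=
      (contDiffAt_unitCross (n := 1) (x := (P.grad 0 p, P.grad 1 p)) P.σ (hb.grad_ne_zero hp 0)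
        (hb.grad_ne_zero hp 1) hcr).differentiableAt one_ne_zero
    have hTx : ‖fderiv ℝ (fun x : (Fin 3 → ℝ) × (Fin 3 → ℝ) => unitCross P.σ x.1 x.2)
      (P.grad 0 p, P.grad 1 p)‖ ≤ max A₁ A₂ := (hT _ hx).trans (le_max_left _ _)
    have hGG := (hG 0).prodMk (hG 1)
    exact exists_hasFDerivAt_comp
      (f := fun x : (Fin 3 → ℝ) × (Fin 3 → ℝ) => unitCross P.σ x.1 x.2)
      (g := fun q => (P.grad 0 q, P.grad 1 q)) (x := p) hd hTx hGG
      ((ContinuousLinearMap.opNorm_prod _ _).trans_le (max_le (hGC 0) (hGC 1)))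
  · intro j
    have hd : DifferentiableAt ℝ negUnit (P.grad j p) :=
      (contDiffAt_negUnit (n := 1) (hb.grad_ne_zero hp j)).differentiableAt one_ne_zero
    exact exists_hasFDerivAt_comp (f := negUnit) (g := P.grad j) hd
      ((hN _ ⟨hb.lo_le j p hp, hb.le_hi j p hp⟩).trans (le_max_right _ _)) (hG j) (hGC j)

/-- The convergence vector field has a derivative of size `O(1 + k_p)` near the path. -/
lemma exists_bound_fderiv_hp (hb : P.Bounds lo hi c C) (hP : P.Admissible) :
    ∃ A : ℝ, 0 < A ∧ ∀ kp : ℝ, 0 ≤ kp → ∀ p ∈ P.D, (∀ j, |P.s j p| ≤ 1) →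
      DifferentiableAt ℝ (P.hp kp) p ∧ ∀ v, ‖fderiv ℝ (P.hp kp) p v‖ ≤ A * (1 + kp) * ‖v‖ := by
  obtain ⟨A, hA, hfr⟩ := hb.exists_bound_fderiv_frame hP
  have hC := hb.C_nonneg
  -- The derivative of `h_p` is `u_d ϑ'` plus `k_p` times two terms `s_j N_j' + s_j' N_j`, each of
  -- norm at most `A + C` where `|s_j| ≤ 1`; the summand `1` only ensures positivity.
  refine ⟨P.U * A + 2 * (A + C) + 1, by have := hP.U_pos; positivity, fun kp hkp p hp hs => ?_⟩
  obtain ⟨⟨T', hT, hTA⟩, hN⟩ := hfr p hp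
  obtain ⟨N₀, hN₀, hA₀⟩ := hN 0
  obtain ⟨N₁, hN₁, hA₁⟩ := hN 1
  have hds : ∀ j, HasFDerivAt (P.s j) (fderiv ℝ (P.s j) p) p := fun j =>
    ((contDiffAt_s hP hp j).differentiableAt (by norm_num)).hasFDerivAt
  have h := (hT.const_smul P.ud).add
    ((((hds 0).smul hN₀).add ((hds 1).smul hN₁)).const_smul kp)
  have h' : HasFDerivAt (P.hp kp) _ p := h
  refine ⟨h'.differentiableAt, fun v => ?_⟩
  rw [h'.fderiv]
  have hud : ‖P.ud‖ ≤ P.U := by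
    rw [ud, norm_mul, Real.norm_eq_abs, Real.norm_eq_abs, abs_of_pos hP.U_pos]
    rcases hP.xi_sign with h | h <;> simp [h]
  have hNn : ∀ j, ‖P.normal j p‖ ≤ 1 := fun j =>
    (norm_le_eNorm _).trans (hb.eNorm_normal hp j).le
  have hop : ∀ {L : (Fin 3 → ℝ) →L[ℝ] (Fin 3 → ℝ)}, ‖L‖ ≤ A → ‖L v‖ ≤ A * ‖v‖ := fun hL =>
    ContinuousLinearMap.le_of_opNorm_le _ hL v
  have hterm : ∀ j, ∀ L : (Fin 3 → ℝ) →L[ℝ] (Fin 3 → ℝ), ‖L‖ ≤ A →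
      ‖P.s j p • L v + (fderiv ℝ (P.s j) p v) • P.normal j p‖ ≤ (A + C) * ‖v‖ := by
    intro j L hL
    refine (norm_add_le _ _).trans ?_
    rw [norm_smul, norm_smul]
    have h1 : ‖P.s j p‖ * ‖L v‖ ≤ 1 * (A * ‖v‖) :=
      mul_le_mul (hs j) (hop hL) (norm_nonneg _) zero_le_one
    have h2 : ‖fderiv ℝ (P.s j) p v‖ * ‖P.normal j p‖ ≤ (C * ‖v‖) * 1 :=
      mul_le_mul (ContinuousLinearMap.le_of_opNorm_le _ (hb.deriv_le j p hp) v) (hNn j)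
        (norm_nonneg _) (by positivity)
    linarith
  calc _ = ‖P.ud • T' v + kp • ((P.s 0 p • N₀ v + (fderiv ℝ (P.s 0) p v) • P.normal 0 p) +
        (P.s 1 p • N₁ v + (fderiv ℝ (P.s 1) p v) • P.normal 1 p))‖ := rfl
    _ ≤ P.U * (A * ‖v‖) + kp * ((A + C) * ‖v‖ + (A + C) * ‖v‖) := by
      refine (norm_add_le _ _).trans ?_
      rw [norm_smul, norm_smul, Real.norm_eq_abs kp, abs_of_nonneg hkp]
      exact add_le_add (mul_le_mul hud (hop hTA) (norm_nonneg _) hP.U_pos.le)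
        (mul_le_mul_of_nonneg_left ((norm_add_le _ _).trans
          (add_le_add (hterm 0 N₀ hA₀) (hterm 1 N₁ hA₁))) hkp)
    _ ≤ _ := by
      have h1 := norm_nonneg v
      have h2 : 0 ≤ kp * (P.U * A * ‖v‖) := by have := hP.U_pos; positivity
      have h3 : 0 ≤ (A + C) * ‖v‖ := by positivity
      have h4 : 0 ≤ kp * ‖v‖ := by positivity
      nlinarith

end Bounds

end RefPath

/-! ### Arguments and directions -/

/-- A continuous argument of a differentiable planar vector is differentiable. -/
lemma hasDerivWithinAt_arg {a b ψ : ℝ → ℝ} {a' b' t : ℝ} {s : Set ℝ} (hts : t ∈ s)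
    (ha : HasDerivWithinAt a a' s t) (hb : HasDerivWithinAt b b' s t)
    (hψ : ContinuousWithinAt ψ s t) (hpos : 0 < a t ^ 2 + b t ^ 2)
    (harg : ∀ u ∈ s, a u = Real.sqrt (a u ^ 2 + b u ^ 2) * Real.cos (ψ u) ∧
      b u = Real.sqrt (a u ^ 2 + b u ^ 2) * Real.sin (ψ u)) :
    HasDerivWithinAt ψ ((b' * a t - a' * b t) / (a t ^ 2 + b t ^ 2)) s t := by
  set ρ := Real.sqrt (a t ^ 2 + b t ^ 2) with hρ
  have hρ0 : 0 < ρ := Real.sqrt_pos.2 hpos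
  have hρ2 : ρ ^ 2 = a t ^ 2 + b t ^ 2 := Real.sq_sqrt hpos.le
  obtain ⟨hat, hbt⟩ := harg t hts
  rw [← hρ] at hat hbt
  set c := Real.cos (ψ t)
  set d := Real.sin (ψ t)
  have hcd : d ^ 2 + c ^ 2 = 1 := Real.sin_sq_add_cos_sq _
  have hden : a t * c + b t * d = ρ := by rw [hat, hbt]; linear_combination ρ * hcd
  have hnum : b t * c - a t * d = 0 := by rw [hat, hbt]; ring
  -- After rotation by `-ψ t` the quotient is `tan (ψ u - ψ t)`. Continuity of `ψ` keeps `ψ u`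
  -- within `π / 2` of `ψ t`, so near `t` the arctangent recovers `ψ u - ψ t` on the right branch.
  have hF : HasDerivWithinAt (fun u => (b u * c - a u * d) / (a u * c + b u * d))
      ((b' * a t - a' * b t) / (a t ^ 2 + b t ^ 2)) s t := by
    refine (((hb.mul_const c).fun_sub (ha.mul_const d)).fun_div
      ((ha.mul_const c).fun_add (hb.mul_const d)) (by rw [hden]; exact hρ0.ne')).congr_deriv ?_
    rw [hden, hnum, ← hρ2, hat, hbt]
    field_simp
    ring
  have hG := hF.arctan.const_add (ψ t)
  have hev : ∀ᶠ u in nhdsWithin t s, |ψ u - ψ t| < Real.pi / 2 := by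
    have := hψ.sub_const (ψ t)
    have h0 : Filter.Tendsto (fun u => |ψ u - ψ t|) (nhdsWithin t s) (nhds 0) := by
      simpa using ContinuousWithinAt.tendsto this.abs
    exact h0.eventually_lt_const (by positivity)
  refine (hG.congr_of_eventuallyEq ?_ ?_).congr_deriv ?_
  · have hev2 : ∀ᶠ u in nhdsWithin t s, 0 < a u ^ 2 + b u ^ 2 :=
      ((ha.continuousWithinAt.pow 2).add (hb.continuousWithinAt.pow 2)).tendsto.eventually_const_lt
        hpos
    filter_upwards [hev, hev2, self_mem_nhdsWithin] with u hu hu2 hus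
    obtain ⟨hau, hbu⟩ := harg u hus
    have hr := Real.sqrt_pos.2 hu2
    set r := Real.sqrt (a u ^ 2 + b u ^ 2)
    have e1 : b u * c - a u * d = r * Real.sin (ψ u - ψ t) := by
      rw [Real.sin_sub, hau, hbu]; ring
    have e2 : a u * c + b u * d = r * Real.cos (ψ u - ψ t) := by
      rw [Real.cos_sub, hau, hbu]; ring
    rw [e1, e2, mul_div_mul_left _ _ hr.ne', ← Real.tan_eq_sin_div_cos,
      Real.arctan_tan (abs_lt.1 hu).1 (abs_lt.1 hu).2]
    ring
  · rw [hnum]; simp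
  · rw [hnum]; simp

/-- The direction of the longitudinal axis of the vehicle. -/
noncomputable def bodyAxis (θ ψ : ℝ) : Fin 3 → ℝ :=
  ![Real.cos θ * Real.cos ψ, Real.cos θ * Real.sin ψ, -Real.sin θ]

lemma bodyAxis_dot_self (θ ψ : ℝ) : bodyAxis θ ψ ⬝ᵥ bodyAxis θ ψ = 1 := by
  simp only [bodyAxis, dotProduct, Fin.sum_univ_three, cons_val_zero, cons_val_one, cons_val]
  linear_combination Real.cos θ ^ 2 * Real.sin_sq_add_cos_sq ψ + Real.sin_sq_add_cos_sq θ

lemma rotMat_mulVec_surge (φ θ ψ u : ℝ) : rotMat φ θ ψ *ᵥ ![u, 0, 0] = u • bodyAxis θ ψ := by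
  ext i
  fin_cases i <;> simp [rotMat, bodyAxis, mulVec, dotProduct, Fin.sum_univ_three] <;> ring

/-- Moving along the longitudinal axis with the projected velocity reproduces a vector up to the
misalignment of the axis with it. -/
lemma eNorm_projection_sub_le (L θ ψ θ' ψ' : ℝ) :
    eNorm ((L • bodyAxis θ' ψ' ⬝ᵥ bodyAxis θ ψ) • bodyAxis θ ψ - L • bodyAxis θ' ψ') ≤
      |L| * (|θ' - θ| + |ψ' - ψ|) := by
  set k := bodyAxis θ' ψ' ⬝ᵥ bodyAxis θ ψ with hk
  refine eNorm_le_of_dotProduct_le (by positivity) ?_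
  -- By Pythagoras the squared distance is `L² (1 - k²)`, with `k` the cosine of the angle between
  -- the axes. Then `1 - k² ≤ 2 (1 - k)`, and `1 - k` is at most half the sum of the squared angle
  -- differences.
  have h1 : ((L • bodyAxis θ' ψ' ⬝ᵥ bodyAxis θ ψ) • bodyAxis θ ψ - L • bodyAxis θ' ψ') ⬝ᵥ
      ((L • bodyAxis θ' ψ' ⬝ᵥ bodyAxis θ ψ) • bodyAxis θ ψ - L • bodyAxis θ' ψ') =
      L ^ 2 * (1 - k ^ 2) := by
    simp only [smul_dotProduct, sub_dotProduct, dotProduct_sub, dotProduct_smul, smul_eq_mul,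
      bodyAxis_dot_self, dotProduct_comm (bodyAxis θ ψ), ← hk]
    ring
  have h2 : k = Real.cos (θ' - θ) - Real.cos θ' * Real.cos θ * (1 - Real.cos (ψ' - ψ)) := by
    rw [hk, Real.cos_sub, Real.cos_sub]
    simp only [bodyAxis, dotProduct, Fin.sum_univ_three, cons_val_zero, cons_val_one, cons_val]
    ring
  have h3 := Real.one_sub_sq_div_two_le_cos (x := θ' - θ)
  have h4 := Real.one_sub_sq_div_two_le_cos (x := ψ' - ψ)
  have h5 : Real.cos θ' * Real.cos θ ≤ 1 := by
    have h6 := Real.cos_sq_le_one θ'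
    have h7 := Real.cos_sq_le_one θ
    nlinarith [sq_nonneg (Real.cos θ' - Real.cos θ)]
  have h8 : Real.cos θ' * Real.cos θ * (1 - Real.cos (ψ' - ψ)) ≤ (ψ' - ψ) ^ 2 / 2 := by
    have := Real.cos_le_one (ψ' - ψ)
    nlinarith
  have h9 : 1 - k ^ 2 ≤ (|θ' - θ| + |ψ' - ψ|) ^ 2 := by
    have e1 := sq_abs (θ' - θ)
    have e2 := sq_abs (ψ' - ψ)
    nlinarith [sq_nonneg (1 - k), mul_nonneg (abs_nonneg (θ' - θ)) (abs_nonneg (ψ' - ψ))]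
  rw [h1, mul_pow, sq_abs]
  exact mul_le_mul_of_nonneg_left h9 (sq_nonneg L)

/-- Polar form of a vector with respect to its pitch and yaw angles. -/
lemma eq_smul_bodyAxis {h : Fin 3 → ℝ} {g ψ : ℝ} (hg : g ≠ 0) (h0 : h 0 = g * Real.cos ψ)
    (h1 : h 1 = g * Real.sin ψ) :
    h = (g / Real.cos (Real.arctan (-h 2 / g))) • bodyAxis (Real.arctan (-h 2 / g)) ψ := by
  set θ := Real.arctan (-h 2 / g) with hθ
  have hc : Real.cos θ ≠ 0 := (Real.cos_arctan_pos _).ne'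
  have ht : Real.sin θ / Real.cos θ = -h 2 / g := by
    rw [← Real.tan_eq_sin_div_cos, hθ, Real.tan_arctan]
  ext i
  fin_cases i
  · simp [bodyAxis, h0]; field_simp
  · simp [bodyAxis, h1]; field_simp
  · simp only [bodyAxis, Fin.reduceFinMk, Pi.smul_apply, cons_val, smul_eq_mul]
    have : g / Real.cos θ * -Real.sin θ = -g * (Real.sin θ / Real.cos θ) := by ring
    rw [this, ht]
    field_simp

lemma abs_eq_eNorm_of_eq_smul_bodyAxis {h : Fin 3 → ℝ} {L θ ψ : ℝ} (hh : h = L • bodyAxis θ ψ) :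
    |L| = eNorm h := by
  rw [hh, eNorm_smul, eNorm_eq_sqrt, bodyAxis_dot_self, Real.sqrt_one, mul_one]

/-! ### Kinematics of the closed loop -/

namespace Setup

variable {S : Setup} {X : Signals} {t : ℝ}

lemma IsSolution.hasDerivWithinAt_pos (h : S.IsSolution X) (ht : 0 ≤ t) :
    HasDerivWithinAt (fun s => pos (X.η s))
      (S.uc X t • bodyAxis (pitch (X.η t)) (yaw (X.η t)) - pos (S.ε X t)) (Set.Ici 0) t := by
  have h1 := hasDerivWithinAt_pi.1 (h.kinematics t ht)
  rw [← rotMat_mulVec_surge (roll (X.η t)), hasDerivWithinAt_pi]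
  intro i
  refine (h1 (Sum.inl i)).congr_deriv ?_
  have h2 : pos (S.ηcDot X t) =
      rotMat (roll (X.η t)) (pitch (X.η t)) (yaw (X.η t)) *ᵥ ![S.uc X t, 0, 0] := by
    rw [ηcDot, jac, pos_fromBlocks_mulVec]
    rfl
  rw [← h2]
  simp [pos, ε]

/-- Zero roll decouples the angles: the pitch rate is then `q` and the yaw rate is `r / cos θ`,
whose denominator cancels the factor `cos θ` in `r_c`. -/
lemma IsSolution.hasDerivWithinAt_pitch (h : S.IsSolution X) (ht : 0 ≤ t)
    (hroll : roll (X.η t) = 0) :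
    HasDerivWithinAt (fun s => pitch (X.η s)) (S.hθ X t - S.ε X t (Sum.inr 1)) (Set.Ici 0) t := by
  refine (hasDerivWithinAt_pi.1 (h.kinematics t ht) (Sum.inr 1)).congr_deriv ?_
  have h2 : S.ηcDot X t (Sum.inr 1) = S.hθ X t := by
    rw [ηcDot, jac, fromBlocks_mulVec_inr, hroll]
    simp [angMat, νc, qc, mulVec, dotProduct, Fin.sum_univ_three]
  rw [ε, Pi.sub_apply, h2]
  ring

lemma IsSolution.hasDerivWithinAt_yaw (h : S.IsSolution X) (ht : 0 ≤ t)
    (hroll : roll (X.η t) = 0) :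
    HasDerivWithinAt (fun s => yaw (X.η s)) (S.hψ X t - S.ε X t (Sum.inr 2)) (Set.Ici 0) t := by
  refine (hasDerivWithinAt_pi.1 (h.kinematics t ht) (Sum.inr 2)).congr_deriv ?_
  have hc := (h.cos_pitch_pos ht).ne'
  have h2 : S.ηcDot X t (Sum.inr 2) = S.hψ X t := by
    rw [ηcDot, jac, fromBlocks_mulVec_inr, hroll]
    simp [angMat, νc, rc, mulVec, dotProduct, Fin.sum_univ_three]
    field_simp
  rw [ε, Pi.sub_apply, h2]
  ring

lemma uc_eq : S.uc X t = S.h X t ⬝ᵥ bodyAxis (pitch (X.η t)) (yaw (X.η t)) := by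
  simp only [uc, bodyAxis, dotProduct, Fin.sum_univ_three, cons_val_zero, cons_val_one, cons_val]
  ring

/-- The observer state is differentiated exactly, so the only error of `hDotHat` comes from using
the estimated velocity, which misses the true one by `ε̂_p - ε_p`. -/
lemma IsSolution.hasDerivWithinAt_h (h : S.IsSolution X) (ht : 0 ≤ t)
    (hd : DifferentiableAt ℝ (S.P.hp S.G.kp) (pos (X.η t))) :
    HasDerivWithinAt (S.h X) (S.hDotHat X t + fderiv ℝ (S.P.hp S.G.kp) (pos (X.η t))
      (pos (X.eh t) - pos (S.ε X t))) (Set.Ici 0) t := by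
  have h1 := hd.hasFDerivAt.comp_hasDerivWithinAt t (h.hasDerivWithinAt_pos ht)
  have h2 : HasDerivWithinAt (fun s => pos (X.eh s)) (pos (S.ehDot X t)) (Set.Ici 0) t :=
    hasDerivWithinAt_pi.2 fun i => hasDerivWithinAt_pi.1 (h.observer_e t ht) (Sum.inl i)
  refine (h1.add (h2.const_smul S.G.δp)).congr_deriv ?_
  have h3 : S.uc X t • bodyAxis (pitch (X.η t)) (yaw (X.η t)) - pos (S.ε X t) =
      S.velHat X t + (pos (X.eh t) - pos (S.ε X t)) := by
    rw [velHat, rotMat_mulVec_surge]; abel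
  rw [h3, map_add, hDotHat]
  abel

lemma lastReg_eq (ht : t ∈ S.regular X) : S.lastReg X t = t :=
  IsGreatest.csSup_eq ⟨⟨ht, le_rfl⟩, fun _ hs => hs.2⟩

lemma θa_eq (ht : t ∈ S.regular X) : S.θa X t = Real.arctan (-S.h X t 2 / S.g X t) := by
  rw [θa, lastReg_eq ht]

/-- The auxiliary yaw angle is the argument of the horizontal part of `ĥ_p*`, up to sign. -/
lemma IsSolution.h_eq (h : S.IsSolution X) (hP : S.P.Admissible) (ht : t ∈ S.regular X) :
    S.h X t 0 = S.g X t * Real.cos (X.ψa t) ∧ S.h X t 1 = S.g X t * Real.sin (X.ψa t) ∧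
      S.g X t ^ 2 = S.horiz X t := by
  obtain ⟨h0, h1⟩ := h.yaw_aux t ht
  have hξ : S.P.ξ ^ 2 = 1 := by rcases hP.xi_sign with h | h <;> rw [h] <;> norm_num
  have hcs := Real.sin_sq_add_cos_sq (X.ψa t)
  have hsq : Real.sqrt (S.horiz X t) ^ 2 = S.horiz X t :=
    Real.sq_sqrt (add_nonneg (sq_nonneg _) (sq_nonneg _))
  set r := Real.sqrt (S.horiz X t)
  have e0 : S.h X t 0 = S.P.ξ * r * Real.cos (X.ψa t) := by
    linear_combination S.P.ξ * h0 - S.h X t 0 * hξ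
  have e1 : S.h X t 1 = S.P.ξ * r * Real.sin (X.ψa t) := by
    linear_combination S.P.ξ * h1 - S.h X t 1 * hξ
  have eg : S.g X t = S.P.ξ * r := by
    rw [g, e0, e1]; linear_combination S.P.ξ * r * hcs
  refine ⟨by rw [eg, e0], by rw [eg, e1], ?_⟩
  rw [eg, mul_pow, hξ, hsq, one_mul]

/-- Errors of the estimated rates of the auxiliary angles caused by an error `w` of the estimated
rate of `ĥ_p*`. -/
noncomputable def yawRateErr (S : Setup) (X : Signals) (t : ℝ) (w : Fin 3 → ℝ) : ℝ :=
  (w 1 * S.h X t 0 - w 0 * S.h X t 1) / S.horiz X t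

noncomputable def pitchRateErr (S : Setup) (X : Signals) (t : ℝ) (w : Fin 3 → ℝ) : ℝ :=
  -(w 2 * S.g X t - S.h X t 2 * (w 0 * Real.cos (X.ψa t) + w 1 * Real.sin (X.ψa t))) /
    (S.h X t 2 ^ 2 + S.g X t ^ 2)

lemma abs_yawRateErr_le {w : Fin 3 → ℝ} {W H μ : ℝ} (hμ : 0 < μ) (hh : μ ≤ S.horiz X t)
    (hw : ∀ i, |w i| ≤ W) (hH : ∀ i, |S.h X t i| ≤ H) :
    |yawRateErr S X t w| ≤ 4 * W * H / μ := by
  have hW : 0 ≤ W := (abs_nonneg _).trans (hw 0)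
  have hH0 : 0 ≤ H := (abs_nonneg _).trans (hH 0)
  rw [yawRateErr, abs_div, abs_of_pos (hμ.trans_le hh)]
  refine div_le_div₀ (by positivity) ?_ hμ hh
  refine (abs_sub _ _).trans ?_
  rw [abs_mul, abs_mul]
  have h1 := mul_le_mul (hw 1) (hH 0) (abs_nonneg _) hW
  have h2 := mul_le_mul (hw 0) (hH 1) (abs_nonneg _) hW
  nlinarith [mul_nonneg hW hH0]

lemma abs_pitchRateErr_le (hs : S.g X t ^ 2 = S.horiz X t) {w : Fin 3 → ℝ} {W H μ : ℝ}
    (hμ : 0 < μ) (hh : μ ≤ S.horiz X t)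
    (hw : ∀ i, |w i| ≤ W) (hH : ∀ i, |S.h X t i| ≤ H) :
    |pitchRateErr S X t w| ≤ 4 * W * H / μ := by
  have hW : 0 ≤ W := (abs_nonneg _).trans (hw 0)
  have hH0 : 0 ≤ H := (abs_nonneg _).trans (hH 0)
  have hc := Real.abs_cos_le_one (X.ψa t)
  have hsn := Real.abs_sin_le_one (X.ψa t)
  have hden : μ ≤ S.h X t 2 ^ 2 + S.g X t ^ 2 := by nlinarith [sq_nonneg (S.h X t 2)]
  rw [pitchRateErr, abs_div, abs_of_pos (hμ.trans_le hden), abs_neg]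
  refine div_le_div₀ (by positivity) ?_ hμ hden
  have hg : |S.g X t| ≤ 2 * H := by
    rw [g]
    refine (abs_add_le _ _).trans ?_
    rw [abs_mul, abs_mul]
    have h1 := mul_le_mul (hH 0) hc (abs_nonneg _) hH0
    have h2 := mul_le_mul (hH 1) hsn (abs_nonneg _) hH0
    linarith
  have h1 := mul_le_mul (hw 2) hg (abs_nonneg _) hW
  have h2 : |w 0 * Real.cos (X.ψa t) + w 1 * Real.sin (X.ψa t)| ≤ 2 * W := by
    refine (abs_add_le _ _).trans ?_
    rw [abs_mul, abs_mul]
    have h1 := mul_le_mul (hw 0) hc (abs_nonneg _) hW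
    have h2 := mul_le_mul (hw 1) hsn (abs_nonneg _) hW
    linarith
  have h3 := mul_le_mul (hH 2) h2 (abs_nonneg _) hH0
  refine (abs_sub _ _).trans ?_
  rw [abs_mul, abs_mul]
  linarith

section aux

variable {s : Set ℝ}

/-- The rate of an argument is linear in the rate of the vector, so an error `w` of the latter
enters through the same formula. The sign `ξ` drops out because `ξ ^ 2 = 1`. -/
lemma IsSolution.hasDerivWithinAt_ψa (h : S.IsSolution X) (hP : S.P.Admissible)
    (hε : 0 < S.εf) (hs : s ⊆ S.regular X) (hts : t ∈ s)
    (hd : DifferentiableAt ℝ (S.P.hp S.G.kp) (pos (X.η t))) :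
    HasDerivWithinAt X.ψa (S.ψaDotRaw X t + yawRateErr S X t (fderiv ℝ (S.P.hp S.G.kp)
      (pos (X.η t)) (pos (X.eh t) - pos (S.ε X t)))) s t := by
  have ht := hs hts
  have hh := (h.hasDerivWithinAt_h ht.1 hd).mono (fun u hu => (hs hu).1 : s ⊆ Set.Ici 0)
  set w := fderiv ℝ (S.P.hp S.G.kp) (pos (X.η t)) (pos (X.eh t) - pos (S.ε X t))
  rw [hasDerivWithinAt_pi] at hh
  have hξ : S.P.ξ ^ 2 = 1 := by rcases hP.xi_sign with h | h <;> rw [h] <;> norm_num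
  have hsq : ∀ u, (S.P.ξ * S.h X u 0) ^ 2 + (S.P.ξ * S.h X u 1) ^ 2 = S.horiz X u := fun u => by
    rw [horiz, mul_pow, mul_pow, hξ, one_mul, one_mul]
  have hpos : 0 < S.horiz X t := hε.trans_le ht.2
  have key := hasDerivWithinAt_arg hts ((hh 0).const_mul S.P.ξ) ((hh 1).const_mul S.P.ξ)
    ((h.yaw_aux_cont t ht).mono hs) (by rw [hsq]; exact hpos)
    (fun u hu => by rw [hsq]; exact h.yaw_aux u (hs hu))
  refine key.congr_deriv ?_
  rw [hsq, ψaDotRaw, yawRateErr, ← add_div]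
  congr 1
  simp only [Pi.add_apply]
  linear_combination ((S.hDotHat X t 1 + w 1) * S.h X t 0 -
    (S.hDotHat X t 0 + w 0) * S.h X t 1) * hξ

lemma IsSolution.hasDerivWithinAt_θa (h : S.IsSolution X) (hP : S.P.Admissible)
    (hε : 0 < S.εf) (hs : s ⊆ S.regular X) (hts : t ∈ s)
    (hd : DifferentiableAt ℝ (S.P.hp S.G.kp) (pos (X.η t))) :
    HasDerivWithinAt (S.θa X) (S.θaDotRaw X t + pitchRateErr S X t (fderiv ℝ (S.P.hp S.G.kp)
      (pos (X.η t)) (pos (X.eh t) - pos (S.ε X t)))) s t := by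
  have ht := hs hts
  have hψ := h.hasDerivWithinAt_ψa hP hε hs hts hd
  have hh := (h.hasDerivWithinAt_h ht.1 hd).mono (fun u hu => (hs hu).1 : s ⊆ Set.Ici 0)
  set w := fderiv ℝ (S.P.hp S.G.kp) (pos (X.η t)) (pos (X.eh t) - pos (S.ε X t))
  rw [hasDerivWithinAt_pi] at hh
  obtain ⟨e0, e1, eg⟩ := h.h_eq hP ht
  have hg0 : S.g X t ≠ 0 := fun h0 => by
    rw [h0] at eg
    have := hε.trans_le ht.2
    rw [← eg] at this
    norm_num at this
  have hg := ((hh 0).fun_mul hψ.cos).fun_add ((hh 1).fun_mul hψ.sin)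
  have key := (((hh 2).fun_neg.fun_div hg hg0).arctan).congr (f₁ := S.θa X)
    (fun u hu => θa_eq (hs hu)) (θa_eq ht)
  refine key.congr_deriv ?_
  have hgt : S.h X t 0 * Real.cos (X.ψa t) + S.h X t 1 * Real.sin (X.ψa t) = S.g X t := rfl
  -- The horizontal part of `ĥ_p*` is parallel to `(cos ψ_a, sin ψ_a)`, so the rate of `ψ_a` does
  -- not contribute to that of `g`; hence the yaw rate error is absent from `pitchRateErr`.
  have hz : -(S.h X t 0 * Real.sin (X.ψa t)) + S.h X t 1 * Real.cos (X.ψa t) = 0 := by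
    rw [e0, e1]; ring
  simp only [Pi.add_apply]
  rw [hgt, θaDotRaw, pitchRateErr]
  have hden : S.h X t 2 ^ 2 + S.g X t ^ 2 ≠ 0 := by positivity
  have hfrac : ∀ N : ℝ, 1 / (1 + (-S.h X t 2 / S.g X t) ^ 2) * (N / S.g X t ^ 2) =
      N / (S.h X t 2 ^ 2 + S.g X t ^ 2) := fun N => by
    have : 1 + (-S.h X t 2 / S.g X t) ^ 2 = (S.h X t 2 ^ 2 + S.g X t ^ 2) / S.g X t ^ 2 := by
      field_simp; ring
    rw [this]
    field_simp
  rw [hfrac, ← add_div]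
  congr 1
  linear_combination S.h X t 2 * S.yawRateErr X t w * hz

end aux

end Setup

/-! ### Stability of the auxiliary orientation error. -/

namespace Setup

variable {S : Setup} {X : Signals} {t : ℝ}

/-- The auxiliary orientation errors stay small while the auxiliary orientation is not frozen. -/
lemma IsSolution.abs_ea_le (h : S.IsSolution X) (hP : S.P.Admissible) (hε : 0 < S.εf)
    (hδ : 0 ≤ S.G.δo) (hδ' : S.G.δo ≤ 1) {T₀ T₁ Ee Eo W H μ B : ℝ}
    (hreg : Set.Icc T₀ T₁ ⊆ S.regular X) (hroll : ∀ t ∈ Set.Icc T₀ T₁, roll (X.η t) = 0)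
    (hd : ∀ t ∈ Set.Icc T₀ T₁, DifferentiableAt ℝ (S.P.hp S.G.kp) (pos (X.η t)))
    (hW : ∀ t ∈ Set.Icc T₀ T₁, ‖fderiv ℝ (S.P.hp S.G.kp) (pos (X.η t))
      (pos (X.eh t) - pos (S.ε X t))‖ ≤ W)
    (hμ : 0 < μ) (hh : ∀ t ∈ Set.Icc T₀ T₁, μ ≤ S.horiz X t)
    (hH : ∀ t ∈ Set.Icc T₀ T₁, ∀ i, |S.h X t i| ≤ H)
    (he : ∀ t ∈ Set.Icc T₀ T₁, ∀ i, |S.ε X t i - X.eh t i| ≤ Ee)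
    (ho : ∀ t ∈ Set.Icc T₀ T₁, ∀ i, |S.ε X t (Sum.inr i)| ≤ Eo)
    (hinit : eNorm (S.ea X T₀) ≤ B)
    (hθ : Eo + Ee + 4 * W * H / μ < S.G.kθ * B) (hψ : Eo + Ee + 4 * W * H / μ < S.G.kψ * B) :
    ∀ t ∈ Set.Icc T₀ T₁, |S.θa X t - pitch (X.η t)| ≤ B ∧ |X.ψa t - yaw (X.η t)| ≤ B := by
  have hsub : Set.Icc T₀ T₁ ⊆ Set.Ici 0 := fun u hu => (hreg hu).1
  set w : ℝ → Fin 3 → ℝ := fun t => fderiv ℝ (S.P.hp S.G.kp) (pos (X.η t))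
      (pos (X.eh t) - pos (S.ε X t)) with hw
  have hwi : ∀ t ∈ Set.Icc T₀ T₁, ∀ i, |w t i| ≤ W := fun t ht i =>
    (norm_le_pi_norm (w t) i).trans (hW t ht)
  -- Written as a convex combination of `ε` and `ε - ε̂`, the disturbance of the orientation loop
  -- has a bound uniform in `δ_o ∈ [0, 1]`.
  have hmix : ∀ t ∈ Set.Icc T₀ T₁, ∀ i : Fin 3,
      |S.ε X t (Sum.inr i) - S.G.δo * X.eh t (Sum.inr i)| ≤ Eo + Ee := by
    intro t ht i
    have h1 : S.ε X t (Sum.inr i) - S.G.δo * X.eh t (Sum.inr i) =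
        (1 - S.G.δo) * S.ε X t (Sum.inr i) +
          S.G.δo * (S.ε X t (Sum.inr i) - X.eh t (Sum.inr i)) := by ring
    rw [h1]
    refine (abs_add_le _ _).trans ?_
    rw [abs_mul, abs_mul, abs_of_nonneg hδ, abs_of_nonneg (sub_nonneg.2 hδ')]
    have h2 := mul_le_mul_of_nonneg_left (ho t ht i) (sub_nonneg.2 hδ')
    have h3 := mul_le_mul_of_nonneg_left (he t ht (Sum.inr i)) hδ
    have h4 := (abs_nonneg _).trans (ho t ht i)
    have h5 := (abs_nonneg _).trans (he t ht (Sum.inr i))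
    nlinarith
  intro t ht
  constructor
  · refine abs_le_of_linear_ode (k := S.G.kθ) (f := fun s => S.θa X s - pitch (X.η s))
      (u := fun s => pitchRateErr S X s (w s) +
        (S.ε X s (Sum.inr 1) - S.G.δo * X.eh s (Sum.inr 1))) ?_ ?_ ?_ t ht
    · intro s hs
      refine ((h.hasDerivWithinAt_θa hP hε hreg hs (hd s hs)).sub
        ((h.hasDerivWithinAt_pitch (hsub hs) (hroll s hs)).mono hsub)).congr_deriv ?_
      rw [Setup.hθ, lastReg_eq (hreg hs)]
      simp only [ea, cons_val_zero]
      ring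
    · exact (abs_le_eNorm (S.ea X T₀) 0).trans hinit
    · intro s hs
      have h1 := abs_pitchRateErr_le (h.h_eq hP (hreg hs)).2.2 hμ (hh s hs) (hwi s hs) (hH s hs)
      linarith [hmix s hs 1, abs_add_le (pitchRateErr S X s (w s))
        (S.ε X s (Sum.inr 1) - S.G.δo * X.eh s (Sum.inr 1))]
  · refine abs_le_of_linear_ode (k := S.G.kψ) (f := fun s => X.ψa s - yaw (X.η s))
      (u := fun s => yawRateErr S X s (w s) +
        (S.ε X s (Sum.inr 2) - S.G.δo * X.eh s (Sum.inr 2))) ?_ ?_ ?_ t ht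
    · intro s hs
      refine ((h.hasDerivWithinAt_ψa hP hε hreg hs (hd s hs)).sub
        ((h.hasDerivWithinAt_yaw (hsub hs) (hroll s hs)).mono hsub)).congr_deriv ?_
      rw [Setup.hψ, lastReg_eq (hreg hs)]
      simp only [ea, cons_val_one, cons_val_zero]
      ring
    · exact (abs_le_eNorm (S.ea X T₀) 1).trans hinit
    · intro s hs
      have h1 := abs_yawRateErr_le hμ (hh s hs) (hwi s hs) (hH s hs)
      linarith [hmix s hs 2, abs_add_le (yawRateErr S X s (w s))
        (S.ε X s (Sum.inr 2) - S.G.δo * X.eh s (Sum.inr 2))]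

/-! ### Level-surface functions along the motion. -/

lemma fderiv_s_apply (P : RefPath) (j : Fin 2) (p v : Fin 3 → ℝ) :
    fderiv ℝ (P.s j) p v = P.grad j p ⬝ᵥ v := by
  conv_lhs => rw [pi_eq_sum_univ' v]
  simp only [map_sum, dotProduct, RefPath.grad]
  refine Finset.sum_congr rfl fun i _ => ?_
  rw [map_smul, smul_eq_mul, mul_comm]

/-- Deviation of the translational velocity from the convergence vector field. -/
noncomputable def velDev (S : Setup) (X : Signals) (t : ℝ) : Fin 3 → ℝ :=
  (S.uc X t • bodyAxis (pitch (X.η t)) (yaw (X.η t)) - S.h X t) +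
    (S.G.δp • pos (X.eh t) - pos (S.ε X t))

lemma IsSolution.hasDerivWithinAt_s (h : S.IsSolution X) (hP : S.P.Admissible) (ht : 0 ≤ t)
    (j : Fin 2) :
    HasDerivWithinAt (fun u => S.P.s j (pos (X.η u)))
      (S.P.grad j (pos (X.η t)) ⬝ᵥ (S.P.hp S.G.kp (pos (X.η t)) + S.velDev X t))
      (Set.Ici 0) t := by
  have h1 := ((RefPath.Bounds.contDiffAt_s hP (h.mem_D t ht) j).differentiableAt
    (by norm_num)).hasFDerivAt.comp_hasDerivWithinAt t (h.hasDerivWithinAt_pos ht)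
  refine h1.congr_deriv ?_
  rw [fderiv_s_apply]
  congr 1
  rw [velDev, Setup.h]
  abel

/-- The first term is the misalignment of the body axis with `ĥ_p*`. In backward motion `ĥ_p*` is a
negative multiple of the auxiliary axis, which is harmless because the surge command is the signed
projection of `ĥ_p*`. The second is `-(1 - δ_p) ε_p - δ_p (ε_p - ε̂_p)`, bounded uniformly in `δ_p`.
-/
lemma IsSolution.eNorm_velDev_le (h : S.IsSolution X) (hP : S.P.Admissible) (hε : 0 < S.εf)
    (hδ : 0 ≤ S.G.δp) (hδ' : S.G.δp < 1) (ht : t ∈ S.regular X) {Ee Ep H Ea : ℝ}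
    (he : ∀ i, |S.ε X t i - X.eh t i| ≤ Ee) (hp : eNorm (pos (S.ε X t)) ≤ Ep)
    (hH : eNorm (S.h X t) ≤ H) (hθ : |S.θa X t - pitch (X.η t)| ≤ Ea)
    (hψ : |X.ψa t - yaw (X.η t)| ≤ Ea) :
    eNorm (S.velDev X t) ≤ H * (2 * Ea) + (Ep + 2 * Ee) := by
  have hH0 : 0 ≤ H := (eNorm_nonneg _).trans hH
  refine (eNorm_add_le _ _).trans (add_le_add ?_ ?_)
  · obtain ⟨e0, e1, eg⟩ := h.h_eq hP ht
    have hg0 : S.g X t ≠ 0 := fun h0 => by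
      rw [h0] at eg
      have := hε.trans_le ht.2
      rw [← eg] at this
      norm_num at this
    have hpol := eq_smul_bodyAxis hg0 e0 e1
    rw [← θa_eq ht] at hpol
    have h1 := eNorm_projection_sub_le (S.g X t / Real.cos (S.θa X t)) (pitch (X.η t))
      (yaw (X.η t)) (S.θa X t) (X.ψa t)
    rw [abs_eq_eNorm_of_eq_smul_bodyAxis hpol, ← hpol, ← uc_eq] at h1
    exact h1.trans (mul_le_mul hH (by linarith) (by positivity) hH0)
  · have h1 : S.G.δp • pos (X.eh t) - pos (S.ε X t) =
        (-(1 - S.G.δp)) • pos (S.ε X t) - S.G.δp • (pos (S.ε X t) - pos (X.eh t)) := by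
      ext i; simp; ring
    have h2 : eNorm (pos (S.ε X t) - pos (X.eh t)) ≤ 2 * Ee := eNorm_le_two_mul fun i => he _
    rw [h1]
    refine (eNorm_sub_le _ _).trans ?_
    rw [eNorm_smul, eNorm_smul, abs_neg, abs_of_nonneg hδ, abs_of_nonneg (sub_nonneg.2 hδ'.le)]
    have h3 := eNorm_nonneg (pos (S.ε X t))
    have h4 := eNorm_nonneg (pos (S.ε X t) - pos (X.eh t))
    nlinarith

end Setup

namespace RefPath.Bounds

variable {P : RefPath} {lo hi c C : ℝ} {p : Fin 3 → ℝ}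

lemma tangent_dot_normal (j : Fin 2) : P.normal j p ⬝ᵥ P.tangent p = 0 := by
  rw [tangent, dotProduct_smul]
  fin_cases j
  · exact (congrArg _ (dot_self_cross _ _)).trans (smul_zero _)
  · exact (congrArg _ (dot_cross_self _ _)).trans (smul_zero _)

/-- The level-surface functions decay along the convergence vector field; since the normals are
uniformly non-collinear, the decay dominates the coupling in the maximum norm. -/
lemma abs_grad_dot_add_le (hb : P.Bounds lo hi c C) (hp : p ∈ P.D) {kp Sb ρ : ℝ} (hkp : 0 ≤ kp)
    (hS : ∀ j, |P.s j p| ≤ Sb) {v : Fin 3 → ℝ} (hv : eNorm v ≤ ρ) (j : Fin 2) :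
    |P.grad j p ⬝ᵥ (P.hp kp p + v) + eNorm (P.grad j p) * kp * P.s j p| ≤
      eNorm (P.grad j p) * kp * (c * Sb) + hi * ρ := by
  have hg := eNorm_nonneg (P.grad j p)
  have hn : ∀ j, P.normal j p ⬝ᵥ P.normal j p = 1 := fun j => by
    rw [← eNorm_sq, hb.eNorm_normal hp, one_pow]
  have hSb : 0 ≤ Sb := (abs_nonneg _).trans (hS 0)
  -- The tangential part of `h_p` has no component along `N_j`, and the other level-surface function
  -- enters only through `N₀ ⬝ᵥ N₁`, of absolute value at most `c`.
  have hhp : ∃ z, |z| ≤ c * Sb ∧ P.normal j p ⬝ᵥ P.hp kp p = kp * (P.s j p + z) := by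
    have hc := hb.abs_normal_dot hp
    fin_cases j
    · refine ⟨P.s 1 p * (P.normal 0 p ⬝ᵥ P.normal 1 p), ?_, ?_⟩
      · rw [abs_mul, mul_comm]
        exact mul_le_mul hc (hS 1) (abs_nonneg _) hb.c_nonneg
      · simp only [Fin.zero_eta, dotProduct_add, dotProduct_smul, tangent_dot_normal,
          smul_eq_mul, RefPath.hp, hn]
        ring
    · refine ⟨P.s 0 p * (P.normal 0 p ⬝ᵥ P.normal 1 p), ?_, ?_⟩
      · rw [abs_mul, mul_comm]
        exact mul_le_mul hc (hS 0) (abs_nonneg _) hb.c_nonneg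
      · simp only [Fin.mk_one, dotProduct_add, dotProduct_smul, tangent_dot_normal,
          smul_eq_mul, RefPath.hp, hn, dotProduct_comm (P.normal 1 p) (P.normal 0 p)]
        ring
  obtain ⟨z, hz, hN⟩ := hhp
  have h1 : P.grad j p ⬝ᵥ P.hp kp p = -(eNorm (P.grad j p) * kp * (P.s j p + z)) := by
    conv_lhs => rw [hb.grad_eq hp j]
    rw [neg_dotProduct, smul_dotProduct, hN, smul_eq_mul]
    ring
  have h2 : |P.grad j p ⬝ᵥ v| ≤ hi * ρ :=
    (abs_dotProduct_le _ _).trans (mul_le_mul (hb.le_hi j p hp) hv (eNorm_nonneg _) hb.hi_pos.le)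
  have h3 : P.grad j p ⬝ᵥ (P.hp kp p + v) + eNorm (P.grad j p) * kp * P.s j p =
      -(eNorm (P.grad j p) * kp * z) + P.grad j p ⬝ᵥ v := by
    rw [dotProduct_add, h1]; ring
  rw [h3]
  refine (abs_add_le _ _).trans (add_le_add ?_ h2)
  rw [abs_neg, abs_mul, abs_of_nonneg (by positivity)]
  gcongr

end RefPath.Bounds

lemma eNorm_horizontal_le (v : Fin 3 → ℝ) : eNorm ![v 0, v 1] ≤ eNorm v := by
  refine eNorm_le_of_dotProduct_le (eNorm_nonneg _) ?_
  rw [eNorm_sq]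
  simp only [dotProduct, Fin.sum_univ_two, Fin.sum_univ_three, cons_val_zero, cons_val_one]
  nlinarith [mul_self_nonneg (v 2)]

namespace Setup

variable {S : Setup} {X : Signals} {t : ℝ} {lo hi c C : ℝ}

/-- Deviation of `ĥ_p*` from the reference velocity `u_d ϑ`. -/
lemma eNorm_h_sub_le (hb : S.P.Bounds lo hi c C) (hD : pos (X.η t) ∈ S.P.D) (hkp : 0 ≤ S.G.kp)
    (hδ : 0 ≤ S.G.δp) (hδ' : S.G.δp < 1) {Sb Ee Ep : ℝ}
    (hS : ∀ j, |S.P.s j (pos (X.η t))| ≤ Sb) (he : ∀ i, |S.ε X t i - X.eh t i| ≤ Ee)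
    (hp : eNorm (pos (S.ε X t)) ≤ Ep) :
    eNorm (S.h X t - S.P.ud • S.P.tangent (pos (X.η t))) ≤
      2 * S.G.kp * Sb + (Ep + 2 * Ee) := by
  have h1 : S.h X t - S.P.ud • S.P.tangent (pos (X.η t)) =
      S.G.kp • (S.P.s 0 (pos (X.η t)) • S.P.normal 0 (pos (X.η t)) +
        S.P.s 1 (pos (X.η t)) • S.P.normal 1 (pos (X.η t))) +
      S.G.δp • (pos (S.ε X t) - (pos (S.ε X t) - pos (X.eh t))) := by
    rw [h, RefPath.hp]; abel_nf
  have h2 : eNorm (pos (S.ε X t) - pos (X.eh t)) ≤ 2 * Ee := eNorm_le_two_mul fun i => he _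
  have h3 := (eNorm_sub_le (pos (S.ε X t)) (pos (S.ε X t) - pos (X.eh t))).trans (add_le_add hp h2)
  have h4 : ∀ j, eNorm (S.P.s j (pos (X.η t)) • S.P.normal j (pos (X.η t))) ≤ Sb := fun j => by
    rw [eNorm_smul, hb.eNorm_normal hD, mul_one]; exact hS j
  rw [h1]
  refine (eNorm_add_le _ _).trans (add_le_add ?_ ?_)
  · rw [eNorm_smul, abs_of_nonneg hkp]
    have := mul_le_mul_of_nonneg_left
      ((eNorm_add_le _ _).trans (add_le_add (h4 0) (h4 1))) hkp
    linarith
  · rw [eNorm_smul, abs_of_nonneg hδ]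
    exact (mul_le_of_le_one_left (eNorm_nonneg _) hδ'.le).trans h3

lemma abs_ud (hP : S.P.Admissible) : |S.P.ud| = S.P.U := by
  rw [RefPath.ud, abs_mul, abs_of_pos hP.U_pos]
  rcases hP.xi_sign with h | h <;> simp [h]

lemma horiz_eq : S.horiz X t = eNorm ![S.h X t 0, S.h X t 1] ^ 2 := by
  rw [eNorm_sq, horiz]
  simp [dotProduct, Fin.sum_univ_two, sq]

/-- The horizontal part of `u_d ϑ` has length at least `U m`, and the deviation may use up half of
it. This is where the freezing threshold `(U m / 2)²` comes from. -/
lemma horiz_bounds (hP : S.P.Admissible) (hb : S.P.Bounds lo hi c C)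
    (hD : pos (X.η t) ∈ S.P.D) {m ρ : ℝ} (hm : 0 < m) (hm1 : m ≤ 1)
    (hvert : m ≤ eNorm ![S.P.tangent (pos (X.η t)) 0, S.P.tangent (pos (X.η t)) 1])
    (hρ : eNorm (S.h X t - S.P.ud • S.P.tangent (pos (X.η t))) ≤ ρ)
    (hρm : ρ ≤ S.P.U * m / 2) :
    (S.P.U * m / 2) ^ 2 ≤ S.horiz X t ∧ eNorm (S.h X t) ≤ 2 * S.P.U := by
  have hU := hP.U_pos
  set ϑ := S.P.tangent (pos (X.η t))
  set e := S.h X t - S.P.ud • ϑ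
  have he := hρ.trans hρm
  constructor
  · have h1 : S.P.ud • ![ϑ 0, ϑ 1] = ![S.h X t 0, S.h X t 1] - ![e 0, e 1] := by
      ext i; fin_cases i <;> simp [e]
    have h2 := eNorm_sub_le ![S.h X t 0, S.h X t 1] ![e 0, e 1]
    rw [← h1, eNorm_smul, abs_ud hP] at h2
    have h3 := mul_le_mul_of_nonneg_left hvert hU.le
    have h4 := eNorm_horizontal_le e
    rw [horiz_eq]
    exact pow_le_pow_left₀ (by positivity) (by linarith) 2
  · have h1 : S.h X t = S.P.ud • ϑ + e := by simp [e]
    rw [h1]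
    refine (eNorm_add_le _ _).trans ?_
    rw [eNorm_smul, abs_ud hP, hb.eNorm_tangent hP.sigma_sign hD]
    nlinarith

/-- Invariance: small velocity and observation errors keep the vehicle in a small tube around the
path, where the auxiliary orientation is not frozen, and keep the orientation errors small. -/
theorem IsSolution.invariant (h : S.IsSolution X) (hP : S.P.Admissible)
    (hb : S.P.Bounds lo hi c C) {m rt A : ℝ} (hm : 0 < m) (hm1 : m ≤ 1)
    (hvert : ∀ p ∈ S.P.D, eNorm (S.P.ep p) < rt → m ≤ eNorm ![S.P.tangent p 0, S.P.tangent p 1])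
    (hA : ∀ p ∈ S.P.D, (∀ j, |S.P.s j p| ≤ 1) → DifferentiableAt ℝ (S.P.hp S.G.kp) p ∧
      ∀ v, ‖fderiv ℝ (S.P.hp S.G.kp) p v‖ ≤ A * ‖v‖)
    (hA0 : 0 ≤ A)
    (hε : 0 < S.εf) (hε' : S.εf ≤ (S.P.U * m / 2) ^ 2) (hkp : 0 < S.G.kp)
    (hδo : 0 ≤ S.G.δo) (hδo' : S.G.δo ≤ 1) (hδp : 0 ≤ S.G.δp) (hδp' : S.G.δp < 1)
    {T₀ Ee Eo Ep Ea Sb : ℝ} (hT₀ : 0 ≤ T₀) (hroll : ∀ t ≥ T₀, roll (X.η t) = 0)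
    (he : ∀ t ≥ T₀, ∀ i, |S.ε X t i - X.eh t i| ≤ Ee)
    (ho : ∀ t ≥ T₀, ∀ i, |S.ε X t (Sum.inr i)| ≤ Eo)
    (hp : ∀ t ≥ T₀, eNorm (pos (S.ε X t)) ≤ Ep)
    (hSb : 0 < Sb) (hSb1 : Sb ≤ 1) (hSrt : 2 * Sb < rt)
    (hSm : 2 * S.G.kp * Sb + (Ep + 2 * Ee) ≤ S.P.U * m / 2)
    (hinit_a : eNorm (S.ea X T₀) ≤ Ea)
    (hinit_s : eNorm (S.P.ep (pos (X.η T₀))) ≤ (1 + c) / 2 * Sb)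
    (hθ : Eo + Ee + 4 * (A * Ee) * (2 * S.P.U) / (S.P.U * m / 2) ^ 2 < S.G.kθ * Ea)
    (hψ : Eo + Ee + 4 * (A * Ee) * (2 * S.P.U) / (S.P.U * m / 2) ^ 2 < S.G.kψ * Ea)
    (hs : hi * (2 * S.P.U * (2 * Ea) + (Ep + 2 * Ee)) < lo * S.G.kp * ((1 - c) / 2 * Sb)) :
    ∀ t ≥ T₀, (∀ j, |S.P.s j (pos (X.η t))| ≤ Sb) ∧ t ∈ S.regular X ∧
      |S.θa X t - pitch (X.η t)| ≤ Ea ∧ |X.ψa t - yaw (X.η t)| ≤ Ea := by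
  have hU := hP.U_pos
  have hc0 := hb.c_nonneg
  have hc1 := hb.c_lt
  have hEe : 0 ≤ Ee := (abs_nonneg _).trans (he T₀ le_rfl (Sum.inl 0))
  have hμ : 0 < (S.P.U * m / 2) ^ 2 := by positivity
  -- consequences of being in the tube at one instant
  have hstat : ∀ t ≥ T₀, (∀ j, |S.P.s j (pos (X.η t))| ≤ Sb) →
      (S.P.U * m / 2) ^ 2 ≤ S.horiz X t ∧ eNorm (S.h X t) ≤ 2 * S.P.U := by
    intro t ht hSt
    have hD := h.mem_D t (hT₀.trans ht)
    refine horiz_bounds hP hb hD hm hm1 (hvert _ hD ?_)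
      (eNorm_h_sub_le hb hD hkp.le hδp hδp' hSt (he t ht) (hp t ht)) hSm
    refine ((eNorm_le_sum _).trans ?_).trans_lt hSrt
    rw [Fin.sum_univ_two]
    have h0 := hSt 0
    have h1 := hSt 1
    simp only [RefPath.ep]
    linarith
  -- consequences of staying in the tube
  have htube : ∀ t ≥ T₀, (∀ u ∈ Set.Icc T₀ t, ∀ j, |S.P.s j (pos (X.η u))| ≤ Sb) →
      Set.Icc T₀ t ⊆ S.regular X ∧ ∀ u ∈ Set.Icc T₀ t,
        |S.θa X u - pitch (X.η u)| ≤ Ea ∧ |X.ψa u - yaw (X.η u)| ≤ Ea := by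
    intro t ht hSt
    have hreg : Set.Icc T₀ t ⊆ S.regular X := fun u hu =>
      ⟨hT₀.trans hu.1, hε'.trans (hstat u hu.1 (hSt u hu)).1⟩
    have hAd := fun u (hu : u ∈ Set.Icc T₀ t) =>
      hA _ (h.mem_D u (hT₀.trans hu.1)) fun j => (hSt u hu j).trans hSb1
    refine ⟨hreg, h.abs_ea_le hP hε hδo hδo' hreg (fun u hu => hroll u hu.1)
      (fun u hu => (hAd u hu).1) (W := A * Ee) (fun u hu => ?_) hμ
      (fun u hu => (hstat u hu.1 (hSt u hu)).1) (H := 2 * S.P.U)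
      (fun u hu i => (abs_le_eNorm _ i).trans (hstat u hu.1 (hSt u hu)).2)
      (fun u hu => he u hu.1) (fun u hu => ho u hu.1) hinit_a hθ hψ⟩
    refine ((hAd u hu).2 _).trans (mul_le_mul_of_nonneg_left ?_ hA0)
    refine (pi_norm_le_iff_of_nonneg hEe).2 fun i => ?_
    have := he u hu.1 (Sum.inl i)
    rw [abs_sub_comm] at this
    exact this
  set f : ℝ → ℝ := fun t => max |S.P.s 0 (pos (X.η t))| |S.P.s 1 (pos (X.η t))| with hf
  have hfle : ∀ t B, f t ≤ B ↔ ∀ j, |S.P.s j (pos (X.η t))| ≤ B := fun t B => by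
    rw [hf, max_le_iff, Fin.forall_fin_two]
  have hcont : ContinuousOn f (Set.Ici T₀) := by
    have hj : ∀ j, ContinuousOn (fun t => S.P.s j (pos (X.η t))) (Set.Ici T₀) := fun j t ht =>
      ((h.hasDerivWithinAt_s hP (hT₀.trans ht) j).mono
        (Set.Ici_subset_Ici.2 hT₀)).continuousWithinAt
    exact (hj 0).abs.sup (hj 1).abs
  have hinit : ∀ j, |S.P.s j (pos (X.η T₀))| ≤ (1 + c) / 2 * Sb := fun j =>
    (abs_le_eNorm (S.P.ep (pos (X.η T₀))) j).trans hinit_s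
  -- The barrier sits midway between `c Sb`, the size of the coupling, and `Sb`, the size of the
  -- tube. The gap `(1 - c) / 2 * Sb` to the coupling absorbs the perturbation by `hs`; the gap to
  -- `Sb` gives the strict improvement needed by the bootstrap.
  have hBS : (1 + c) / 2 * Sb < Sb := by nlinarith
  have hlt : ∀ t ≥ T₀, f t < Sb := by
    refine forall_lt_of_bootstrap hcont (((hfle _ _).2 hinit).trans_lt hBS) fun t ht hft => ?_
    have hSt : ∀ u ∈ Set.Icc T₀ t, ∀ j, |S.P.s j (pos (X.η u))| ≤ Sb := fun u hu =>
      (hfle _ _).1 (hft u hu)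
    obtain ⟨hreg, hang⟩ := htube t ht hSt
    refine ((hfle _ _).2 fun j => ?_).trans_lt hBS
    have key : ∀ u ∈ Set.Icc T₀ t, |S.P.grad j (pos (X.η u)) ⬝ᵥ
        (S.P.hp S.G.kp (pos (X.η u)) + S.velDev X u) +
        eNorm (S.P.grad j (pos (X.η u))) * S.G.kp * S.P.s j (pos (X.η u))| <
        eNorm (S.P.grad j (pos (X.η u))) * S.G.kp * ((1 + c) / 2 * Sb) := by
      intro u hu
      have hD := h.mem_D u (hT₀.trans hu.1)
      have h1 := h.eNorm_velDev_le hP hε hδp hδp' (hreg hu) (he u hu.1) (hp u hu.1)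
        (hstat u hu.1 (hSt u hu)).2 (hang u hu).1 (hang u hu).2
      refine (hb.abs_grad_dot_add_le hD hkp.le (hSt u hu) h1 j).trans_lt ?_
      have h2 : lo * S.G.kp * ((1 - c) / 2 * Sb) ≤
          eNorm (S.P.grad j (pos (X.η u))) * S.G.kp * ((1 - c) / 2 * Sb) := by
        have h3 : 0 ≤ (1 - c) / 2 * Sb := by
          have : 0 < 1 - c := by linarith
          positivity
        exact mul_le_mul_of_nonneg_right
          (mul_le_mul_of_nonneg_right (hb.lo_le j _ hD) hkp.le) h3
      have h4 : eNorm (S.P.grad j (pos (X.η u))) * S.G.kp * ((1 + c) / 2 * Sb) =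
          eNorm (S.P.grad j (pos (X.η u))) * S.G.kp * (c * Sb) +
          eNorm (S.P.grad j (pos (X.η u))) * S.G.kp * ((1 - c) / 2 * Sb) := by ring
      linarith
    refine abs_le_of_deriv_at_barrier (f := fun t => S.P.s j (pos (X.η t))) (a := T₀) (b := t)
      (fun u hu => (h.hasDerivWithinAt_s hP (hT₀.trans hu.1) j).mono
        fun v hv => hT₀.trans hv.1) (hinit j) ?_ ?_ t ⟨ht, le_rfl⟩
    · intro u hu hB
      have h1 := abs_lt.1 (key u ⟨hu.1, hu.2.le⟩)
      rw [hB] at h1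
      linarith [h1.2]
    · intro u hu hB
      have h1 := abs_lt.1 (key u ⟨hu.1, hu.2.le⟩)
      rw [hB] at h1
      linarith [h1.1]
  intro t ht
  have hSt : ∀ u ∈ Set.Icc T₀ t, ∀ j, |S.P.s j (pos (X.η u))| ≤ Sb := fun u hu =>
    (hfle _ _).1 (hlt u hu.1).le
  obtain ⟨hreg, hang⟩ := htube t ht hSt
  have htt : t ∈ Set.Icc T₀ t := ⟨ht, le_rfl⟩
  exact ⟨hSt t htt, hreg htt, hang t htt⟩

end Setup

/-! ### Orientation errors modulo `2π` -/

lemma toIcoMod_eq_add (z : ℝ) :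
    ∃ n : ℤ, z = toIcoMod Real.two_pi_pos (-Real.pi) z + n * (2 * Real.pi) :=
  ⟨toIcoDiv Real.two_pi_pos (-Real.pi) z, by
    rw [← zsmul_eq_mul]; exact (toIcoMod_add_toIcoDiv_zsmul Real.two_pi_pos (-Real.pi) z).symm⟩

lemma toIcoMod_mem (z : ℝ) :
    -Real.pi ≤ toIcoMod Real.two_pi_pos (-Real.pi) z ∧
      toIcoMod Real.two_pi_pos (-Real.pi) z < Real.pi := by
  have := toIcoMod_mem_Ico Real.two_pi_pos (-Real.pi) z
  exact ⟨this.1, this.2.trans_eq (by ring)⟩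

lemma abs_toIcoMod_le_pi (z : ℝ) : |toIcoMod Real.two_pi_pos (-Real.pi) z| ≤ Real.pi :=
  abs_le.2 ⟨(toIcoMod_mem z).1, (toIcoMod_mem z).2.le⟩

/-- The representative in `[-π, π)` has the least absolute value in its class, so any convenient
representative yields a bound. -/
lemma abs_toIcoMod_le {z x : ℝ} {k : ℤ} (h : z = x + k * (2 * Real.pi)) :
    |toIcoMod Real.two_pi_pos (-Real.pi) z| ≤ |x| := by
  obtain ⟨n, hn⟩ := toIcoMod_eq_add z
  obtain ⟨h1, h2⟩ := toIcoMod_mem z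
  set w := toIcoMod Real.two_pi_pos (-Real.pi) z
  have hx : x = w + ((n - k : ℤ) : ℝ) * (2 * Real.pi) := by push_cast; linarith
  have hw : |w| ≤ Real.pi := abs_toIcoMod_le_pi z
  have hpi := Real.pi_pos
  rcases lt_trichotomy (n - k) 0 with h3 | h3 | h3
  · have h4 : ((n - k : ℤ) : ℝ) ≤ -1 := by exact_mod_cast Int.le_sub_one_of_lt h3
    refine hw.trans (le_abs.2 (Or.inr ?_))
    nlinarith
  · rw [hx, h3]; simp
  · have h4 : (1 : ℝ) ≤ ((n - k : ℤ) : ℝ) := by exact_mod_cast h3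
    refine hw.trans (le_abs.2 (Or.inl ?_))
    nlinarith

lemma cos_toIcoMod (z : ℝ) : Real.cos (toIcoMod Real.two_pi_pos (-Real.pi) z) = Real.cos z := by
  obtain ⟨n, hn⟩ := toIcoMod_eq_add z
  conv_rhs => rw [hn, Real.cos_add_int_mul_two_pi]

lemma sin_toIcoMod (z : ℝ) : Real.sin (toIcoMod Real.two_pi_pos (-Real.pi) z) = Real.sin z := by
  obtain ⟨n, hn⟩ := toIcoMod_eq_add z
  conv_rhs => rw [hn, Real.sin_add_int_mul_two_pi]

lemma eNorm_mul_cos_atan2 (x y : ℝ) :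
    x = eNorm ![x, y] * Real.cos (atan2 y x) ∧ y = eNorm ![x, y] * Real.sin (atan2 y x) := by
  have h : eNorm ![x, y] = ‖(⟨x, y⟩ : ℂ)‖ := by
    rw [eNorm_eq_sqrt, Complex.norm_def, Complex.normSq_mk]
    simp [dotProduct, Fin.sum_univ_two]
  rw [atan2, cos_toIcoMod, sin_toIcoMod, h, Complex.norm_mul_cos_arg, Complex.norm_mul_sin_arg]
  exact ⟨rfl, rfl⟩

/-- Close planar vectors have close arguments. -/
lemma abs_toIcoMod_sub_arg_le {r q α β ρ : ℝ} (hr : 0 < r) (hq : 0 ≤ q) (hρ : 0 ≤ ρ)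
    (h : (r * Real.cos α - q * Real.cos β) ^ 2 + (r * Real.sin α - q * Real.sin β) ^ 2 ≤ ρ ^ 2) :
    |toIcoMod Real.two_pi_pos (-Real.pi) (α - β)| ≤ 4 * ρ / r := by
  set δ := toIcoMod Real.two_pi_pos (-Real.pi) (α - β)
  have hcos : Real.cos δ = Real.cos (α - β) := cos_toIcoMod _
  have hδ : |δ| ≤ Real.pi := abs_toIcoMod_le_pi _
  have h1 := Real.cos_le_one_sub_mul_cos_sq hδ
  have h2 : r ^ 2 + q ^ 2 - 2 * r * q * Real.cos δ ≤ ρ ^ 2 := by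
    rw [hcos, Real.cos_sub]
    have e1 := Real.sin_sq_add_cos_sq α
    have e2 := Real.sin_sq_add_cos_sq β
    linear_combination h - r ^ 2 * e1 - q ^ 2 * e2
  -- Minimising the law of cosines `h2` over `q ≥ 0` leaves `r² sin² δ` if `cos δ ≥ 0` and `r²`
  -- otherwise. Then `1 - cos δ ≥ 2 δ² / π²` and `π ≤ 4` give the constant `4`.
  have h3 : r ^ 2 * (1 - Real.cos δ) ≤ 2 * ρ ^ 2 := by
    rcases le_total 0 (Real.cos δ) with hc | hc
    · have := Real.cos_le_one δ
      nlinarith [sq_nonneg (q - r * Real.cos δ), mul_nonneg (sq_nonneg r) hc,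
        mul_nonneg (mul_nonneg (sq_nonneg r) hc) (sub_nonneg.2 this)]
    · have := Real.neg_one_le_cos δ
      nlinarith [mul_nonneg (mul_nonneg hr.le hq) (neg_nonneg.2 hc), sq_nonneg q,
        mul_nonneg (sq_nonneg r) (by linarith : 0 ≤ 1 + Real.cos δ)]
  have hpi : Real.pi ≤ 4 := Real.pi_le_four
  have h4 : (r * |δ|) ^ 2 ≤ (4 * ρ) ^ 2 := by
    have h5 : 2 / Real.pi ^ 2 * δ ^ 2 ≤ 1 - Real.cos δ := by linarith
    have h6 : 2 * (r ^ 2 * δ ^ 2) ≤ Real.pi ^ 2 * (2 * ρ ^ 2) := by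
      have h7 := mul_le_mul_of_nonneg_left h5 (sq_nonneg r)
      have h8 : r ^ 2 * (2 / Real.pi ^ 2 * δ ^ 2) ≤ 2 * ρ ^ 2 := h7.trans h3
      have h9 : r ^ 2 * (2 / Real.pi ^ 2 * δ ^ 2) = 2 * (r ^ 2 * δ ^ 2) / Real.pi ^ 2 := by ring
      rw [h9, div_le_iff₀ (by positivity)] at h8
      linarith
    have h10 : Real.pi ^ 2 ≤ 16 := by nlinarith [Real.pi_pos]
    rw [mul_pow, sq_abs]
    nlinarith [mul_le_mul_of_nonneg_right h10 (sq_nonneg ρ)]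
  rw [le_div_iff₀ hr, mul_comm]
  exact le_of_sq_le_sq h4 (by positivity)

lemma abs_arctan_sub_le (x y : ℝ) : |Real.arctan x - Real.arctan y| ≤ |x - y| := by
  have h : LipschitzWith 1 Real.arctan := by
    refine lipschitzWith_of_nnnorm_deriv_le Real.differentiable_arctan fun z => ?_
    rw [Real.deriv_arctan, ← NNReal.coe_le_coe, coe_nnnorm, Real.norm_eq_abs,
      abs_of_pos (by positivity)]
    rw [NNReal.coe_one, div_le_one (by positivity)]
    nlinarith [sq_nonneg z]
  have := h.dist_le_mul x y
  simpa [Real.dist_eq] using this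

namespace Setup

variable {S : Setup} {X : Signals} {t : ℝ} {lo hi c C : ℝ}

/-- In forward motion the auxiliary orientation is close to the reference one. -/
lemma IsSolution.abs_ref_sub_aux_le (h : S.IsSolution X) (hP : S.P.Admissible)
    (hb : S.P.Bounds lo hi c C) (hξ : S.P.ξ = 1) (ht : t ∈ S.regular X) {m ρ : ℝ}
    (hm : 0 < m) (hm1 : m ≤ 1)
    (hvert : m ≤ eNorm ![S.P.tangent (pos (X.η t)) 0, S.P.tangent (pos (X.η t)) 1])
    (hρ : eNorm (S.h X t - S.P.ud • S.P.tangent (pos (X.η t))) ≤ ρ)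
    (hρm : ρ ≤ S.P.U * m / 2) :
    |S.P.pitchRef (pos (X.η t)) - S.θa X t| ≤ 5 * ρ / (S.P.U * m ^ 2) ∧
    |toIcoMod Real.two_pi_pos (-Real.pi) (S.P.yawRef (pos (X.η t)) - X.ψa t)| ≤
      5 * ρ / (S.P.U * m ^ 2) := by
  have hD := h.mem_D t ht.1
  have hU := hP.U_pos
  have hρ0 : 0 ≤ ρ := (eNorm_nonneg _).trans hρ
  have hbd := horiz_bounds hP hb hD hm hm1 hvert hρ hρm
  have hud : S.P.ud = S.P.U := by rw [RefPath.ud, hξ, one_mul]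
  rw [hud] at hρ
  obtain ⟨f0, f1⟩ := h.yaw_aux t ht
  rw [hξ, one_mul] at f0 f1
  have hsq : Real.sqrt (S.horiz X t) = eNorm ![S.h X t 0, S.h X t 1] := by
    rw [horiz_eq, Real.sqrt_sq (eNorm_nonneg _)]
  rw [hsq] at f0 f1
  have hq : S.P.U * m / 2 ≤ eNorm ![S.h X t 0, S.h X t 1] := by
    have := hbd.1
    rw [horiz_eq] at this
    exact le_of_sq_le_sq this (eNorm_nonneg _)
  set ϑ := S.P.tangent (pos (X.η t)) with hϑ
  obtain ⟨d0, d1⟩ := eNorm_mul_cos_atan2 (ϑ 0) (ϑ 1)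
  have hyr : S.P.yawRef (pos (X.η t)) = atan2 (ϑ 1) (ϑ 0) := by
    rw [RefPath.yawRef, hξ, one_mul, one_mul]
  set α := atan2 (ϑ 1) (ϑ 0)
  set r := eNorm ![ϑ 0, ϑ 1] with hr
  set q := eNorm ![S.h X t 0, S.h X t 1] with hqd
  have hr0 : 0 < r := hm.trans_le hvert
  have hq0 : 0 < q := lt_of_lt_of_le (by positivity) hq
  have hdiff : ∀ i, |S.h X t i - S.P.U * ϑ i| ≤ ρ := fun i => (abs_le_eNorm _ i).trans hρ
  have hplan : eNorm (![S.h X t 0, S.h X t 1] - S.P.U • ![ϑ 0, ϑ 1]) ≤ ρ := by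
    have h1 := eNorm_horizontal_le (S.h X t - S.P.U • ϑ)
    have h2 : ![(S.h X t - S.P.U • ϑ) 0, (S.h X t - S.P.U • ϑ) 1] =
        ![S.h X t 0, S.h X t 1] - S.P.U • ![ϑ 0, ϑ 1] := by
      ext i; fin_cases i <;> simp
    rw [h2] at h1
    exact h1.trans hρ
  constructor
  · have hg : S.g X t = q := by
      rw [g]
      linear_combination f0 * Real.cos (X.ψa t) + f1 * Real.sin (X.ψa t) +
        q * Real.sin_sq_add_cos_sq (X.ψa t)
    have hpr : S.P.pitchRef (pos (X.η t)) = Real.arctan (-ϑ 2 / r) := by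
      rw [RefPath.pitchRef, hyr, ← hϑ]
      congr 2
      linear_combination d0 * Real.cos α + d1 * Real.sin α + r * Real.sin_sq_add_cos_sq α
    rw [hpr, θa_eq ht, hg]
    refine (abs_arctan_sub_le _ _).trans ?_
    have hrq : |S.P.U * r - q| ≤ ρ := by
      have h1 : eNorm (S.P.U • ![ϑ 0, ϑ 1]) = S.P.U * r := by
        rw [eNorm_smul, abs_of_pos hU]
      have h2 := eNorm_add_le (![S.h X t 0, S.h X t 1] - S.P.U • ![ϑ 0, ϑ 1])
        (S.P.U • ![ϑ 0, ϑ 1])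
      have h3 := eNorm_sub_le ![S.h X t 0, S.h X t 1]
        (![S.h X t 0, S.h X t 1] - S.P.U • ![ϑ 0, ϑ 1])
      rw [sub_add_cancel] at h2
      rw [sub_sub_cancel] at h3
      rw [h1] at h2 h3
      rw [abs_le]
      constructor <;> linarith
    have hz : |S.h X t 2| ≤ 2 * S.P.U := (abs_le_eNorm _ _).trans hbd.2
    have h1 : -ϑ 2 / r - -S.h X t 2 / q =
        ((S.h X t 2 - S.P.U * ϑ 2) * q + S.h X t 2 * (S.P.U * r - q)) / (S.P.U * r * q) := by
      field_simp; ring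
    rw [h1, abs_div, abs_of_pos (by positivity : 0 < S.P.U * r * q)]
    have h2 : |(S.h X t 2 - S.P.U * ϑ 2) * q + S.h X t 2 * (S.P.U * r - q)| ≤
        ρ * q + 2 * S.P.U * ρ := by
      refine (abs_add_le _ _).trans (add_le_add ?_ ?_)
      · rw [abs_mul, abs_of_pos hq0]
        exact mul_le_mul_of_nonneg_right (hdiff 2) hq0.le
      · rw [abs_mul]
        exact mul_le_mul hz hrq (abs_nonneg _) (by positivity)
    rw [div_le_div_iff₀ (by positivity) (by positivity)]
    -- From `q ≥ U m / 2` the second summand is at most `4ρq / m`, and `m ≤ 1` bounds the first by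
    -- `ρq / m`.
    have h3 : ρ * q + 2 * S.P.U * ρ ≤ 5 * ρ * q / m := by
      rw [le_div_iff₀ hm]
      nlinarith [mul_le_mul_of_nonneg_left hq hρ0, mul_le_mul_of_nonneg_left hm1
        (mul_nonneg hρ0 hq0.le)]
    calc _ ≤ (5 * ρ * q / m) * (S.P.U * m ^ 2) :=
          mul_le_mul_of_nonneg_right (h2.trans h3) (by positivity)
      _ = 5 * ρ * (S.P.U * m * q) := by field_simp
      _ ≤ 5 * ρ * (S.P.U * r * q) := by gcongr
  · rw [hyr]
    have h1 := abs_toIcoMod_sub_arg_le (r := S.P.U * r) (q := q) (α := α) (β := X.ψa t)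
      (by positivity) hq0.le hρ0 (by
        have h2 := pow_le_pow_left₀ (eNorm_nonneg _) hplan 2
        rw [eNorm_sq] at h2
        refine le_trans (le_of_eq ?_) h2
        simp only [dotProduct, Fin.sum_univ_two, Pi.sub_apply, Pi.smul_apply, cons_val_zero,
          cons_val_one, smul_eq_mul]
        rw [mul_assoc, mul_assoc, ← d0, ← d1, ← f0, ← f1]
        ring)
    refine h1.trans ?_
    have h2 : S.P.U * m ^ 2 ≤ S.P.U * r := by
      have : m ^ 2 ≤ r := by nlinarith
      gcongr
    gcongr
    norm_num

end Setup

/-! ### Ultimate bounds -/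

/-- Bounds on the errors of the estimates of the velocity error and of the disturbance. -/
noncomputable def obsVelBound (Ω rdd : ℝ) : ℝ := 11 * rdd / Ω ^ 2
noncomputable def obsDistBound (Ω rdd : ℝ) : ℝ := 9 * rdd / Ω

/-- Bounds on the translational and rotational velocity errors. -/
noncomputable def posVelBound (Ω κ rdd rds : ℝ) : ℝ :=
  2 * ((rds + 2 * obsDistBound Ω rdd) / κ + 2 * obsVelBound Ω rdd)
noncomputable def angVelBound (Ω ko rdd : ℝ) : ℝ :=
  2 * (obsDistBound Ω rdd / ko + obsVelBound Ω rdd)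

/-- Bound on the auxiliary orientation error. -/
noncomputable def auxBound (B₀ Ω ko k kp rdd : ℝ) : ℝ :=
  2 * (angVelBound Ω ko rdd + obsVelBound Ω rdd + B₀ * (1 + kp) * obsVelBound Ω rdd) / k

/-- Bound on the perturbation of the positional dynamics. -/
noncomputable def perturbBound (B₀ Ω κ ko k kp rdd rds : ℝ) : ℝ :=
  posVelBound Ω κ rdd rds + 2 * obsVelBound Ω rdd + auxBound B₀ Ω ko k kp rdd

/-- Bound on the level-surface functions. -/
noncomputable def levelBound (C₀ B₀ Ω κ ko k kp rdd rds : ℝ) : ℝ :=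
  C₀ * perturbBound B₀ Ω κ ko k kp rdd rds / kp

/-- Bound on the deviation of the auxiliary pitch and yaw from the vehicle's, plus, in forward
motion, the deviation from the reference angles. In backward motion the reference yaw is opposite
to the auxiliary one, and only the trivial bound for angles modulo `2π` is available. -/
noncomputable def orientBound (P : RefPath) (m C₀ B₀ Ω κ ko k kp rdd rds : ℝ) : ℝ :=
  open Classical in
  if P.ξ = 1 then
    2 * (5 * (2 * kp * levelBound C₀ B₀ Ω κ ko k kp rdd rds +
      (posVelBound Ω κ rdd rds + 2 * obsVelBound Ω rdd)) / (P.U * m ^ 2) +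
      auxBound B₀ Ω ko k kp rdd)
  else 2 * Real.pi

section positivity

variable {B₀ Ω κ ko k kp rdd rds : ℝ}

lemma obsVelBound_pos (hΩ : 0 < Ω) (hd : 0 < rdd) : 0 < obsVelBound Ω rdd := by
  unfold obsVelBound; positivity

lemma obsDistBound_pos (hΩ : 0 < Ω) (hd : 0 < rdd) : 0 < obsDistBound Ω rdd := by
  unfold obsDistBound; positivity

lemma posVelBound_pos (hΩ : 0 < Ω) (hκ : 0 < κ) (hd : 0 < rdd) (hs : 0 < rds) :
    0 < posVelBound Ω κ rdd rds := by
  have := obsVelBound_pos hΩ hd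
  have := obsDistBound_pos hΩ hd
  unfold posVelBound; positivity

lemma angVelBound_pos (hΩ : 0 < Ω) (hko : 0 < ko) (hd : 0 < rdd) : 0 < angVelBound Ω ko rdd := by
  have := obsVelBound_pos hΩ hd
  have := obsDistBound_pos hΩ hd
  unfold angVelBound; positivity

lemma auxBound_pos (hB : 0 < B₀) (hΩ : 0 < Ω) (hko : 0 < ko) (hk : 0 < k) (hkp : 0 < kp)
    (hd : 0 < rdd) : 0 < auxBound B₀ Ω ko k kp rdd := by
  have := obsVelBound_pos hΩ hd
  have := angVelBound_pos hΩ hko hd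
  unfold auxBound; positivity

lemma perturbBound_pos (hB : 0 < B₀) (hΩ : 0 < Ω) (hκ : 0 < κ) (hko : 0 < ko) (hk : 0 < k)
    (hkp : 0 < kp) (hd : 0 < rdd) (hs : 0 < rds) :
    0 < perturbBound B₀ Ω κ ko k kp rdd rds := by
  have := obsVelBound_pos hΩ hd
  have := posVelBound_pos hΩ hκ hd hs
  have := auxBound_pos hB hΩ hko hk hkp hd
  unfold perturbBound; positivity

/-- The part of the perturbation which is not caused by the unactuated axes. -/
lemma perturbBound_le (hΩ : 0 < Ω) (hκ : 1 ≤ κ) (hd : 0 < rdd) :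
    perturbBound B₀ Ω κ ko k kp rdd rds ≤ 2 * rds / κ +
      rdd * (36 / Ω + 66 / Ω ^ 2 +
        2 * (2 * (9 / Ω / ko + 11 / Ω ^ 2) + 11 / Ω ^ 2 + B₀ * (1 + kp) * (11 / Ω ^ 2)) / k) := by
  have hκ0 : 0 < κ := by linarith
  have h1 : 36 * rdd / Ω / κ ≤ 36 * rdd / Ω := div_le_self (by positivity) hκ
  unfold perturbBound posVelBound auxBound angVelBound obsDistBound obsVelBound
  calc _ = 2 * rds / κ + 36 * rdd / Ω / κ + rdd * (66 / Ω ^ 2 +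
        2 * (2 * (9 / Ω / ko + 11 / Ω ^ 2) + 11 / Ω ^ 2 + B₀ * (1 + kp) * (11 / Ω ^ 2)) / k) := by
        ring
    _ ≤ 2 * rds / κ + 36 * rdd / Ω + rdd * (66 / Ω ^ 2 +
        2 * (2 * (9 / Ω / ko + 11 / Ω ^ 2) + 11 / Ω ^ 2 + B₀ * (1 + kp) * (11 / Ω ^ 2)) / k) := by
        gcongr
    _ = _ := by ring

end positivity

/-- The instant `T₀` itself is included by continuity, so that the differential equations for pitch
and yaw hold on closed intervals starting at `T₀`. -/
lemma Setup.IsSolution.roll_eq_zero {S : Setup} {X : Signals} (h : S.IsSolution X) {T₀ : ℝ}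
    (hT₀ : 0 ≤ T₀) (hr : ∀ t > T₀, roll (X.η t) = 0) : ∀ t ≥ T₀, roll (X.η t) = 0 := by
  intro t ht
  rcases eq_or_lt_of_le ht with rfl | hlt
  · have hc : ContinuousWithinAt (fun s => roll (X.η s)) (Set.Ioi T₀) T₀ :=
      ((hasDerivWithinAt_pi.1 (h.kinematics T₀ hT₀) (Sum.inr 0)).continuousWithinAt).mono
        fun s hs => hT₀.trans (le_of_lt hs)
    have h1 : Filter.Tendsto (fun s => roll (X.η s)) (nhdsWithin T₀ (Set.Ioi T₀)) (nhds 0) :=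
      tendsto_const_nhds.congr' (by
        filter_upwards [self_mem_nhdsWithin] with s hs
        exact (hr s hs).symm)
    exact tendsto_nhds_unique hc.tendsto h1
  · exact hr t hlt

/-- Provides an initial radius for the smallness condition of `observer_bounds`, common to all six
bandwidths. -/
lemma exists_pos_forall_mul_le {L : ℝ} (hL : 0 < L) (ω : DoF → ℝ) (hω : ∀ i, 0 < ω i) :
    ∃ r > 0, ∀ i, r * (1 + ω i + ω i ^ 2) * ω i ≤ L := by
  obtain ⟨M, hM⟩ := (Set.finite_range ω).bddAbove
  have hM' : ∀ i, ω i ≤ M := fun i => hM ⟨i, rfl⟩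
  have hM0 : 0 < M := (hω (Sum.inl 0)).trans_le (hM' _)
  refine ⟨L / ((1 + M + M ^ 2) * M), by positivity, fun i => ?_⟩
  have h1 : (1 + ω i + ω i ^ 2) * ω i ≤ (1 + M + M ^ 2) * M := by
    have := hM' i
    have := hω i
    gcongr
  rw [mul_assoc, div_mul_eq_mul_div, div_le_iff₀ (by positivity)]
  gcongr

set_option maxHeartbeats 800000 in
/-- For small perturbations the control law locally guarantees the bounds. -/
theorem exists_locallyGuarantees_of_small {P : RefPath} (hP : P.Admissible) :
    ∃ m > (0 : ℝ), ∃ C₀ > (0 : ℝ), ∃ B₀ > (0 : ℝ), ∃ ε₀ > (0 : ℝ), ∃ c₁ > (0 : ℝ), ∃ c₂ > (0 : ℝ),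
      ∀ εf : ℝ, 0 < εf → εf ≤ ε₀ →
      ∀ ko δo δp : ℝ, 0 < ko → 0 ≤ δo → δo ≤ 1 → 0 ≤ δp → δp < 1 →
      ∀ κ kθ kψ kp rdd rds : ℝ, 0 < κ → 0 < kθ → 0 < kψ → 0 < kp → 0 < rdd → 0 < rds →
      ∀ (ω : DoF → ℝ) (Ω : ℝ), 0 < Ω → (∀ i, Ω ≤ ω i) →
      perturbBound B₀ Ω κ ko (min kθ kψ) kp rdd rds ≤ c₁ →
      perturbBound B₀ Ω κ ko (min kθ kψ) kp rdd rds ≤ c₂ * kp →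
      LocallyGuarantees P εf ω κ ko kθ kψ kp δo δp rdd rds
        (2 * levelBound C₀ B₀ Ω κ ko (min kθ kψ) kp rdd rds +
          orientBound P m C₀ B₀ Ω κ ko (min kθ kψ) kp rdd rds)
        (2 * levelBound C₀ B₀ Ω κ ko (min kθ kψ) kp rdd rds) := by
  obtain ⟨lo, hi, c, C, hb⟩ := hP.exists_bounds
  obtain ⟨A, hA, hAp⟩ := hb.exists_bound_fderiv_hp hP
  obtain ⟨m₀, hm₀, rt, hrt, hvert₀⟩ := hP.nonvertical
  have hU := hP.U_pos
  have hlo := hb.lo_pos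
  have hhi := hb.hi_pos
  have hc1 : 0 < 1 - c := sub_pos.2 hb.c_lt
  have hc0 := hb.c_nonneg
  obtain ⟨m, hm, hm1, hvert⟩ : ∃ m > (0 : ℝ), m ≤ 1 ∧ ∀ p ∈ P.D, eNorm (P.ep p) < rt →
      m ≤ eNorm ![P.tangent p 0, P.tangent p 1] :=
    ⟨min m₀ 1, lt_min hm₀ one_pos, min_le_right _ _, fun p hp h =>
      (min_le_left _ _).trans (hvert₀ p hp h).le⟩
  -- `C₀` makes the decay `lo k_p (1 - c) / 2 * Sb` twice the bound `hi (4U + 1) Q` on the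
  -- perturbation. `B₀` collects the constants of the angular rate errors `4 W H / μ` with `H = 2U`,
  -- `μ = (U m / 2)²`.
  set C₀ : ℝ := 4 * hi * (4 * P.U + 1) / (lo * (1 - c)) with hC₀
  set B₀ : ℝ := 4 * A * (2 * P.U) / (P.U * m / 2) ^ 2 with hB₀
  have hC₀p : 0 < C₀ := by positivity
  have hB₀p : 0 < B₀ := by positivity
  -- The bound `Q ≤ c₁` keeps `ĥ_p*` within `U m / 2` of `u_d ϑ`. The bound `Q ≤ c₂ k_p` gives `Sb ≤
  -- min (rt / 4) 1`, so the tube lies where the tangent is not vertical and the derivative of `h_p`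
  -- is controlled.
  refine ⟨m, hm, C₀, hC₀p, B₀, hB₀p, (P.U * m / 2) ^ 2, by positivity,
    P.U * m / (2 * (2 * C₀ + 1)), by positivity, min (rt / 4) 1 / C₀, by positivity, ?_⟩
  intro εf hεf hεf' ko δo δp hko hδo hδo' hδp hδp' κ kθ kψ kp rdd rds hκ hkθ hkψ hkp hrdd hrds
    ω Ω hΩ hω hQ1 hQ2
  have hk : 0 < min kθ kψ := lt_min hkθ hkψ
  have hEe := obsVelBound_pos hΩ hrdd
  have hEd := obsDistBound_pos hΩ hrdd
  have hEp := posVelBound_pos hΩ hκ hrdd hrds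
  have hEo := angVelBound_pos hΩ hko hrdd
  have hEa := auxBound_pos hB₀p hΩ hko hk hkp hrdd
  have hQ := perturbBound_pos hB₀p hΩ hκ hko hk hkp hrdd hrds
  -- The factors `2` in the definitions of the velocity and auxiliary bounds are there to make these
  -- barrier inequalities strict.
  have hEp' : rds + 2 * obsDistBound Ω rdd + κ * (2 * obsVelBound Ω rdd) <
      κ * posVelBound Ω κ rdd rds := by
    have : κ * posVelBound Ω κ rdd rds =
        2 * (rds + 2 * obsDistBound Ω rdd + κ * (2 * obsVelBound Ω rdd)) := by
      unfold posVelBound; field_simp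
    rw [this]
    have : 0 < κ * (2 * obsVelBound Ω rdd) := by positivity
    linarith
  have hEo' : obsDistBound Ω rdd + ko * obsVelBound Ω rdd < ko * angVelBound Ω ko rdd := by
    have : ko * angVelBound Ω ko rdd =
        2 * (obsDistBound Ω rdd + ko * obsVelBound Ω rdd) := by
      unfold angVelBound; field_simp
    rw [this]
    have : 0 < ko * obsVelBound Ω rdd := by positivity
    linarith
  have hEa' : angVelBound Ω ko rdd + obsVelBound Ω rdd +
      4 * (A * (1 + kp) * obsVelBound Ω rdd) * (2 * P.U) / (P.U * m / 2) ^ 2 <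
      min kθ kψ * auxBound B₀ Ω ko (min kθ kψ) kp rdd := by
    have h1 : min kθ kψ * auxBound B₀ Ω ko (min kθ kψ) kp rdd =
        2 * (angVelBound Ω ko rdd + obsVelBound Ω rdd +
          B₀ * (1 + kp) * obsVelBound Ω rdd) := by
      unfold auxBound; field_simp
    have h2 : 4 * (A * (1 + kp) * obsVelBound Ω rdd) * (2 * P.U) / (P.U * m / 2) ^ 2 =
        B₀ * (1 + kp) * obsVelBound Ω rdd := by
      rw [hB₀]; ring
    rw [h1, h2]
    have : 0 < B₀ * (1 + kp) * obsVelBound Ω rdd := by positivity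
    linarith
  have hSb : 0 < levelBound C₀ B₀ Ω κ ko (min kθ kψ) kp rdd rds := by
    unfold levelBound; positivity
  have hSbkp : kp * levelBound C₀ B₀ Ω κ ko (min kθ kψ) kp rdd rds =
      C₀ * perturbBound B₀ Ω κ ko (min kθ kψ) kp rdd rds := by
    unfold levelBound; field_simp
  have hSbm : levelBound C₀ B₀ Ω κ ko (min kθ kψ) kp rdd rds ≤ min (rt / 4) 1 := by
    rw [levelBound, div_le_iff₀ hkp]
    rw [div_mul_eq_mul_div, le_div_iff₀ hC₀p] at hQ2
    linarith
  have hQdef : perturbBound B₀ Ω κ ko (min kθ kψ) kp rdd rds = posVelBound Ω κ rdd rds +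
      2 * obsVelBound Ω rdd + auxBound B₀ Ω ko (min kθ kψ) kp rdd := rfl
  have hori : orientBound P m C₀ B₀ Ω κ ko (min kθ kψ) kp rdd rds = if P.ξ = 1 then
    2 * (5 * (2 * kp * levelBound C₀ B₀ Ω κ ko (min kθ kψ) kp rdd rds +
      (posVelBound Ω κ rdd rds + 2 * obsVelBound Ω rdd)) / (P.U * m ^ 2) +
      auxBound B₀ Ω ko (min kθ kψ) kp rdd) else 2 * Real.pi := by
    unfold orientBound; congr
  set Ee := obsVelBound Ω rdd with hEe_def
  set Ed := obsDistBound Ω rdd with hEd_def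
  set Ep := posVelBound Ω κ rdd rds
  set Eo := angVelBound Ω ko rdd
  set Ea := auxBound B₀ Ω ko (min kθ kψ) kp rdd
  set Q := perturbBound B₀ Ω κ ko (min kθ kψ) kp rdd rds
  set Sb := levelBound C₀ B₀ Ω κ ko (min kθ kψ) kp rdd rds
  have hs : hi * (2 * P.U * (2 * Ea) + (Ep + 2 * Ee)) < lo * kp * ((1 - c) / 2 * Sb) := by
    have h1 : lo * kp * ((1 - c) / 2 * Sb) = 2 * (hi * (4 * P.U + 1) * Q) := by
      have h2 : lo * kp * ((1 - c) / 2 * Sb) = lo * (1 - c) / 2 * (kp * Sb) := by ring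
      rw [h2, hSbkp, hC₀]
      field_simp
      ring
    have h3 : 2 * P.U * (2 * Ea) + (Ep + 2 * Ee) ≤ (4 * P.U + 1) * Q := by
      rw [hQdef]
      nlinarith [mul_pos hU hEp, mul_pos hU hEe]
    have h4 := mul_le_mul_of_nonneg_left h3 hhi.le
    have h5 : 0 < hi * (4 * P.U + 1) * Q := by positivity
    rw [h1]
    rw [← mul_assoc] at h4
    linarith
  have hSm : 2 * kp * Sb + (Ep + 2 * Ee) ≤ P.U * m / 2 := by
    have h1 : 2 * kp * Sb + (Ep + 2 * Ee) ≤ (2 * C₀ + 1) * Q := by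
      have : 2 * kp * Sb = 2 * (C₀ * Q) := by rw [← hSbkp]; ring
      rw [this]
      linarith
    rw [le_div_iff₀ (by positivity)] at hQ1
    linarith
  have hωpos : ∀ i, 0 < ω i := fun i => hΩ.trans_le (hω i)
  obtain ⟨r₁, hr₁, hr₁ω⟩ := exists_pos_forall_mul_le hrdd ω hωpos
  -- Every initial error lies below the level that it must keep. The radius involves only the path,
  -- gains, bandwidths and disturbance bounds, hence is uniform over vehicles.
  refine ⟨min r₁ (min (min Ep Eo) (min Ea ((1 + c) / 2 * Sb))), by positivity, ?_⟩
  intro V hV hV1 hV2 b hb0 fφ τs S hS _ X hX hdist T₀ hT₀ hroll hχ hε hea hep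
  have hroll' := hX.roll_eq_zero hT₀ hroll
  simp only [lt_min_iff] at hχ hε hea hep
  subst hS
  have hobs := Setup.observer_errors_le hX hV hT₀ hrdd hΩ hω hdist.1 hχ.1.le hr₁ω
  have he : ∀ t ≥ T₀, ∀ i, |Setup.ε _ X t i - X.eh t i| ≤ Ee := fun t ht i => (hobs t ht i).1
  have hd : ∀ t ≥ T₀, ∀ i, |Setup.d _ X t i - X.dh t i| ≤ Ed := fun t ht i => (hobs t ht i).2
  have hp := Setup.eNorm_pos_ε_le hX hV hb0 rfl hκ hV1 hV2 hT₀ hdist.2 he hd hε.2.1.1.le hEp'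
  have ho : ∀ t ≥ T₀, ∀ i, |Setup.ε _ X t (Sum.inr i)| ≤ Eo := fun t ht i =>
    Setup.abs_ε_inr_le hX hV hb0 rfl hko hT₀ he hd hε.2.1.2.le hEo' i t ht
  have hkey := hX.invariant hP hb hm hm1 hvert (A := A * (1 + kp))
    (fun p hp hsp => hAp kp hkp.le p hp hsp)
    (by positivity) hεf hεf' hkp hδo hδo' hδp hδp' hT₀ hroll' he ho hp hSb
    (hSbm.trans (min_le_right _ _)) (by linarith [hSbm.trans (min_le_left _ _)]) hSm
    hea.2.2.1.le hep.2.2.2.le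
    (hEa'.trans_le (mul_le_mul_of_nonneg_right (min_le_left _ _) hEa.le))
    (hEa'.trans_le (mul_le_mul_of_nonneg_right (min_le_right _ _) hEa.le)) hs
  have hep2 : ∀ t ≥ T₀, eNorm (P.ep (pos (X.η t))) ≤ 2 * Sb := fun t ht => by
    refine (eNorm_le_sum _).trans ?_
    rw [Fin.sum_univ_two]
    have h0 := (hkey t ht).1 0
    have h1 := (hkey t ht).1 1
    simp only [RefPath.ep]
    linarith
  refine ⟨⟨T₀, hT₀, fun t ht => ?_⟩, ⟨T₀, hT₀, hep2⟩⟩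
  obtain ⟨hSt, hreg, hθ, hψ⟩ := hkey t ht
  refine (eNorm_sum_elim_le _ _).trans (add_le_add (hep2 t ht) ?_)
  refine (eNorm_le_sum _).trans ?_
  have hφ0 : |toIcoMod Real.two_pi_pos (-Real.pi) (P.eo (X.η t) 0)| ≤ 0 := by
    have : P.eo (X.η t) 0 = 0 := by simp [RefPath.eo, hroll' t ht]
    rw [this]
    simpa using abs_toIcoMod_le (z := 0) (x := 0) (k := 0) (by simp)
  rw [Fin.sum_univ_three]
  rw [hori]
  split_ifs with hξ
  · have hD := hX.mem_D t (hT₀.trans ht)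
    have hsm : 2 * Sb < rt := by linarith [hSbm.trans (min_le_left _ _)]
    have href := hX.abs_ref_sub_aux_le hP hb hξ hreg hm hm1
      (hvert _ hD ((hep2 t ht).trans_lt hsm))
      (Setup.eNorm_h_sub_le hb hD hkp.le hδp hδp' hSt (he t ht) (hp t ht)) hSm
    set D := 5 * (2 * kp * Sb + (Ep + 2 * Ee)) / (P.U * m ^ 2)
    have h1 : |toIcoMod Real.two_pi_pos (-Real.pi) (P.eo (X.η t) 1)| ≤ D + Ea := by
      refine (abs_toIcoMod_le (k := 0) (x := P.eo (X.η t) 1) (by simp)).trans ?_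
      have h2 := (abs_add_le _ _).trans (add_le_add href.1 hθ)
      rw [sub_add_sub_cancel] at h2
      exact h2
    have h3 : |toIcoMod Real.two_pi_pos (-Real.pi) (P.eo (X.η t) 2)| ≤ D + Ea := by
      obtain ⟨n, hn⟩ := toIcoMod_eq_add (P.yawRef (pos (X.η t)) - X.ψa t)
      refine (abs_toIcoMod_le (k := n) (x := toIcoMod Real.two_pi_pos (-Real.pi)
        (P.yawRef (pos (X.η t)) - X.ψa t) + (X.ψa t - yaw (X.η t))) ?_).trans ?_
      · have : P.eo (X.η t) 2 = (P.yawRef (pos (X.η t)) - X.ψa t) + (X.ψa t - yaw (X.η t)) := by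
          rw [sub_add_sub_cancel]; rfl
        rw [this]
        linarith
      · exact (abs_add_le _ _).trans (add_le_add href.2 hψ)
    linarith
  · have h1 := abs_toIcoMod_le_pi (P.eo (X.η t) 1)
    have h2 := abs_toIcoMod_le_pi (P.eo (X.η t) 2)
    linarith

/-! ### Choice of gains and bandwidths. -/

/-- Extension of a bound, by one, to parameters at which it is meaningless. -/
noncomputable def posOrOne (x : ℝ) : ℝ := open Classical in if 0 < x then x else 1

lemma posOrOne_pos (x : ℝ) : 0 < posOrOne x := by
  unfold posOrOne; split_ifs with h
  exacts [h, one_pos]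

lemma posOrOne_eq {x : ℝ} (h : 0 < x) : posOrOne x = x := if_pos h

lemma gainK_inl (κ ko : ℝ) : gainK κ ko (Sum.inl 0) (Sum.inl 0) = κ := by simp [gainK]

lemma gainK_inr (κ ko : ℝ) : gainK κ ko (Sum.inr 0) (Sum.inr 0) = ko := by simp [gainK]

section positivity

variable {B₀ C₀ m Ω κ ko k kp rdd rds : ℝ}

lemma levelBound_pos (hC : 0 < C₀) (hB : 0 < B₀) (hΩ : 0 < Ω) (hκ : 0 < κ) (hko : 0 < ko)
    (hk : 0 < k) (hkp : 0 < kp) (hd : 0 < rdd) (hs : 0 < rds) :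
    0 < levelBound C₀ B₀ Ω κ ko k kp rdd rds := by
  have := perturbBound_pos hB hΩ hκ hko hk hkp hd hs
  unfold levelBound; positivity

lemma orientBound_pos {P : RefPath} (hP : P.Admissible) (hm : 0 < m) (hC : 0 < C₀) (hB : 0 < B₀)
    (hΩ : 0 < Ω) (hκ : 0 < κ) (hko : 0 < ko) (hk : 0 < k) (hkp : 0 < kp) (hd : 0 < rdd)
    (hs : 0 < rds) : 0 < orientBound P m C₀ B₀ Ω κ ko k kp rdd rds := by
  have := levelBound_pos hC hB hΩ hκ hko hk hkp hd hs
  have := obsVelBound_pos hΩ hd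
  have := posVelBound_pos hΩ hκ hd hs
  have := auxBound_pos hB hΩ hko hk hkp hd
  have := hP.U_pos
  have := Real.pi_pos
  unfold orientBound
  split_ifs <;> positivity

/-- The perturbation is small for slow disturbances and strong transversal damping. -/
lemma exists_perturbBound_le_of_slow (hB : 0 < B₀) (hΩ : 0 < Ω) (hko : 0 < ko) (hk : 0 < k)
    (hkp : 0 < kp) {c : ℝ} (hc : 0 < c) :
    ∃ r₀ > (0 : ℝ), ∀ rds > (0 : ℝ), ∃ κ₀ > (0 : ℝ), ∀ κ ≥ κ₀, ∀ rdd : ℝ, 0 < rdd → rdd ≤ r₀ →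
      perturbBound B₀ Ω κ ko k kp rdd rds ≤ c := by
  set E := 36 / Ω + 66 / Ω ^ 2 +
    2 * (2 * (9 / Ω / ko + 11 / Ω ^ 2) + 11 / Ω ^ 2 + B₀ * (1 + kp) * (11 / Ω ^ 2)) / k with hE
  have hE0 : 0 < E := by positivity
  -- Half of `c` is allotted to each part of `perturbBound_le`. For `κ ≥ 1` the coefficient `E` of
  -- `rdd` involves neither `κ` nor `rds`, so `r₀` can be fixed before them.
  refine ⟨c / (2 * E), by positivity, fun rds hrds => ⟨max 1 (4 * rds / c), by positivity,
    fun κ hκ rdd hrdd hr => (perturbBound_le hΩ ((le_max_left _ _).trans hκ) hrdd).trans ?_⟩⟩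
  have hκ0 : 0 < κ := one_pos.trans_le ((le_max_left _ _).trans hκ)
  have h1 : 2 * rds / κ ≤ c / 2 := by
    have := (le_max_right _ _).trans hκ
    rw [div_le_iff₀ hc] at this
    rw [div_le_iff₀ hκ0]
    linarith
  have h2 : rdd * E ≤ c / 2 := by
    rw [le_div_iff₀ (by positivity)] at hr
    linarith
  rw [← hE]
  linarith

/-- The perturbation is small for fast observers and strong transversal damping. -/
lemma exists_perturbBound_le_of_fast (hB : 0 < B₀) (hko : 0 < ko) (hd : 0 < rdd)
    {c : ℝ} (hc : 0 < c) {κ : ℝ} (hκ : 1 ≤ κ) (hκ' : 4 * rds / c ≤ κ) (hkp : 0 < kp) :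
    ∃ ω₀ > (0 : ℝ), ∀ k ≥ (1 : ℝ), ∀ Ω ≥ ω₀, perturbBound B₀ Ω κ ko k kp rdd rds ≤ c := by
  set E := rdd * (36 + 66 + 2 * (2 * (9 / ko + 11) + 11 + B₀ * (1 + kp) * 11)) with hE
  have hE0 : 0 < E := by positivity
  -- For `Ω ≥ 1` and `k ≥ 1` the part of the perturbation proportional to `rdd` is at most `E / Ω`.
  -- Since `E` grows with `k_p`, the bandwidth has to be chosen after `k_p`.
  refine ⟨max 1 (2 * E / c), by positivity, fun k hk Ω hΩ => ?_⟩
  have hΩ1 : 1 ≤ Ω := (le_max_left _ _).trans hΩ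
  have hΩ0 : 0 < Ω := by linarith
  have hκ0 : 0 < κ := by linarith
  refine (perturbBound_le hΩ0 hκ hd).trans ?_
  have h1 : 2 * rds / κ ≤ c / 2 := by
    rw [div_le_iff₀ hc] at hκ'
    rw [div_le_iff₀ hκ0]
    linarith
  have hinv : ∀ a : ℝ, 0 ≤ a → a / Ω ^ 2 ≤ a / Ω := fun a ha =>
    div_le_div_of_nonneg_left ha hΩ0 (by nlinarith)
  have h2 : E / Ω ≤ c / 2 := by
    have := (le_max_right _ _).trans hΩ
    rw [div_le_iff₀ hc] at this
    rw [div_le_iff₀ hΩ0]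
    linarith
  have h3 : rdd * (36 / Ω + 66 / Ω ^ 2 +
      2 * (2 * (9 / Ω / ko + 11 / Ω ^ 2) + 11 / Ω ^ 2 + B₀ * (1 + kp) * (11 / Ω ^ 2)) / k) ≤
      E / Ω := by
    calc _ ≤ rdd * (36 / Ω + 66 / Ω ^ 2 + 2 * (2 * (9 / Ω / ko + 11 / Ω ^ 2) + 11 / Ω ^ 2 +
          B₀ * (1 + kp) * (11 / Ω ^ 2))) := by
          gcongr
          exact div_le_self (by positivity) hk
      _ ≤ rdd * (36 / Ω + 66 / Ω + 2 * (2 * (9 / Ω / ko + 11 / Ω) + 11 / Ω +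
          B₀ * (1 + kp) * (11 / Ω))) := by
          have h4 := hinv 11 (by norm_num)
          have h5 := hinv 66 (by norm_num)
          gcongr
      _ = E / Ω := by rw [hE]; field_simp
  linarith

end positivity

end VFOADR

theorem proposition1 (P : RefPath) (hP : P.Admissible) :
    ∃ ε₀ > (0 : ℝ), ∃ boundη boundp : ℝ → Design → ℝ → ℝ → ℝ,
      (∀ ωo G rdd rds, 0 < boundη ωo G rdd rds ∧ 0 < boundp ωo G rdd rds) ∧
      ∀ εf : ℝ, 0 < εf → εf ≤ ε₀ →
      ∀ ko δo δp : ℝ, 0 < ko → 0 ≤ δo → δo ≤ 1 → 0 ≤ δp → δp < 1 →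
      -- local satisfaction of both objectives, for any positive gains
      (∀ kθ kψ kp : ℝ, 0 < kθ → 0 < kψ → 0 < kp →
        ∀ (ω : DoF → ℝ) (ωo : ℝ), 0 < ωo → IsLeast (Set.range ω) ωo →
        ∃ r₀ > (0 : ℝ), ∀ rds > (0 : ℝ), ∃ κ₀ > (0 : ℝ), ∀ κ ≥ κ₀, ∀ rdd : ℝ, 0 < rdd → rdd ≤ r₀ →
          LocallyGuarantees P εf ω κ ko kθ kψ kp δo δp rdd rds
            (boundη ωo ⟨gainK κ ko, kθ, kψ, kp, δo, δp⟩ rdd rds)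
            (boundp ωo ⟨gainK κ ko, kθ, kψ, kp, δo, δp⟩ rdd rds)) ∧
      -- the bound on the positional error can be made arbitrarily small
      (∀ rdd > (0 : ℝ), ∀ rds > (0 : ℝ), ∃ κ₀ > (0 : ℝ), ∀ κ ≥ κ₀, ∀ ϵ > (0 : ℝ),
        ∃ k₀ > (0 : ℝ), ∀ kp ≥ k₀, ∃ ka₀ > (0 : ℝ), ∃ ω₀ > (0 : ℝ),
        ∀ kθ ≥ ka₀, ∀ kψ ≥ ka₀, ∀ (ω : DoF → ℝ) (ωo : ℝ), ω₀ ≤ ωo → IsLeast (Set.range ω) ωo →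
          LocallyGuarantees P εf ω κ ko kθ kψ kp δo δp rdd rds
            (boundη ωo ⟨gainK κ ko, kθ, kψ, kp, δo, δp⟩ rdd rds)
            (boundp ωo ⟨gainK κ ko, kθ, kψ, kp, δo, δp⟩ rdd rds) ∧
          boundp ωo ⟨gainK κ ko, kθ, kψ, kp, δo, δp⟩ rdd rds ≤ ϵ) := by
  obtain ⟨m, hm, C₀, hC₀, B₀, hB₀, ε₀, hε₀, c₁, hc₁, c₂, hc₂, hloc⟩ :=
    exists_locallyGuarantees_of_small hP
  -- The scalars `κ` and `k_o` are read off from diagonal entries of `K`. `posOrOne` makes the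
  -- functions positive at all arguments, including meaningless ones.
  refine ⟨ε₀, hε₀,
    fun Ω G rdd rds => posOrOne (2 * levelBound C₀ B₀ Ω (G.K (Sum.inl 0) (Sum.inl 0))
      (G.K (Sum.inr 0) (Sum.inr 0)) (min G.kθ G.kψ) G.kp rdd rds +
      orientBound P m C₀ B₀ Ω (G.K (Sum.inl 0) (Sum.inl 0))
      (G.K (Sum.inr 0) (Sum.inr 0)) (min G.kθ G.kψ) G.kp rdd rds),
    fun Ω G rdd rds => posOrOne (2 * levelBound C₀ B₀ Ω (G.K (Sum.inl 0) (Sum.inl 0))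
      (G.K (Sum.inr 0) (Sum.inr 0)) (min G.kθ G.kψ) G.kp rdd rds),
    fun _ _ _ _ => ⟨posOrOne_pos _, posOrOne_pos _⟩, ?_⟩
  intro εf hεf hεf' ko δo δp hko hδo hδo' hδp hδp'
  have hgen : ∀ κ kθ kψ kp rdd rds : ℝ, 0 < κ → 0 < kθ → 0 < kψ → 0 < kp → 0 < rdd → 0 < rds →
      ∀ (ω : DoF → ℝ) (ωo : ℝ), 0 < ωo → IsLeast (Set.range ω) ωo →
      perturbBound B₀ ωo κ ko (min kθ kψ) kp rdd rds ≤ c₁ →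
      perturbBound B₀ ωo κ ko (min kθ kψ) kp rdd rds ≤ c₂ * kp →
      LocallyGuarantees P εf ω κ ko kθ kψ kp δo δp rdd rds
        (posOrOne (2 * levelBound C₀ B₀ ωo κ ko (min kθ kψ) kp rdd rds +
          orientBound P m C₀ B₀ ωo κ ko (min kθ kψ) kp rdd rds))
        (posOrOne (2 * levelBound C₀ B₀ ωo κ ko (min kθ kψ) kp rdd rds)) := by
    intro κ kθ kψ kp rdd rds hκ hkθ hkψ hkp hrdd hrds ω ωo hωo hω h1 h2
    have hk : 0 < min kθ kψ := lt_min hkθ hkψ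
    have hl := levelBound_pos hC₀ hB₀ hωo hκ hko hk hkp hrdd hrds
    have ho := orientBound_pos hP hm hC₀ hB₀ hωo hκ hko hk hkp hrdd hrds
    rw [posOrOne_eq (by positivity), posOrOne_eq (by positivity)]
    exact hloc εf hεf hεf' ko δo δp hko hδo hδo' hδp hδp' κ kθ kψ kp rdd rds hκ hkθ hkψ hkp hrdd
      hrds ω ωo hωo (fun i => hω.2 ⟨i, rfl⟩) h1 h2
  simp only [gainK_inl, gainK_inr]
  constructor
  · intro kθ kψ kp hkθ hkψ hkp ω ωo hωo hω
    obtain ⟨r₀, hr₀, hr⟩ := exists_perturbBound_le_of_slow hB₀ hωo hko (lt_min hkθ hkψ) hkp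
      (lt_min hc₁ (mul_pos hc₂ hkp))
    refine ⟨r₀, hr₀, fun rds hrds => ?_⟩
    obtain ⟨κ₀, hκ₀, hκ⟩ := hr rds hrds
    refine ⟨κ₀, hκ₀, fun κ hκκ rdd hrdd hrr => ?_⟩
    have hQ := hκ κ hκκ rdd hrdd hrr
    exact hgen κ kθ kψ kp rdd rds (hκ₀.trans_le hκκ) hkθ hkψ hkp hrdd hrds ω ωo hωo hω
      (hQ.trans (min_le_left _ _)) (hQ.trans (min_le_right _ _))
  · intro rdd hrdd rds hrds
    refine ⟨max 1 (4 * rds / c₁), by positivity, fun κ hκ ϵ hϵ => ?_⟩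
    -- The first entry turns `Q ≤ c₁` into `Q ≤ c₂ k_p`; the second makes `2 C₀ Q / k_p ≤ ϵ`. As `Q`
    -- need not shrink with `ϵ`, `κ₀` does not depend on `ϵ`.
    refine ⟨max (c₁ / c₂) (2 * C₀ * c₁ / ϵ), by positivity, fun kp hkp => ?_⟩
    have hkp1 := (le_max_left _ _).trans hkp
    have hkp2 := (le_max_right _ _).trans hkp
    have hkp0 : 0 < kp := (div_pos hc₁ hc₂).trans_le hkp1
    have hκ1 : 1 ≤ κ := (le_max_left _ _).trans hκ
    have hκ0 : 0 < κ := one_pos.trans_le hκ1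
    obtain ⟨ω₀, hω₀, hQ⟩ := exists_perturbBound_le_of_fast (rds := rds) hB₀ hko hrdd hc₁ hκ1
      ((le_max_right _ _).trans hκ) hkp0
    -- The threshold `1` for `k_θ` and `k_ψ` suffices, because the bandwidth alone makes the
    -- auxiliary error small.
    refine ⟨1, one_pos, ω₀, hω₀, fun kθ hkθ kψ hkψ ω ωo hωo hω => ?_⟩
    have hkθ0 : 0 < kθ := one_pos.trans_le hkθ
    have hkψ0 : 0 < kψ := one_pos.trans_le hkψ
    have hωo0 := hω₀.trans_le hωo
    have h1 := hQ (min kθ kψ) (le_min hkθ hkψ) ωo hωo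
    have h2 : c₁ ≤ c₂ * kp := by
      rw [div_le_iff₀ hc₂] at hkp1
      linarith
    refine ⟨hgen κ kθ kψ kp rdd rds hκ0 hkθ0 hkψ0 hkp0 hrdd hrds ω ωo hωo0 hω h1 (h1.trans h2), ?_⟩
    rw [posOrOne_eq (mul_pos two_pos
      (levelBound_pos hC₀ hB₀ hωo0 hκ0 hko (lt_min hkθ0 hkψ0) hkp0 hrdd hrds)), levelBound]
    rw [div_le_iff₀ hϵ] at hkp2
    rw [← mul_div_assoc, div_le_iff₀ hkp0]
    have := mul_le_mul_of_nonneg_left h1 hC₀.le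
    linarith
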